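/- Theorem. Let $\omega>0$, $T=2\pi/\omega$, $\mathbb T_T=\mathbb R/T\mathbb Z$, let $\gamma\in\mathbb R$ and $g:\mathbb R\to\mathbb R$, and consider $$g(x)w_{tt}-w_{xx}+\gamma\,\delta_0(x)\,(w_t^3)_t=0\qquad\text{on }\mathbb R\times\mathbb R. \tag{1}$$ A $T$-periodic weak solution of (1) is a real function $w\in H^1(\mathbb R\times\mathbb T_T)$ with $\partial_t w(0,\cdot)\in L^3(\mathbb T_T)$ (the weak derivative of the trace of $w$ at $x=0$) such that for all $\psi\in C_c^\infty(\mathbb R\times\mathbb T_T)$ $$\int_{\mathbb R\times\mathbb T_T}\bigl(-g(x)\,\partial_tw\,\partial_t\psi+\partial_xw\,\partial_x\psi\bigr)\,d(x,t)-\gamma\int_0^T(\partial_tw(0,t))^3\,\partial_t\psi(0,t)\,dt=0 .$$ For $k\in\mathbb Z$ let $L_k=-\frac{d^2}{dx^2}-k^2\omega^2g(x)$ on $L^2(\mathbb R)$ with domain $H^2(\mathbb R)$. Assume: (C0) $g\in L^\infty(\mathbb R)$ is even, $g\not\equiv0$, and $\gamma\ne0$. (C1) For all odd $k\ge1$, $0$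 belongs neither to the essential spectrum of $L_k$ nor to the spectrum of the restriction of $L_k$ to odd functions (the Dirichlet spectrum of $L_k$). Then for every odd $k$ there is a unique $\Phi_k=\Phi_{-k}\in H^2(0,\infty)$ with $L_k\Phi_k=0$ on $(0,\infty)$ and $\Phi_k(0)=1$. (C2) There are $\rho,M>0$ with $|\Phi_k(x)|\le Me^{-\rho x}$ for all $x\ge0$ and all odd $k\ge1$. Let $l\ge1$ be an odd integer. Call $j\in\mathbb N$ good if either $\gamma<0$ and $\Phi'_{m\,l^j}(0)>0$ for some odd $m\ge1$, or $\gamma>0$ and $\Phi'_{m\,l^j}(0)<0$ for some odd $m\ge1$. Assume that infinitely many $j$ are good. For real sequences indexed by $\mathbb Z$ let $(y*z)_k=\sum_{i\in\mathbb Z}y_iz_{k-i}$. Let $\mathrm{Dom}(J)$ be the set of real sequences $z=(z_k)_{k\in\mathbb Z}$ with $z_k=0$ for even $k$, $z_{-k}=-z_k$, such that $z*z$ is well defined and belongs to $\ell^2$; let $$J(z)=\tfrac14\,(z*z*z*z)_0+\frac{T}{\gamma\omega^4}\sum_{k\text{ odd}}\frac{\Phi_k'(0)}{k^2}z_k^2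 ,$$ and for odd $r\ge1$ let $\mathcal D_r=\{z\in\mathrm{Dom}(J): z_k=0\text{ for all }k\not\equiv r\bmod 2r\}$. For $\alpha\in\mathrm{Dom}(J)$ put $$w_\alpha(x,t)=\sum_{k\text{ odd}}\frac{\alpha_k}{k}\Phi_k(|x|)\,\frac1{\sqrt T}e^{i\omega kt}.$$ Then: 1. Equation (1) has infinitely many distinct nontrivial $T$-periodic weak solutions. 2. For every good $j$, the functional $J$ attains its minimum on $\mathcal D_{l^j}$, and for every minimizer $\alpha$ one has $J(\alpha)<0$ and $w_\alpha$ is a nontrivial, $T$-periodic, $\frac{T}{2l^j}$-antiperiodic (in time) weak solution of (1). 3. If $l\neq1$, infinitely many distinct nontrivial solutions are obtained in this way: there are good indices $j_1<j_2<\dots$ and minimizers $\alpha^{(n)}$ of $J$ on $\mathcal D_{l^{j_n}}$ such that the weak solutions $w_{\alpha^{(n)}}$ are nontrivial and pairwise distinct. Here functions on $\mathbb R\times\mathbb T_T$ are distinct, resp. nontrivial, if they differ, resp. differ from $0$, on a set of positive measure. -/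

import Mathlib

open MeasureTheory Set

noncomputable section

namespace Breather

/-! ### Weak derivatives on open subsets of the line -/

/-- `v` is the weak derivative of `u` on the open set `Ω ⊆ ℝ`:
`∫_Ω φ' u = - ∫_Ω φ v` for all real test functions `φ ∈ C_c^∞(Ω)`. -/
def HasWeakDerivOn {E : Type*} [NormedAddCommGroup E] [NormedSpace ℝ E]
    (Ω : Set ℝ) (u v : ℝ → E) : Prop :=
  ∀ φ : ℝ → ℝ, ContDiff ℝ (⊤ : ℕ∞) φ → HasCompactSupport φ → tsupport φ ⊆ Ω →
    ∫ x in Ω, deriv φ x • u x = - ∫ x in Ω, φ x • v x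

/-! ### Spectra of unbounded operators -/

section Spectrum

variable {H : Type*} [NormedAddCommGroup H] [NormedSpace ℂ H]

/-- The resolvent set: `A - z : D(A) → H` is bijective with a bounded inverse `B`. -/
def resolventSet (A : H →ₗ.[ℂ] H) : Set ℂ :=
  {z | ∃ B : H →L[ℂ] H,
    (∀ f : H, ∃ h : B f ∈ A.domain, A ⟨B f, h⟩ - z • B f = f) ∧
    ∀ u : A.domain, B (A u - z • (u : H)) = u}

/-- The spectrum of an unbounded operator. -/
def spec (A : H →ₗ.[ℂ] H) : Set ℂ := (resolventSet A)ᶜ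

/-- The kernel of `A - z`, as a subspace of the domain of `A`. -/
def eigenspace (A : H →ₗ.[ℂ] H) (z : ℂ) : Submodule ℂ A.domain :=
  LinearMap.ker (A.toFun - z • A.domain.subtype)

/-- The discrete spectrum: isolated points of the spectrum which are eigenvalues of finite
multiplicity. -/
def discreteSpec (A : H →ₗ.[ℂ] H) : Set ℂ :=
  {z | z ∈ spec A ∧ (∃ ε > 0, spec A ∩ Metric.ball z ε = {z}) ∧
    eigenspace A z ≠ ⊥ ∧ FiniteDimensional ℂ (eigenspace A z)}

/-- The essential spectrum (of a self-adjoint operator): the complement of the discrete spectrum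
in the spectrum. -/
def essSpec (A : H →ₗ.[ℂ] H) : Set ℂ := spec A \ discreteSpec A

/-- The part of `A` in the subspace `M`: it is defined on those `u ∈ M ∩ D(A)` with `A u ∈ M`. -/
def partIn (A : H →ₗ.[ℂ] H) (M : Submodule ℂ H) : M →ₗ.[ℂ] M :=
  (A.graph.comap (M.subtype.prodMap M.subtype)).toLinearPMap

theorem partIn_graph (A : H →ₗ.[ℂ] H) (M : Submodule ℂ H) :
    (partIn A M).graph = A.graph.comap (M.subtype.prodMap M.subtype) := by
  apply Submodule.toLinearPMap_graph_eq
  rintro ⟨u, f⟩ h hu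
  simp only at hu
  subst hu
  have := A.graph_fst_eq_zero_snd h (by simp)
  simpa using this

end Spectrum

/-! ### The operators `L_k` -/

/-- The complex Hilbert space `L²(ℝ)`. -/
abbrev L2 : Type := Lp ℂ 2 (volume : Measure ℝ)

theorem integrable_smul_L2 {φ : ℝ → ℝ} (hφ : Continuous φ) (hc : HasCompactSupport φ) (u : L2) :
    Integrable (fun x => φ x • u x) :=
  ((Lp.memLp u).locallyIntegrable (by norm_num)).integrable_smul_left_of_hasCompactSupport hφ hc

theorem HasWeakDerivOn.add_L2 {u v u' v' : L2} (h : HasWeakDerivOn univ u u')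
    (k : HasWeakDerivOn univ v v') : HasWeakDerivOn univ (u + v : L2) (u' + v' : L2) := by
  intro φ h1 h2 h3
  have a := h φ h1 h2 h3
  have b := k φ h1 h2 h3
  simp only [Measure.restrict_univ] at a b ⊢
  have hd : Continuous (deriv φ) := h1.continuous_deriv (by simp)
  have e1 : ∫ x, deriv φ x • (u + v : L2) x = ∫ x, (deriv φ x • u x + deriv φ x • v x) := by
    refine integral_congr_ae ?_
    filter_upwards [Lp.coeFn_add u v] with x hx
    rw [hx, Pi.add_apply, smul_add]
  have e2 : ∫ x, φ x • (u' + v' : L2) x = ∫ x, (φ x • u' x + φ x • v' x) := by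
    refine integral_congr_ae ?_
    filter_upwards [Lp.coeFn_add u' v'] with x hx
    rw [hx, Pi.add_apply, smul_add]
  rw [e1, e2, integral_add (integrable_smul_L2 hd h2.deriv u) (integrable_smul_L2 hd h2.deriv v),
    integral_add (integrable_smul_L2 h1.continuous h2 u') (integrable_smul_L2 h1.continuous h2 v'),
    a, b]
  ring

theorem HasWeakDerivOn.smul_L2 {u u' : L2} (c : ℂ) (h : HasWeakDerivOn univ u u') :
    HasWeakDerivOn univ (c • u : L2) (c • u' : L2) := by
  intro φ h1 h2 h3
  have a := h φ h1 h2 h3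
  simp only [Measure.restrict_univ] at a ⊢
  have e1 : ∫ x, deriv φ x • (c • u : L2) x = ∫ x, c • (deriv φ x • u x) := by
    refine integral_congr_ae ?_
    filter_upwards [Lp.coeFn_smul c u] with x hx
    rw [hx, Pi.smul_apply, smul_comm]
  have e2 : ∫ x, φ x • (c • u' : L2) x = ∫ x, c • (φ x • u' x) := by
    refine integral_congr_ae ?_
    filter_upwards [Lp.coeFn_smul c u'] with x hx
    rw [hx, Pi.smul_apply, smul_comm]
  rw [e1, e2, integral_smul, integral_smul, a, smul_neg]

theorem HasWeakDerivOn.zero_L2 : HasWeakDerivOn univ (0 : L2) (0 : L2) := by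
  simpa using HasWeakDerivOn.smul_L2 (u := 0) (u' := 0) 0 (by
    intro φ h1 h2 h3
    have e (ψ : ℝ → ℝ) : ∫ x in univ, ψ x • (0 : L2) x = 0 := by
      refine integral_eq_zero_of_ae ?_
      rw [Measure.restrict_univ]
      filter_upwards [Lp.coeFn_zero ℂ 2 (volume : Measure ℝ)] with x hx
      rw [hx]
      simp
    rw [e, e, neg_zero])

theorem HasWeakDerivOn.eq_zero_L2 {u' : L2} (h : HasWeakDerivOn univ (0 : L2) u') : u' = 0 := by
  have key : ∀ᵐ x, u' x = 0 := by
    refine ae_eq_zero_of_integral_contDiff_smul_eq_zero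
      ((Lp.memLp u').locallyIntegrable (by norm_num)) ?_
    intro φ h1 h2
    have a := h φ h1 h2 (subset_univ _)
    have z : ∫ x in univ, deriv φ x • (0 : L2) x = 0 := by
      refine integral_eq_zero_of_ae ?_
      rw [Measure.restrict_univ]
      filter_upwards [Lp.coeFn_zero ℂ 2 (volume : Measure ℝ)] with x hx
      rw [hx]
      simp
    rw [z, Measure.restrict_univ] at a
    simpa using a.symm
  refine Lp.ext ?_
  filter_upwards [key, Lp.coeFn_zero ℂ 2 (volume : Measure ℝ)] with x h1 h2
  rw [h1, h2, Pi.zero_apply]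

/-- The graph of `-d²/dx² - c g(x)` in `L²(ℝ)`: the pairs `(u, f)` such that `u ∈ H²(ℝ)`
(that is, `u` has weak derivatives `u', u'' ∈ L²(ℝ)`) and `f = -u'' - c g u ∈ L²(ℝ)`. -/
def schrodingerGraph (g : ℝ → ℝ) (c : ℝ) : Submodule ℂ (L2 × L2) where
  carrier := {p | ∃ u' u'' : L2, HasWeakDerivOn univ p.1 u' ∧ HasWeakDerivOn univ u' u'' ∧
    ∀ᵐ x, p.2 x = - u'' x - ((c * g x : ℝ) : ℂ) * p.1 x}
  zero_mem' := by
    refine ⟨0, 0, HasWeakDerivOn.zero_L2, HasWeakDerivOn.zero_L2, ?_⟩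
    filter_upwards [Lp.coeFn_zero ℂ 2 (volume : Measure ℝ)] with x hx
    simp
  add_mem' := by
    rintro ⟨u, f⟩ ⟨v, k⟩ ⟨u', u'', h1, h2, h3⟩ ⟨v', v'', k1, k2, k3⟩
    refine ⟨u' + v', u'' + v'', h1.add_L2 k1, h2.add_L2 k2, ?_⟩
    filter_upwards [h3, k3, Lp.coeFn_add u v, Lp.coeFn_add f k, Lp.coeFn_add u'' v'']
      with x a b e1 e2 e3
    simp only [Prod.mk_add_mk, e1, e2, e3, Pi.add_apply, a, b]
    ring
  smul_mem' := by
    rintro z ⟨u, f⟩ ⟨u', u'', h1, h2, h3⟩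
    refine ⟨z • u', z • u'', h1.smul_L2 z, h2.smul_L2 z, ?_⟩
    filter_upwards [h3, Lp.coeFn_smul z u, Lp.coeFn_smul z f, Lp.coeFn_smul z u'']
      with x a e1 e2 e3
    simp only [Prod.smul_mk, e1, e2, e3, Pi.smul_apply, smul_eq_mul, a]
    ring

/-- The operator `-d²/dx² - c g(x)` in `L²(ℝ)`, with domain `H²(ℝ)` if `g` is bounded. -/
def schrodinger (g : ℝ → ℝ) (c : ℝ) : L2 →ₗ.[ℂ] L2 := (schrodingerGraph g c).toLinearPMap

theorem schrodinger_graph (g : ℝ → ℝ) (c : ℝ) : (schrodinger g c).graph = schrodingerGraph g c := by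
  apply Submodule.toLinearPMap_graph_eq
  rintro ⟨u, f⟩ ⟨u', u'', h1, h2, h3⟩ hu
  simp only at hu h1 h3
  subst hu
  obtain rfl := h1.eq_zero_L2
  obtain rfl := h2.eq_zero_L2
  refine Lp.ext ?_
  filter_upwards [h3, Lp.coeFn_zero ℂ 2 (volume : Measure ℝ)] with x a b
  rw [a, b]
  simp

/-- The subspace of odd functions in `L²(ℝ)`. -/
def oddL2 : Submodule ℂ L2 where
  carrier := {u | ∀ᵐ x, u (-x) = - u x}
  zero_mem' := by
    have h := Lp.coeFn_zero ℂ 2 (volume : Measure ℝ)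
    have h' := (Measure.measurePreserving_neg (volume : Measure ℝ)).quasiMeasurePreserving.ae h
    filter_upwards [h, h'] with x a b
    rw [a, b]
    simp
  add_mem' := by
    intro u v hu hv
    simp only [mem_ofPred_eq] at hu hv ⊢
    have h := Lp.coeFn_add u v
    have h' := (Measure.measurePreserving_neg (volume : Measure ℝ)).quasiMeasurePreserving.ae h
    filter_upwards [h, h', hu, hv] with x a b p q
    rw [a, b, Pi.add_apply, Pi.add_apply, p, q]
    ring
  smul_mem' := by
    intro c u hu
    simp only [mem_ofPred_eq] at hu ⊢
    have h := Lp.coeFn_smul c u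
    have h' := (Measure.measurePreserving_neg (volume : Measure ℝ)).quasiMeasurePreserving.ae h
    filter_upwards [h, h', hu] with x a b p
    rw [a, b, Pi.smul_apply, Pi.smul_apply, p, smul_neg]

/-- `L_k = -d²/dx² - k² ω² g(x)` on `L²(ℝ)`. -/
def Lop (g : ℝ → ℝ) (ω : ℝ) (k : ℤ) : L2 →ₗ.[ℂ] L2 := schrodinger g ((k : ℝ) ^ 2 * ω ^ 2)

/-- The Dirichlet spectrum of `L_k`: the spectrum of `L_k` restricted to odd functions. -/
def dirichletSpec (g : ℝ → ℝ) (ω : ℝ) (k : ℤ) : Set ℂ := spec (partIn (Lop g ω k) oddL2)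

/-! ### The assumptions on the coefficients -/

/-- `g ∈ L^∞(ℝ)` is even and does not vanish identically, and `γ ≠ 0`. -/
def C0 (g : ℝ → ℝ) (γ : ℝ) : Prop :=
  MemLp g ⊤ (volume : Measure ℝ) ∧ (∀ᵐ x, g (-x) = g x) ∧ (¬ ∀ᵐ x, g x = 0) ∧ γ ≠ 0

/-- For all odd `k ≥ 1`, `0` is neither in the essential nor in the Dirichlet spectrum of `L_k`. -/
def C1 (g : ℝ → ℝ) (ω : ℝ) : Prop :=
  ∀ k : ℕ, Odd k → (0 : ℂ) ∉ essSpec (Lop g ω k) ∪ dirichletSpec g ω k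

/-- `Φ ∈ H²(0,∞)` (in its continuous representative on `[0,∞)`) solves
`-Φ'' - k² ω² g Φ = 0` on `(0,∞)`, and `Φ(0) = 1`. -/
def IsDecayingSolution (g : ℝ → ℝ) (ω : ℝ) (k : ℤ) (Φ : ℝ → ℝ) : Prop :=
  ContinuousOn Φ (Ici 0) ∧ Φ 0 = 1 ∧
  ∃ Φ₁ Φ₂ : ℝ → ℝ,
    MemLp Φ 2 (volume.restrict (Ioi 0)) ∧ MemLp Φ₁ 2 (volume.restrict (Ioi 0)) ∧
    MemLp Φ₂ 2 (volume.restrict (Ioi 0)) ∧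
    HasWeakDerivOn (Ioi 0) Φ Φ₁ ∧ HasWeakDerivOn (Ioi 0) Φ₁ Φ₂ ∧
    ∀ᵐ x ∂(volume.restrict (Ioi 0)), - Φ₂ x - (k : ℝ) ^ 2 * ω ^ 2 * g x * Φ x = 0

open Classical in
/-- The solution `Φ_k` of the previous definition. For bounded `g` there is at most one, up to its
irrelevant values on `(-∞,0)`; the value is `0` if there is none. Note `Φ_{-k} = Φ_k`. -/
def Phi (g : ℝ → ℝ) (ω : ℝ) (k : ℤ) : ℝ → ℝ :=
  if h : ∃ Φ, IsDecayingSolution g ω k Φ then h.choose else 0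

/-- The one-sided derivative `Φ_k'(0)`. -/
def PhiDeriv (g : ℝ → ℝ) (ω : ℝ) (k : ℤ) : ℝ := derivWithin (Phi g ω k) (Ici 0) 0

theorem Phi_neg (g : ℝ → ℝ) (ω : ℝ) (k : ℤ) : Phi g ω (-k) = Phi g ω k := by
  have h : IsDecayingSolution g ω (-k) = IsDecayingSolution g ω k := by
    funext Φ
    simp [IsDecayingSolution]
  unfold Phi
  rw [h]

/-- The functions `Φ_k`, `k ≥ 1` odd, decay exponentially, uniformly in `k`. -/
def C2 (g : ℝ → ℝ) (ω : ℝ) : Prop :=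
  ∃ ρ > 0, ∃ M > 0, ∀ k : ℕ, Odd k → ∀ x : ℝ, 0 ≤ x → |Phi g ω k x| ≤ M * Real.exp (-ρ * x)

/-- Some `Φ'_{m l^j}(0)` with `m ≥ 1` odd is positive (if `γ < 0`), resp. negative
(if `γ > 0`). -/
def GoodIndex (g : ℝ → ℝ) (γ ω : ℝ) (l j : ℕ) : Prop :=
  ∃ m : ℕ, Odd m ∧
    ((γ < 0 ∧ 0 < PhiDeriv g ω (m * l ^ j : ℕ)) ∨ (0 < γ ∧ PhiDeriv g ω (m * l ^ j : ℕ) < 0))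

/-! ### Weak solutions on `ℝ × 𝕋_T`

Functions on `ℝ × 𝕋_T` are represented by functions of `(x, t) ∈ ℝ × ℝ` which are `T`-periodic
in `t`, and integrated over the strip `ℝ × (0, T]`. -/

/-- The measure of `ℝ × 𝕋_T`. -/
def stripMeasure (T : ℝ) : Measure (ℝ × ℝ) := volume.prod (volume.restrict (Ioc 0 T))

/-- The measure of the half cylinder `(0,∞) × 𝕋_T`. -/
def halfStripMeasure (T : ℝ) : Measure (ℝ × ℝ) :=
  (volume.restrict (Ioi 0)).prod (volume.restrict (Ioc 0 T))

/-- Periodicity in the time variable. -/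
def TimePeriodic (T : ℝ) (w : ℝ × ℝ → ℝ) : Prop := ∀ x t, w (x, t + T) = w (x, t)

/-- Test functions: `C_c^∞(ℝ × 𝕋_T)`. -/
def IsTest (T : ℝ) (ψ : ℝ × ℝ → ℝ) : Prop :=
  ContDiff ℝ (⊤ : ℕ∞) ψ ∧ TimePeriodic T ψ ∧ ∃ R : ℝ, ∀ x t, R < |x| → ψ (x, t) = 0

/-- The classical partial derivative `∂_x ψ`. -/
def dx (ψ : ℝ × ℝ → ℝ) (p : ℝ × ℝ) : ℝ := deriv (fun x => ψ (x, p.2)) p.1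

/-- The classical partial derivative `∂_t ψ`. -/
def dt (ψ : ℝ × ℝ → ℝ) (p : ℝ × ℝ) : ℝ := deriv (fun t => ψ (p.1, t)) p.2

/-- `wx` is the weak partial derivative `∂_x w` on `ℝ × 𝕋_T`. -/
def IsWeakDx (T : ℝ) (w wx : ℝ × ℝ → ℝ) : Prop :=
  ∀ ψ, IsTest T ψ → ∫ p, w p * dx ψ p ∂(stripMeasure T) = - ∫ p, wx p * ψ p ∂(stripMeasure T)

/-- `wt` is the weak partial derivative `∂_t w` on `ℝ × 𝕋_T`. -/
def IsWeakDt (T : ℝ) (w wt : ℝ × ℝ → ℝ) : Prop :=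
  ∀ ψ, IsTest T ψ → ∫ p, w p * dt ψ p ∂(stripMeasure T) = - ∫ p, wt p * ψ p ∂(stripMeasure T)

/-- `v ∈ L²(𝕋_T)` is the trace `w(0,·)` of `w ∈ H¹(ℝ × 𝕋_T)` (where `wx = ∂_x w`), determined by
Green's formula `∫_{x>0} (∂_x w ψ + w ∂_x ψ) = - ∫_0^T w(0,t) ψ(0,t) dt`. -/
def IsTraceAtZero (T : ℝ) (w wx : ℝ × ℝ → ℝ) (v : ℝ → ℝ) : Prop :=
  MemLp v 2 (volume.restrict (Ioc 0 T)) ∧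
  ∀ ψ, IsTest T ψ →
    ∫ p, (wx p * ψ p + w p * dx ψ p) ∂(halfStripMeasure T) = - ∫ t in Ioc 0 T, v t * ψ (0, t)

/-- `v'` is the weak derivative of `v` on the circle `𝕋_T`. -/
def IsWeakDerivCircle (T : ℝ) (v v' : ℝ → ℝ) : Prop :=
  ∀ φ : ℝ → ℝ, ContDiff ℝ (⊤ : ℕ∞) φ → Function.Periodic φ T →
    ∫ t in Ioc 0 T, v t * deriv φ t = - ∫ t in Ioc 0 T, v' t * φ t

/-- `w` is a `T`-periodic weak solution of `g(x) w_tt - w_xx + γ δ₀(x) (w_t³)_t = 0`: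
`w ∈ H¹(ℝ × 𝕋_T)`, the weak derivative `u = ∂_t w(0,·)` of the trace belongs to `L³(𝕋_T)`, and
the weak form of the equation holds for all test functions. -/
def IsWeakSolution (g : ℝ → ℝ) (γ T : ℝ) (w : ℝ × ℝ → ℝ) : Prop :=
  TimePeriodic T w ∧ MemLp w 2 (stripMeasure T) ∧
  ∃ wx wt : ℝ × ℝ → ℝ, MemLp wx 2 (stripMeasure T) ∧ MemLp wt 2 (stripMeasure T) ∧
    IsWeakDx T w wx ∧ IsWeakDt T w wt ∧
    ∃ v u : ℝ → ℝ, IsTraceAtZero T w wx v ∧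
      MemLp u 3 (volume.restrict (Ioc 0 T)) ∧ IsWeakDerivCircle T v u ∧
      ∀ ψ, IsTest T ψ →
        ∫ p, (- g p.1 * wt p * dt ψ p + wx p * dx ψ p) ∂(stripMeasure T)
          - γ * ∫ t in Ioc 0 T, (u t) ^ 3 * dt ψ (0, t) = 0

/-- `w` does not vanish almost everywhere. -/
def IsNontrivial (T : ℝ) (w : ℝ × ℝ → ℝ) : Prop := ¬ w =ᵐ[stripMeasure T] 0

/-- The functions `w n` are pairwise distinct (as classes of functions modulo null sets). -/
def PairwiseDistinct (T : ℝ) (w : ℕ → ℝ × ℝ → ℝ) : Prop :=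
  ∀ m n, m ≠ n → ¬ w m =ᵐ[stripMeasure T] w n

/-! ### The functional `J` and the symmetric subspaces -/

/-- Convolution of two-sided sequences. -/
def conv (y z : ℤ → ℝ) (k : ℤ) : ℝ := ∑' l, y l * z (k - l)

/-- The space `Dom(J)` of the real sequences `(z_k)`, `k` odd (extended by `0` to even `k`), with
`z_{-k} = - z_k` and `z * z ∈ ℓ²`; the latter includes that the convolution converges. -/
def DomJ : Set (ℤ → ℝ) :=
  {z | (∀ k, Even k → z k = 0) ∧ (∀ k, z (-k) = - z k) ∧
    (∀ k, Summable fun l => z l * z (k - l)) ∧ Summable fun k => (conv z z k) ^ 2}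

/-- The functional `J(z) = (z*z*z*z)_0 / 4 + T / (γ ω⁴) ∑_k Φ_k'(0) / k² z_k²`. -/
def J (g : ℝ → ℝ) (γ ω T : ℝ) (z : ℤ → ℝ) : ℝ :=
  1 / 4 * conv (conv z z) (conv z z) 0
    + T / (γ * ω ^ 4) * ∑' k : ℤ, PhiDeriv g ω k / (k : ℝ) ^ 2 * z k ^ 2

/-- The subspace `𝒟_r` of `Dom(J)`: only the entries with index `k ≡ r` modulo `2r` are
occupied. -/
def symDom (r : ℕ) : Set (ℤ → ℝ) :=
  {z | z ∈ DomJ ∧ ∀ k : ℤ, ¬ k ≡ r [ZMOD (2 * (r : ℤ))] → z k = 0}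

/-- `α` is a minimizer of `J` on `𝒟_r`. -/
def IsMinimizer (g : ℝ → ℝ) (γ ω T : ℝ) (r : ℕ) (α : ℤ → ℝ) : Prop :=
  α ∈ symDom r ∧ ∀ z ∈ symDom r, J g γ ω T α ≤ J g γ ω T z

/-- `w(x,t) = ∑_{k odd} (α_k / k) Φ_k(|x|) e_k(t)` with `e_k(t) = T^{-1/2} e^{iωkt}`. -/
def IsGeneratedBy (g : ℝ → ℝ) (ω T : ℝ) (α : ℤ → ℝ) (w : ℝ × ℝ → ℝ) : Prop :=
  ∀ x t : ℝ, HasSum (fun k : {k : ℤ // Odd k} =>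
    ((α k / (k : ℤ) * Phi g ω k |x| / Real.sqrt T : ℝ) : ℂ)
      * Complex.exp (Complex.I * ω * (k : ℤ) * t)) (w (x, t) : ℂ)

/-- `τ`-antiperiodicity in time. -/
def TimeAntiperiodic (τ : ℝ) (w : ℝ × ℝ → ℝ) : Prop := ∀ x t, w (x, t + τ) = - w (x, t)

end Breather

end

noncomputable section

namespace Breather

open Filter Topology

/-! ### Weak derivatives and primitives on the line -/

/-! Off `x = 0` each mode `Φ_k(|x|) e^{iωkt}` already solves the linear equation, so a superposition
of modes solves (1) as soon as the jump of `∂_x w` across `x = 0` balances the cubic term. Put `f =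
∑ α_k sin(ωkt)`. Then `∂_t w(0,·) = -(ω/√T) f`, and the balance says that `f³` is the sine series
with coefficients `-2 b_k α_k`, where `b_k = T Φ_k'(0) / (γ ω⁴ k²)`. Since `z * z` is minus the
sequence of Fourier coefficients of `f²`, Parseval turns `J` into `¼ ∫ f⁴ + ∑ b_k z_k²` (normalized
measure), and the balance is the Euler-Lagrange equation of this functional.

Minimizers come from the direct method (`exists_weightedJ_minimizer`). The quartic part dominates
the square of the `ℓ²` norm, which gives coercivity. The uniform decay of the profiles, interpolated
against the ODE, gives `Φ_k'(0) = O(k)` (`exists_profile_of_nat`); hence `b_k → 0` and the quadratic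
part is weakly continuous, while the quartic part is weakly lower semicontinuous
(`integral_pow_four_le_of_tendsto_coeff`). A good index supplies a negative `b_k` at a mode allowed
in the symmetric class, so the minimum is negative and minimizers are nonzero.

Variations inside the class suffice for the full equation because `r + r + r ≡ r` modulo `2r`: the
cube of `f` has no modes outside the class (`IsSineSeries.cube_of_minimizer`). The same equation is
a regularity statement: a priori `f³` is only integrable, but its coefficients are bounded multiples
of `α ∈ ℓ²`, so `f³ ∈ L²` and `f ∈ L³`. The series for `w` converges uniformly, those for `∂_x w`
and `∂_t w` in `L²` of the cylinder by orthogonality, and the weak equation is checked mode by mode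
(`IsProfileSystem.weak_equation`).

For `l > 1` a nonzero element of `𝒟_{l^j}` lives on multiples of `l^j`, so it cannot lie in the
spaces with much larger `j`; this separates infinitely many minimizers. For `l = 1` all these spaces
coincide, and infinitely many solutions are obtained as time translates of a single antiperiodic one
(`pairwiseDistinct_shift`). -/

theorem intervalIntegrable_of_locallyIntegrable {V : ℝ → ℝ} (hV : LocallyIntegrable V)
    (a b : ℝ) : IntervalIntegrable V volume a b :=
  (hV.integrableOn_isCompact isCompact_uIcc).intervalIntegrable

/-- A primitive of a locally integrable function is absolutely continuous with derivative `V` almost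
everywhere (Lebesgue), which is all that integration by parts requires. -/
theorem integral_deriv_mul_add_mul_primitive {V F φ : ℝ → ℝ} {c : ℝ} (hV : LocallyIntegrable V)
    (hF : ∀ x, F x = c + ∫ t in (0 : ℝ)..x, V t) (hφ : ContDiff ℝ 1 φ) (a b : ℝ) :
    ∫ x in a..b, (deriv φ x * F x + φ x * V x) = φ b * F b - φ a * F a := by
  have hac : AbsolutelyContinuousOnInterval φ a b :=
    hφ.contDiffOn.absolutelyContinuousOnInterval
  have hF' : F = fun x => (c + ∫ t in (0 : ℝ)..a, V t) + ∫ t in a..x, V t := by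
    funext x
    rw [hF, add_assoc, intervalIntegral.integral_add_adjacent_intervals
      (intervalIntegrable_of_locallyIntegrable hV _ _)
      (intervalIntegrable_of_locallyIntegrable hV _ _)]
  have hFac : AbsolutelyContinuousOnInterval F a b := by
    rw [hF']
    have h1 : AbsolutelyContinuousOnInterval (fun _ : ℝ => c + ∫ t in (0 : ℝ)..a, V t) a b :=
      (contDiffOn_const (n := 1)).absolutelyContinuousOnInterval
    exact h1.add ((intervalIntegrable_of_locallyIntegrable hV a b)
      |>.absolutelyContinuousOnInterval_intervalIntegral left_mem_uIcc)
  rw [← hac.integral_deriv_mul_eq_sub hFac]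
  refine intervalIntegral.integral_congr_ae ?_
  filter_upwards [LocallyIntegrable.ae_hasDerivAt_integral hV] with x hx _
  have := (hx a).const_add (c + ∫ t in (0 : ℝ)..a, V t)
  rw [hF']
  simp only
  rw [this.deriv]

theorem exists_forall_abs_lt_of_hasCompactSupport {φ : ℝ → ℝ} (h : HasCompactSupport φ) :
    ∃ R > 0, ∀ x, R ≤ |x| → φ x = 0 ∧ deriv φ x = 0 := by
  obtain ⟨R, hR, hs⟩ := h.isCompact.isBounded.subset_closedBall_lt 0 0
  refine ⟨R + 1, by positivity, fun x hx => ?_⟩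
  have hx' : x ∉ tsupport φ := fun hm => by
    have := hs hm
    simp only [Metric.mem_closedBall, dist_zero_right, Real.norm_eq_abs] at this
    linarith
  refine ⟨image_eq_zero_of_notMem_tsupport hx', ?_⟩
  by_contra hd
  exact hx' (support_deriv_subset hd)

theorem integral_Ioi_deriv_mul_add_mul_primitive {V F φ : ℝ → ℝ} {c : ℝ}
    (hV : LocallyIntegrable V)
    (hF : ∀ x, F x = c + ∫ t in (0 : ℝ)..x, V t) (hφ : ContDiff ℝ 1 φ)
    (hc : HasCompactSupport φ) :
    ∫ x in Ioi 0, (deriv φ x * F x + φ x * V x) = - (φ 0 * F 0) := by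
  obtain ⟨R, hR, hs⟩ := exists_forall_abs_lt_of_hasCompactSupport hc
  have := integral_deriv_mul_add_mul_primitive hV hF hφ 0 R
  rw [(hs R (le_abs_self R)).1, intervalIntegral.integral_of_le hR.le] at this
  rw [setIntegral_eq_of_subset_of_forall_sdiff_eq_zero measurableSet_Ioi
    (Ioc_subset_Ioi_self : Ioc 0 R ⊆ Ioi 0), this]
  · ring
  · rintro x ⟨hx, hx'⟩
    have : R ≤ |x| := by
      simp only [mem_Ioi, mem_Ioc, not_and, not_le] at hx hx'
      rw [abs_of_pos hx]
      exact (hx' hx).le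
    simp [hs x this]

theorem integral_deriv_mul_primitive {V F φ : ℝ → ℝ} {c : ℝ}
    (hV : LocallyIntegrable V)
    (hF : ∀ x, F x = c + ∫ t in (0 : ℝ)..x, V t) (hφ : ContDiff ℝ 1 φ)
    (hc : HasCompactSupport φ) :
    ∫ x, (deriv φ x * F x + φ x * V x) = 0 := by
  obtain ⟨R, hR, hs⟩ := exists_forall_abs_lt_of_hasCompactSupport hc
  have := integral_deriv_mul_add_mul_primitive hV hF hφ (-R) R
  rw [(hs R (le_abs_self R)).1, (hs (-R) (by rw [abs_neg]; exact le_abs_self R)).1,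
    intervalIntegral.integral_of_le (by linarith)] at this
  rw [← setIntegral_eq_integral_of_forall_compl_eq_zero (s := Ioc (-R) R), this]
  · ring
  · intro x hx'
    have : R ≤ |x| := by
      by_contra hlt
      rw [not_le, abs_lt] at hlt
      exact hx' ⟨hlt.1, hlt.2.le⟩
    simp [hs x this]

theorem continuous_primitive_of_locallyIntegrable {V : ℝ → ℝ} (hV : LocallyIntegrable V) :
    Continuous fun x => ∫ t in (0 : ℝ)..x, V t :=
  intervalIntegral.continuous_primitive (intervalIntegrable_of_locallyIntegrable hV) 0

/-- A function on an interval whose weak derivative vanishes is constant. -/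
theorem HasWeakDerivOn.ae_eq_const {Ω : Set ℝ} (ho : IsOpen Ω) (hconn : Ω.OrdConnected)
    (hne : Ω.Nonempty) {h : ℝ → ℝ} (hi : LocallyIntegrableOn h Ω)
    (hw : HasWeakDerivOn Ω h 0) : ∃ c, ∀ᵐ x, x ∈ Ω → h x = c := by
  obtain ⟨p, hp⟩ := hne
  obtain ⟨ε, hε, hball⟩ := Metric.isOpen_iff.1 ho p hp
  let b : ContDiffBump p := ⟨ε / 4, ε / 2, by positivity, by linarith⟩
  set η : ℝ → ℝ := b.normed volume
  have hη1 : ∫ x, η x = 1 := b.integral_normed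
  have hηc : HasCompactSupport η := b.hasCompactSupport_normed
  have hηs : tsupport η ⊆ Ω := by
    rw [b.tsupport_normed_eq]
    exact (Metric.closedBall_subset_ball (by change ε / 2 < ε; linarith)).trans hball
  have hηd : ContDiff ℝ (⊤ : ℕ∞) η := b.contDiff_normed
  have hint {φ : ℝ → ℝ} (h1 : ContDiff ℝ (⊤ : ℕ∞) φ) (h2 : HasCompactSupport φ)
      (h3 : tsupport φ ⊆ Ω) : Integrable fun x => φ x * h x := by
    have := (hi.integrableOn_compact_subset h3 h2).continuousOn_mul (g := φ) h1.continuous.continuousOn h2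
    rw [integrableOn_iff_integrable_of_support_subset] at this
    · exact this
    · intro x hx
      exact subset_tsupport _ (fun h0 => hx (by simp [h0]))
  have hset {φ : ℝ → ℝ} (h3 : tsupport φ ⊆ Ω) (k : ℝ → ℝ) :
      ∫ x in Ω, φ x * k x = ∫ x, φ x * k x := by
    refine setIntegral_eq_integral_of_forall_compl_eq_zero fun x hx => ?_
    rw [image_eq_zero_of_notMem_tsupport (fun hm => hx (h3 hm)), zero_mul]
  refine ⟨∫ x, η x * h x, ?_⟩
  -- The constant is the `η`-average of `h`; the fundamental lemma of the calculus of variations is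
  -- applied to `h - c`.
  set c := ∫ x, η x * h x
  have hic : LocallyIntegrableOn (fun x => h x - c) Ω :=
    hi.sub (continuous_const.locallyIntegrable.locallyIntegrableOn Ω)
  refine (ho.ae_eq_zero_of_integral_contDiff_smul_eq_zero hic ?_).mono
    fun x hx hm => sub_eq_zero.1 (hx hm)
  intro φ h1 h2 h3
  set m := ∫ x, φ x
  -- The correction by `m η` makes the mean vanish, so that the primitive of `θ` has compact support
  -- and is an admissible test function.
  set θ : ℝ → ℝ := fun x => φ x - m * η x
  have hθd : ContDiff ℝ (⊤ : ℕ∞) θ := h1.sub (contDiff_const.mul hηd)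
  have hθ0 : ∫ x, θ x = 0 := by
    simp only [θ]
    rw [integral_sub (h1.continuous.integrable_of_hasCompactSupport h2)
      ((hηd.continuous.integrable_of_hasCompactSupport hηc).const_mul m), integral_const_mul, hη1]
    simp [m]
  have hKc : IsCompact (tsupport φ ∪ tsupport η) := h2.isCompact.union hηc.isCompact
  have hKne : (tsupport φ ∪ tsupport η).Nonempty := by
    refine ⟨p, Or.inr ?_⟩
    rw [b.tsupport_normed_eq]
    exact Metric.mem_closedBall_self (by change 0 ≤ ε / 2; positivity)
  obtain ⟨lo, hlo, hlo'⟩ := hKc.exists_isLeast hKne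
  obtain ⟨hi', hhi, hhi'⟩ := hKc.exists_isGreatest hKne
  have hKsub : tsupport φ ∪ tsupport η ⊆ Ω := union_subset h3 hηs
  have hθout : ∀ x, x ∉ Icc lo hi' → θ x = 0 := by
    intro x hx
    have : x ∉ tsupport φ ∪ tsupport η := fun hm => hx ⟨hlo' hm, hhi' hm⟩
    rw [mem_union, not_or] at this
    simp [θ, image_eq_zero_of_notMem_tsupport this.1, image_eq_zero_of_notMem_tsupport this.2]
  set χ : ℝ → ℝ := fun x => ∫ t in lo..x, θ t
  have hχder : ∀ x, HasDerivAt χ (θ x) x := fun x =>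
    intervalIntegral.integral_hasDerivAt_right (hθd.continuous.intervalIntegrable _ _)
      (hθd.continuous.stronglyMeasurableAtFilter _ _) hθd.continuous.continuousAt
  have hχ' : deriv χ = θ := funext fun x => (hχder x).deriv
  have hχd : ContDiff ℝ (⊤ : ℕ∞) χ := by
    rw [contDiff_infty_iff_deriv]
    exact ⟨fun x => (hχder x).differentiableAt, hχ' ▸ hθd⟩
  have hχout : ∀ x, x ∉ Icc lo hi' → χ x = 0 := by
    intro x hx
    rw [mem_Icc, not_and_or, not_le, not_le] at hx
    rcases hx with hx | hx
    · simp only [χ]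
      rw [intervalIntegral.integral_symm, intervalIntegral.integral_of_le hx.le, neg_eq_zero,
        ← integral_Ico_eq_integral_Ioc]
      exact setIntegral_eq_zero_of_forall_eq_zero fun t ht => hθout t
        (fun hm => absurd hm.1 (not_le.2 ht.2))
    · have : lo ≤ hi' := hlo' hhi
      simp only [χ]
      rw [intervalIntegral.integral_of_le (by linarith), ← integral_Icc_eq_integral_Ioc,
        setIntegral_eq_integral_of_forall_compl_eq_zero, hθ0]
      intro t ht
      exact hθout t fun hm => ht ⟨hm.1, hm.2.trans hx.le⟩
  have hχs : tsupport χ ⊆ Icc lo hi' :=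
    closure_minimal (fun x hx => by by_contra hn; exact hx (hχout x hn)) isClosed_Icc
  have hχc : HasCompactSupport χ := isCompact_Icc.of_isClosed_subset (isClosed_tsupport _) hχs
  -- This is where connectedness enters: the primitive may be nonzero between the two supports, and
  -- `Ω` contains that whole interval.
  have hχΩ : tsupport χ ⊆ Ω := hχs.trans (hconn.out (hKsub hlo) (hKsub hhi))
  have key := hw χ hχd hχc hχΩ
  simp only [hχ', smul_eq_mul, Pi.zero_apply, mul_zero, integral_zero, neg_zero] at key
  have hθs : tsupport θ ⊆ Ω := by
    refine (closure_minimal (fun x hx => ?_) isClosed_Icc).trans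
      (hconn.out (hKsub hlo) (hKsub hhi))
    by_contra hn
    exact hx (hθout x hn)
  rw [hset hθs] at key
  have e : ∫ x, θ x * h x = (∫ x, φ x * h x) - m * c := by
    simp only [c, ← integral_const_mul]
    rw [← integral_sub (hint h1 h2 h3) ((hint hηd hηc hηs).const_mul m)]
    refine integral_congr_ae (ae_of_all _ fun x => ?_)
    simp only [θ]
    ring
  simp only [smul_eq_mul, mul_sub]
  rw [integral_sub (hint h1 h2 h3)
    ((h1.continuous.integrable_of_hasCompactSupport h2).mul_const c), integral_mul_const]
  linarith [e, key]

/-- A function with a weak derivative on an interval is a primitive of it. -/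
theorem HasWeakDerivOn.ae_eq_primitive {Ω : Set ℝ} (ho : IsOpen Ω) (hconn : Ω.OrdConnected)
    (hne : Ω.Nonempty) {u v V : ℝ → ℝ} (hi : LocallyIntegrableOn u Ω)
    (hV : LocallyIntegrable V) (hVv : ∀ᵐ x ∂volume.restrict Ω, v x = V x)
    (hw : HasWeakDerivOn Ω u v) : ∃ c, ∀ᵐ x, x ∈ Ω → u x = c + ∫ t in (0 : ℝ)..x, V t := by
  have hcont := continuous_primitive_of_locallyIntegrable hV
  have hi' : LocallyIntegrableOn (fun x => u x - ∫ t in (0 : ℝ)..x, V t) Ω :=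
    hi.sub (hcont.locallyIntegrable.locallyIntegrableOn Ω)
  obtain ⟨c, hc⟩ := HasWeakDerivOn.ae_eq_const ho hconn hne hi' (by
    intro φ h1 h2 h3
    have hd : Continuous (deriv φ) := h1.continuous_deriv (by simp)
    have hs3 : tsupport (deriv φ) ⊆ Ω := tsupport_deriv_subset.trans h3
    have i1 : IntegrableOn (fun x => deriv φ x * u x) Ω := by
      have := (hi.integrableOn_compact_subset hs3 h2.deriv).continuousOn_mul (g := deriv φ)
        hd.continuousOn h2.deriv
      rw [integrableOn_iff_integrable_of_support_subset] at this
      · exact this.integrableOn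
      · intro x hx
        exact subset_tsupport _ (fun h0 => hx (by simp [h0]))
    have i2 : Integrable (fun x => deriv φ x * ∫ t in (0 : ℝ)..x, V t) :=
      (hd.mul hcont).integrable_of_hasCompactSupport (h2.deriv.mul_right)
    have a := hw φ h1 h2 h3
    have b := integral_deriv_mul_primitive (F := fun x => ∫ t in (0 : ℝ)..x, V t) (c := 0) hV
      (by simp) (h1.of_le (by simp)) h2
    have i3 : Integrable (fun x => φ x * V x) :=
      hV.integrable_smul_left_of_hasCompactSupport h1.continuous h2
    rw [integral_add i2 i3] at b
    have e2 : ∫ x in Ω, deriv φ x * ∫ t in (0 : ℝ)..x, V t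
        = ∫ x, deriv φ x * ∫ t in (0 : ℝ)..x, V t := by
      refine setIntegral_eq_integral_of_forall_compl_eq_zero fun x hx => ?_
      rw [image_eq_zero_of_notMem_tsupport (fun hm => hx (hs3 hm)), zero_mul]
    have e3 : ∫ x in Ω, φ x * V x = ∫ x, φ x * V x := by
      refine setIntegral_eq_integral_of_forall_compl_eq_zero fun x hx => ?_
      rw [image_eq_zero_of_notMem_tsupport (fun hm => hx (h3 hm)), zero_mul]
    have e4 : ∫ x in Ω, φ x * v x = ∫ x in Ω, φ x * V x := by
      refine integral_congr_ae ?_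
      filter_upwards [hVv] with x hx
      rw [hx]
    simp only [smul_eq_mul, mul_sub, Pi.zero_apply, mul_zero, integral_zero, neg_zero] at a ⊢
    rw [integral_sub i1 i2.integrableOn, a, e2, e4, e3]
    linarith)
  exact ⟨c, hc.mono fun x hx hm => by linarith [hx hm]⟩

/-! ### The decaying solutions -/

theorem HasWeakDerivOn.mono_univ {u v : ℝ → ℝ} (h : HasWeakDerivOn univ u v) (Ω : Set ℝ) :
    HasWeakDerivOn Ω u v := by
  intro φ h1 h2 h3
  have a := h φ h1 h2 (subset_univ _)
  simp only [Measure.restrict_univ] at a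
  rw [setIntegral_eq_integral_of_forall_compl_eq_zero, a,
    setIntegral_eq_integral_of_forall_compl_eq_zero]
  · intro x hx
    rw [image_eq_zero_of_notMem_tsupport (fun hm => hx (h3 hm)), zero_smul]
  · intro x hx
    rw [image_eq_zero_of_notMem_tsupport (fun hm => hx (h3 (tsupport_deriv_subset hm))), zero_smul]

theorem HasWeakDerivOn.sub_of_locallyIntegrable {u v u' v' : ℝ → ℝ}
    (hu : LocallyIntegrable u) (hv : LocallyIntegrable v) (hu' : LocallyIntegrable u')
    (hv' : LocallyIntegrable v') (h : HasWeakDerivOn univ u u') (k : HasWeakDerivOn univ v v') :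
    HasWeakDerivOn univ (fun x => u x - v x) (fun x => u' x - v' x) := by
  intro φ h1 h2 h3
  have a := h φ h1 h2 h3
  have b := k φ h1 h2 h3
  have hd : Continuous (deriv φ) := h1.continuous_deriv (by simp)
  simp only [Measure.restrict_univ, smul_sub] at a b ⊢
  rw [integral_sub (hu.integrable_smul_left_of_hasCompactSupport hd h2.deriv)
      (hv.integrable_smul_left_of_hasCompactSupport hd h2.deriv),
    integral_sub (hu'.integrable_smul_left_of_hasCompactSupport h1.continuous h2)
      (hv'.integrable_smul_left_of_hasCompactSupport h1.continuous h2), a, b]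
  ring

theorem HasWeakDerivOn.congr_ae {Ω : Set ℝ} {u v w : ℝ → ℝ} (h : HasWeakDerivOn Ω u v)
    (huw : ∀ᵐ x, u x = w x) : HasWeakDerivOn Ω w v := by
  intro φ h1 h2 h3
  rw [← h φ h1 h2 h3]
  refine integral_congr_ae ?_
  filter_upwards [ae_restrict_of_ae huw] with x hx
  rw [hx]

theorem hasWeakDerivOn_univ_of_contDiff {χ : ℝ → ℝ} (hχ : ContDiff ℝ (⊤ : ℕ∞) χ) :
    HasWeakDerivOn univ χ (deriv χ) := by
  intro φ h1 h2 _
  have hd : Continuous (deriv χ) := hχ.continuous_deriv (by simp)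
  have hφd : Continuous (deriv φ) := h1.continuous_deriv (by simp)
  have := integral_deriv_mul_primitive (F := χ) (c := χ 0) hd.locallyIntegrable (by
    intro x
    rw [intervalIntegral.integral_deriv_eq_sub
      (fun y _ => (hχ.differentiable (by simp)).differentiableAt) (hd.intervalIntegrable _ _)]
    ring) (h1.of_le (by simp)) h2
  have i1 : Integrable fun x => deriv φ x * χ x :=
    (hφd.mul hχ.continuous).integrable_of_hasCompactSupport (h2.deriv.mul_right)
  have i2 : Integrable fun x => φ x * deriv χ x :=
    (h1.continuous.mul hd).integrable_of_hasCompactSupport (h2.mul_right)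
  rw [integral_add i1 i2] at this
  simp only [Measure.restrict_univ, smul_eq_mul]
  linarith

theorem HasWeakDerivOn.re {u u' : L2} (h : HasWeakDerivOn univ u u') :
    HasWeakDerivOn univ (fun x => (u x).re) (fun x => (u' x).re) := by
  intro φ h1 h2 h3
  have hd : Continuous (deriv φ) := h1.continuous_deriv (by simp)
  have a := congrArg Complex.re (h φ h1 h2 h3)
  simp only [Measure.restrict_univ] at a ⊢
  have e1 := integral_re (𝕜 := ℂ) (integrable_smul_L2 hd h2.deriv u)
  have e2 := integral_re (𝕜 := ℂ) (integrable_smul_L2 h1.continuous h2 u')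
  simp only [RCLike.re_to_complex, Complex.neg_re, Complex.smul_re] at e1 e2 a ⊢
  rw [e1, e2, a]

theorem locallyIntegrable_re_L2 (u : L2) : LocallyIntegrable fun x => (u x).re :=
  (Lp.memLp u).re.locallyIntegrable (by norm_num)

/-- If `0` is not in the Dirichlet spectrum of `L_k`, the decaying solution exists. -/
theorem exists_isDecayingSolution {g : ℝ → ℝ} (hg : MemLp g ⊤ (volume : Measure ℝ)) {ω : ℝ}
    {k : ℤ} (hk : (0 : ℂ) ∉ dirichletSpec g ω k) : ∃ Φ, IsDecayingSolution g ω k Φ := by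
  let b : ContDiffBump (0 : ℝ) := ⟨1, 2, by norm_num, by norm_num⟩
  set χ : ℝ → ℝ := fun x => b x
  have hχ : ContDiff ℝ (⊤ : ℕ∞) χ := b.contDiff
  have hχc : HasCompactSupport χ := b.hasCompactSupport
  have hχ0 : χ 0 = 1 := b.one_of_mem_closedBall (Metric.mem_closedBall_self b.rIn_pos.le)
  have hχ1 : ContDiff ℝ (⊤ : ℕ∞) (deriv χ) := (contDiff_infty_iff_deriv.1 hχ).2
  have hχ2 : ContDiff ℝ (⊤ : ℕ∞) (deriv (deriv χ)) := (contDiff_infty_iff_deriv.1 hχ1).2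
  have m0 : MemLp χ 2 volume := hχ.continuous.memLp_of_hasCompactSupport hχc
  have m1 : MemLp (deriv χ) 2 volume := hχ1.continuous.memLp_of_hasCompactSupport hχc.deriv
  have m2 : MemLp (deriv (deriv χ)) 2 volume :=
    hχ2.continuous.memLp_of_hasCompactSupport hχc.deriv.deriv
  set c : ℝ := (k : ℝ) ^ 2 * ω ^ 2
  -- Ansatz `Φ = χ - u` with a cutoff `χ`, `χ(0) = 1`: on `(0,∞)` the correction must satisfy `L_k u
  -- = L_k χ`. The right side `q` is extended to an odd function, so that the Dirichlet resolvent
  -- provides an odd `u`.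
  set q : ℝ → ℝ := (Ioi 0).indicator fun x => - deriv (deriv χ) x - c * (g x * χ x)
  have hq : MemLp q 2 volume := by
    have h2 : MemLp (fun x => g x * χ x) 2 volume := m0.mul hg
    exact (m2.neg.sub (h2.const_mul c)).indicator measurableSet_Ioi
  have hmp := Measure.measurePreserving_neg (volume : Measure ℝ)
  have hf : MemLp (fun x => ((q x - q (-x) : ℝ) : ℂ)) 2 volume :=
    (hq.sub (hq.comp_measurePreserving hmp)).ofReal
  set f : L2 := hf.toLp _
  have hfae : ∀ᵐ x, f x = ((q x - q (-x) : ℝ) : ℂ) := hf.coeFn_toLp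
  have hfodd : f ∈ oddL2 := by
    change ∀ᵐ x, f (-x) = - f x
    filter_upwards [hfae, hmp.quasiMeasurePreserving.ae hfae] with x h1 h2
    rw [h1, h2]
    push_cast
    rw [neg_neg]
    ring
  simp only [dirichletSpec, spec, mem_compl_iff, not_not] at hk
  obtain ⟨B, hB, -⟩ := hk
  obtain ⟨hdom, hBf⟩ := hB ⟨f, hfodd⟩
  rw [zero_smul, sub_zero] at hBf
  set u : L2 := (B ⟨f, hfodd⟩).1
  have huodd : ∀ᵐ x, u (-x) = - u x := (B ⟨f, hfodd⟩).2
  have hgraph : ((B ⟨f, hfodd⟩, ⟨f, hfodd⟩) : oddL2 × oddL2) ∈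
      (partIn (Lop g ω k) oddL2).graph := by
    rw [LinearPMap.mem_graph_iff]
    exact ⟨⟨_, hdom⟩, rfl, hBf⟩
  rw [partIn_graph, Submodule.mem_comap, Lop, schrodinger_graph] at hgraph
  obtain ⟨u', u'', w1, w2, heq⟩ := hgraph
  change HasWeakDerivOn univ u u' at w1
  change ∀ᵐ x, f x = - u'' x - ((c * g x : ℝ) : ℂ) * u x at heq
  have hV := locallyIntegrable_re_L2 u'
  obtain ⟨c0, hc0⟩ := HasWeakDerivOn.ae_eq_primitive isOpen_univ ordConnected_univ univ_nonempty
    ((locallyIntegrable_re_L2 u).locallyIntegrableOn univ) hV (ae_of_all _ fun _ => rfl) w1.re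
  simp only [mem_univ, true_implies] at hc0
  have hcont := continuous_primitive_of_locallyIntegrable hV
  set U : ℝ → ℝ := fun x => ∫ t in (0 : ℝ)..x, (u' t).re
  -- An odd continuous function vanishes at `0`, so the correction does not disturb the value `χ(0)
  -- = 1`.
  have hc00 : c0 = 0 := by
    have e : (fun x => c0 + U (-x)) =ᵐ[volume] fun x => - (c0 + U x) := by
      filter_upwards [hc0, hmp.quasiMeasurePreserving.ae hc0, huodd] with x h1 h2 h3
      rw [← h1, ← h2, h3, Complex.neg_re]
    have e' := congrFun ((Continuous.ae_eq_iff_eq volume (by fun_prop) (by fun_prop)).1 e) 0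
    simp only [neg_zero, U, intervalIntegral.integral_same, add_zero] at e'
    linarith
  have hUae : ∀ᵐ x, (u x).re = U x := by
    filter_upwards [hc0] with x hx
    rw [hx, hc00, zero_add]
  have hU2 : MemLp U 2 volume := (memLp_congr_ae hUae).1 (Lp.memLp u).re
  refine ⟨fun x => χ x - U x, (hχ.continuous.sub hcont).continuousOn, by simp [hχ0, U],
    fun x => deriv χ x - (u' x).re, fun x => deriv (deriv χ) x - (u'' x).re,
    (m0.sub hU2).restrict _, (m1.sub (Lp.memLp u').re).restrict _,
    (m2.sub (Lp.memLp u'').re).restrict _, ?_, ?_, ?_⟩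
  · exact (HasWeakDerivOn.sub_of_locallyIntegrable hχ.continuous.locallyIntegrable
      hcont.locallyIntegrable hχ1.continuous.locallyIntegrable hV
      (hasWeakDerivOn_univ_of_contDiff hχ) (w1.re.congr_ae hUae)).mono_univ _
  · exact (HasWeakDerivOn.sub_of_locallyIntegrable hχ1.continuous.locallyIntegrable
      hV hχ2.continuous.locallyIntegrable (locallyIntegrable_re_L2 u'')
      (hasWeakDerivOn_univ_of_contDiff hχ1) w2.re).mono_univ _
  · filter_upwards [ae_restrict_of_ae hUae, ae_restrict_of_ae heq, ae_restrict_of_ae hfae,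
      ae_restrict_mem measurableSet_Ioi] with x h1 h2 h3 hx
    have hx' : -x ∉ Ioi (0 : ℝ) := by simpa using (mem_Ioi.1 hx).le
    have h4 := congrArg Complex.re (h3.symm.trans h2)
    simp only [q, indicator_of_mem hx, indicator_of_notMem hx', Complex.ofReal_re,
      Complex.sub_re, Complex.neg_re, Complex.re_ofReal_mul, h1] at h4
    linear_combination h4

/-- Integrating the weak derivatives twice gives a `C¹` representative up to the boundary, so the
one-sided derivative at `0` is the constant of integration of the first primitive. -/
theorem IsDecayingSolution.exists_deriv {g : ℝ → ℝ} {ω : ℝ} {k : ℤ} {Φ : ℝ → ℝ}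
    (h : IsDecayingSolution g ω k Φ) :
    ∃ Ψ V : ℝ → ℝ, LocallyIntegrable V ∧ Continuous Ψ ∧
      (∀ x, Ψ x = derivWithin Φ (Ici 0) 0 + ∫ t in (0 : ℝ)..x, V t) ∧
      (∀ x, 0 ≤ x → Φ x = 1 + ∫ t in (0 : ℝ)..x, Ψ t) ∧
      ∀ᵐ x, 0 < x → V x = - ((k : ℝ) ^ 2 * ω ^ 2 * g x * Φ x) := by
  obtain ⟨hc, h0, Φ₁, Φ₂, m0, m1, m2, w1, w2, heq⟩ := h
  have hind {v : ℝ → ℝ} (m : MemLp v 2 (volume.restrict (Ioi 0))) :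
      LocallyIntegrable ((Ioi 0).indicator v) :=
    ((memLp_indicator_iff_restrict measurableSet_Ioi).2 m).locallyIntegrable (by norm_num)
  have hon {v : ℝ → ℝ} (m : MemLp v 2 (volume.restrict (Ioi 0))) :
      LocallyIntegrableOn v (Ioi 0) :=
    ((hind m).locallyIntegrableOn (Ioi 0)).congr <| by
      filter_upwards [ae_restrict_mem measurableSet_Ioi] with x hx
      rw [indicator_of_mem hx]
  have hindae (v : ℝ → ℝ) : ∀ᵐ x ∂volume.restrict (Ioi 0), v x = (Ioi 0).indicator v x := by
    filter_upwards [ae_restrict_mem measurableSet_Ioi] with x hx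
    rw [indicator_of_mem hx]
  set V : ℝ → ℝ := (Ioi 0).indicator Φ₂
  obtain ⟨d, hd⟩ := HasWeakDerivOn.ae_eq_primitive isOpen_Ioi ordConnected_Ioi nonempty_Ioi
    (hon m1) (hind m2) (hindae Φ₂) w2
  set Ψ : ℝ → ℝ := fun x => d + ∫ t in (0 : ℝ)..x, V t
  have hΨ : Continuous Ψ :=
    continuous_const.add (continuous_primitive_of_locallyIntegrable (hind m2))
  obtain ⟨c, hc'⟩ := HasWeakDerivOn.ae_eq_primitive isOpen_Ioi ordConnected_Ioi nonempty_Ioi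
    (hon m0) hΨ.locallyIntegrable ((ae_restrict_iff' measurableSet_Ioi).2 hd) w1
  have hP := continuous_primitive_of_locallyIntegrable hΨ.locallyIntegrable
  have heqOn : EqOn Φ (fun x => c + ∫ t in (0 : ℝ)..x, Ψ t) (Ioi 0) :=
    Measure.eqOn_open_of_ae_eq (μ := volume) ((ae_restrict_iff' measurableSet_Ioi).2 hc')
      isOpen_Ioi (hc.mono Ioi_subset_Ici_self) (by fun_prop)
  have heqOn' : EqOn Φ (fun x => c + ∫ t in (0 : ℝ)..x, Ψ t) (Ici 0) :=
    heqOn.of_subset_closure hc (by fun_prop) Ioi_subset_Ici_self (by rw [closure_Ioi])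
  have hc1 : c = 1 := by
    have := heqOn' (mem_Ici.2 le_rfl)
    simp only [h0, intervalIntegral.integral_same, add_zero] at this
    exact this.symm
  have hder : derivWithin Φ (Ici 0) 0 = d := by
    have h1 : HasDerivAt (fun x => c + ∫ t in (0 : ℝ)..x, Ψ t) (Ψ 0) 0 :=
      (intervalIntegral.integral_hasDerivAt_right (hΨ.intervalIntegrable _ _)
        (hΨ.stronglyMeasurableAtFilter _ _) hΨ.continuousAt).const_add c
    have h2 : HasDerivWithinAt Φ (Ψ 0) (Ici 0) 0 :=
      h1.hasDerivWithinAt.congr heqOn' (heqOn' (mem_Ici.2 le_rfl))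
    rw [h2.derivWithin (uniqueDiffOn_Ici 0 0 (mem_Ici.2 le_rfl))]
    simp [Ψ]
  refine ⟨Ψ, V, hind m2, hΨ, fun x => by rw [hder], fun x hx => by rw [← hc1]; exact heqOn' hx, ?_⟩
  filter_upwards [(ae_restrict_iff' measurableSet_Ioi).1 heq] with x hx hx0
  simp only [V, indicator_of_mem (mem_Ioi.2 hx0)]
  linarith [hx hx0]

/-- `Φ` agrees on `[0,∞)` with the decaying solution `Φ_k`, has derivative `Ψ` and second
derivative `V`, and `Φ`, `Ψ / k` decay exponentially with constants `C`, `ρ`. -/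
structure IsProfile (g : ℝ → ℝ) (ω ρ C : ℝ) (k : ℤ) (Φ Ψ V : ℝ → ℝ) : Prop where
  eq_Phi : ∀ x, 0 ≤ x → Phi g ω k x = Φ x
  locallyIntegrable : LocallyIntegrable V
  continuous_deriv : Continuous Ψ
  eq_primitive : ∀ x, Φ x = 1 + ∫ t in (0 : ℝ)..x, Ψ t
  deriv_eq_primitive : ∀ x, Ψ x = PhiDeriv g ω k + ∫ t in (0 : ℝ)..x, V t
  ode : ∀ᵐ x, 0 < x → V x = - ((k : ℝ) ^ 2 * ω ^ 2 * g x * Φ x)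
  bound : ∀ x, 0 ≤ x → |Φ x| ≤ C * Real.exp (-ρ * x)
  bound_deriv : ∀ x, 0 ≤ x → |Ψ x| ≤ C * |(k : ℝ)| * Real.exp (-ρ * x)

theorem exists_ae_abs_le_of_memLp_top {g : ℝ → ℝ} (hg : MemLp g ⊤ (volume : Measure ℝ)) :
    ∃ G, 0 ≤ G ∧ ∀ᵐ x, |g x| ≤ G := by
  refine ⟨(eLpNormEssSup g volume).toReal, ENNReal.toReal_nonneg, ?_⟩
  have h := hg.2
  rw [eLpNorm_exponent_top] at h
  filter_upwards [ae_le_eLpNormEssSup (f := g) (μ := volume)] with x hx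
  have := ENNReal.toReal_mono h.ne hx
  simpa using this

/-- The decay of the derivative is an interpolation estimate: the ODE bounds `Φ''` by `k² ω² G |Φ|`,
and a bound on `Φ` and `Φ''` over an interval to the right of `x` bounds `Φ'(x)`. -/
theorem exists_profile_of_nat {g : ℝ → ℝ} {γ ω : ℝ} (h0 : C0 g γ) (h1 : C1 g ω)
    {ρ M G : ℝ} (hρ : 0 < ρ) (hM : 0 < M) (hG : 0 ≤ G) (hgG : ∀ᵐ x, |g x| ≤ G)
    (h2 : ∀ k : ℕ, Odd k → ∀ x : ℝ, 0 ≤ x → |Phi g ω k x| ≤ M * Real.exp (-ρ * x))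
    (k : ℕ) (hk : Odd k) :
    ∃ Φ Ψ V, IsProfile g ω ρ (M * (2 + ω ^ 2 * G)) k Φ Ψ V := by
  have hex := exists_isDecayingSolution h0.1 fun hm => h1 k hk (Or.inr hm)
  have hdec : IsDecayingSolution g ω k (Phi g ω k) := by
    have : Phi g ω k = hex.choose := by rw [Phi, dif_pos hex]
    rw [this]
    exact hex.choose_spec
  obtain ⟨Ψ, V, hV, hΨ, hΨV, hΦ, hode⟩ := hdec.exists_deriv
  set Φ : ℝ → ℝ := fun x => 1 + ∫ t in (0 : ℝ)..x, Ψ t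
  have hk1 : (1 : ℝ) ≤ k := by exact_mod_cast hk.pos
  have hb (x : ℝ) (hx : 0 ≤ x) : |Φ x| ≤ M * Real.exp (-ρ * x) := by
    have := h2 k hk x hx
    rwa [hΦ x hx] at this
  have hode' : ∀ᵐ x, 0 < x → V x = - (((k : ℤ) : ℝ) ^ 2 * ω ^ 2 * g x * Φ x) := by
    filter_upwards [hode] with x hx hx0
    rw [hx hx0, hΦ x hx0.le]
  have hωG : 0 ≤ ω ^ 2 * G := by positivity
  refine ⟨Φ, Ψ, V, hΦ, hV, hΨ, fun x => rfl, hΨV, hode', fun x hx => ?_, fun x hx => ?_⟩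
  · refine (hb x hx).trans ?_
    gcongr
    nlinarith
  · set E := Real.exp (-ρ * x)
    have hE : 0 < E := Real.exp_pos _
    have hexp {s : ℝ} (hs : x ≤ s) : Real.exp (-ρ * s) ≤ E :=
      Real.exp_le_exp.2 (by nlinarith)
    have hVb : ∀ᵐ s, x < s → |V s| ≤ k ^ 2 * (ω ^ 2 * G) * (M * E) := by
      filter_upwards [hode', hgG] with s hs hgs hxs
      rw [hs (by linarith), abs_neg, abs_mul, abs_mul, abs_of_nonneg (by positivity)]
      push_cast
      calc (k : ℝ) ^ 2 * ω ^ 2 * |g s| * |Φ s| ≤ k ^ 2 * ω ^ 2 * G * (M * E) := by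
            gcongr
            exact (hb s (by linarith)).trans (by gcongr; exact hexp hxs.le)
        _ = _ := by ring
    -- The length `1/k` balances the two contributions: `h |Φ'(x)| ≤ |Φ(x+h)| + |Φ(x)| + k² ω² G h²
    -- M E`, and `k h = 1` removes `k` from the right side.
    set h : ℝ := (k : ℝ)⁻¹
    have hh : 0 < h := by positivity
    have hΨd {s : ℝ} (hs : s ∈ Ioc x (x + h)) :
        ‖Ψ s - Ψ x‖ ≤ k ^ 2 * (ω ^ 2 * G) * (M * E) * h := by
      have e : Ψ s - Ψ x = ∫ t in x..s, V t := by
        rw [hΨV s, hΨV x, add_sub_add_left_eq_sub, intervalIntegral.integral_interval_sub_left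
          (intervalIntegrable_of_locallyIntegrable hV _ _)
          (intervalIntegrable_of_locallyIntegrable hV _ _)]
      rw [e]
      refine (intervalIntegral.norm_integral_le_of_norm_le_const_ae
        (C := k ^ 2 * (ω ^ 2 * G) * (M * E)) ?_).trans ?_
      · filter_upwards [hVb] with t ht hts
        rw [uIoc_of_le hs.1.le] at hts
        exact ht hts.1
      · rw [abs_of_pos (by linarith [hs.1])]
        gcongr
        linarith [hs.2]
    have hint : ‖∫ s in x..(x + h), (Ψ s - Ψ x)‖ ≤
        k ^ 2 * (ω ^ 2 * G) * (M * E) * h * |x + h - x| :=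
      intervalIntegral.norm_integral_le_of_norm_le_const fun s hs => hΨd (by
        rwa [uIoc_of_le (by linarith)] at hs)
    rw [intervalIntegral.integral_sub (hΨ.intervalIntegrable _ _)
      intervalIntegrable_const, intervalIntegral.integral_const, add_sub_cancel_left,
      abs_of_pos hh, smul_eq_mul] at hint
    have e2 : ∫ s in x..(x + h), Ψ s = Φ (x + h) - Φ x := by
      simp only [Φ]
      rw [add_sub_add_left_eq_sub, intervalIntegral.integral_interval_sub_left
          (hΨ.intervalIntegrable _ _) (hΨ.intervalIntegrable _ _)]
    rw [e2, Real.norm_eq_abs] at hint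
    have hkh : (k : ℝ) * h = 1 := mul_inv_cancel₀ (by positivity)
    have e3 : (k : ℝ) ^ 2 * (ω ^ 2 * G) * (M * E) * h * h = ω ^ 2 * G * (M * E) := by
      linear_combination (ω ^ 2 * G * (M * E)) * (k * h + 1) * hkh
    rw [e3] at hint
    have b1 := hb x hx
    have b2 : |Φ (x + h)| ≤ M * E := (hb _ (by linarith)).trans (by
      gcongr; exact hexp (by linarith))
    have b3 : |h * Ψ x| ≤ M * (2 + ω ^ 2 * G) * E := by
      rw [abs_le] at hint b1 b2 ⊢
      constructor <;> nlinarith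
    rw [abs_mul, abs_of_pos hh] at b3
    have e4 : |Ψ x| = k * (h * |Ψ x|) := by rw [← mul_assoc, hkh, one_mul]
    rw [e4]
    push_cast
    rw [abs_of_nonneg (by positivity : (0 : ℝ) ≤ k)]
    calc (k : ℝ) * (h * |Ψ x|) ≤ k * (M * (2 + ω ^ 2 * G) * E) := by gcongr
      _ = _ := by ring

/-- Under the assumptions (C0), (C1), (C2) all the decaying solutions have uniform profiles. -/
theorem exists_profiles {g : ℝ → ℝ} {γ ω : ℝ} (h0 : C0 g γ) (h1 : C1 g ω) (h2 : C2 g ω) :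
    ∃ ρ > 0, ∃ C > 0, ∃ Φ Ψ V : ℤ → ℝ → ℝ, (∀ k, Odd k → IsProfile g ω ρ C k (Φ k) (Ψ k) (V k)) ∧
      ∀ k, ¬ Odd k → Φ k = 0 ∧ Ψ k = 0 := by
  obtain ⟨ρ, hρ, M, hM, hb⟩ := h2
  obtain ⟨G, hG, hgG⟩ := exists_ae_abs_le_of_memLp_top h0.1
  refine ⟨ρ, hρ, M * (2 + ω ^ 2 * G), by positivity, ?_⟩
  have key (k : ℤ) : ∃ Φ Ψ V, (Odd k → IsProfile g ω ρ (M * (2 + ω ^ 2 * G)) k Φ Ψ V) ∧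
      (¬ Odd k → Φ = 0 ∧ Ψ = 0) := by
    by_cases hk : Odd k
    · obtain ⟨Φ, Ψ, V, h⟩ := exists_profile_of_nat h0 h1 hρ hM hG hgG hb k.natAbs
        (Int.natAbs_odd.2 hk)
      refine ⟨Φ, Ψ, V, fun _ => ?_, fun h => absurd hk h⟩
      -- The equation depends on `k` only through `k²`, so negative indices inherit the profile of
      -- `|k|`.
      rcases Int.natAbs_eq k with hk' | hk'
      · rw [hk']
        exact h
      · rw [hk']
        obtain ⟨a1, a2, a3, a4, a5, a6, a7, a8⟩ := h
        exact ⟨by simpa only [Phi_neg] using a1, a2, a3, a4,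
          by simpa only [PhiDeriv, Phi_neg] using a5, by simpa using a6, a7, by simpa using a8⟩
    · exact ⟨0, 0, 0, fun h => absurd h hk, fun _ => ⟨rfl, rfl⟩⟩
  choose Φ Ψ V h h' using key
  exact ⟨Φ, Ψ, V, h, h'⟩

/-! ### Fourier coefficients of products and of integrable functions -/

section Fourier

open AddCircle

variable {T : ℝ} [hT : Fact (0 < T)]

theorem integrable_continuous_mul {h : AddCircle T → ℂ} (hh : Integrable h haarAddCircle)
    {φ : AddCircle T → ℂ} (hφ : Continuous φ) :
    Integrable (fun x => φ x * h x) haarAddCircle := by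
  obtain ⟨C, hC⟩ := isCompact_univ.exists_bound_of_continuousOn hφ.continuousOn
  exact hh.bdd_mul hφ.aestronglyMeasurable (ae_of_all _ fun x => hC x (mem_univ x))

/-- The functional `φ ↦ ∫ φ h` is continuous for the sup norm and kills all Fourier monomials, whose
span is dense in the continuous functions. -/
theorem integral_continuous_mul_eq_zero {h : AddCircle T → ℂ} (hh : Integrable h haarAddCircle)
    (h0 : ∀ n, fourierCoeff h n = 0) (φ : C(AddCircle T, ℂ)) :
    ∫ x, φ x * h x ∂haarAddCircle = 0 := by
  let Λ : C(AddCircle T, ℂ) →ₗ[ℂ] ℂ :=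
    { toFun := fun φ => ∫ x, φ x * h x ∂haarAddCircle
      map_add' := fun φ ψ => by
        rw [← integral_add (integrable_continuous_mul hh φ.continuous)
          (integrable_continuous_mul hh ψ.continuous)]
        exact integral_congr_ae (ae_of_all _ fun x => by simp [add_mul])
      map_smul' := fun c φ => by
        rw [RingHom.id_apply, smul_eq_mul, ← integral_const_mul]
        exact integral_congr_ae (ae_of_all _ fun x => by simp [mul_assoc]) }
  let Λc : C(AddCircle T, ℂ) →L[ℂ] ℂ := Λ.mkContinuous (∫ x, ‖h x‖ ∂haarAddCircle) fun φ => by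
    refine (norm_integral_le_integral_norm _).trans ?_
    rw [← integral_mul_const]
    refine integral_mono_ae (integrable_continuous_mul hh φ.continuous).norm
      (hh.norm.mul_const _) (ae_of_all _ fun x => ?_)
    simp only [norm_mul]
    rw [mul_comm]
    gcongr
    exact φ.norm_coe_le_norm x
  have hker : (Submodule.span ℂ (range (@fourier T))).topologicalClosure ≤
      LinearMap.ker (Λc : C(AddCircle T, ℂ) →ₗ[ℂ] ℂ) := by
    refine Submodule.topologicalClosure_minimal _ ?_ Λc.isClosed_ker
    rw [Submodule.span_le]
    rintro _ ⟨n, rfl⟩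
    have := h0 (-n)
    rw [fourierCoeff, neg_neg] at this
    exact this
  have : φ ∈ LinearMap.ker (Λc : C(AddCircle T, ℂ) →ₗ[ℂ] ℂ) :=
    hker (by rw [span_fourier_closure_eq_top]; trivial)
  exact this

/-- An integrable function on the circle is determined by its Fourier coefficients. -/
theorem ae_eq_zero_of_fourierCoeff_eq_zero {h : AddCircle T → ℂ}
    (hh : Integrable h haarAddCircle) (h0 : ∀ n, fourierCoeff h n = 0) :
    h =ᵐ[haarAddCircle] 0 := by
  refine ae_eq_zero_of_forall_setIntegral_isClosed_eq_zero hh fun s hs => ?_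
  -- Indicators of closed sets are bounded pointwise limits of continuous functions, so the
  -- vanishing of integrals carries over to them.
  have hlim : Tendsto (fun n : ℕ => ∫ x, ((hs.apprSeq n x : ℝ) : ℂ) * h x ∂haarAddCircle) atTop
      (𝓝 (∫ x, s.indicator h x ∂haarAddCircle)) := by
    refine tendsto_integral_of_dominated_convergence (fun x => ‖h x‖) (fun n => ?_) hh.norm
      (fun n => ae_of_all _ fun x => ?_) (ae_of_all _ fun x => ?_)
    · exact (integrable_continuous_mul hh (φ := fun x => ((hs.apprSeq n x : ℝ) : ℂ))
        (by fun_prop)).1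
    · rw [norm_mul]
      have h1 : ‖((hs.apprSeq n x : ℝ) : ℂ)‖ ≤ 1 := by
        rw [Complex.norm_real, Real.norm_of_nonneg (NNReal.coe_nonneg _)]
        exact_mod_cast HasOuterApproxClosed.apprSeq_apply_le_one hs n x
      nlinarith [norm_nonneg (h x)]
    · have h1 := (tendsto_pi_nhds.1 (HasOuterApproxClosed.tendsto_apprSeq hs)) x
      have h2 : Tendsto (fun n => ((hs.apprSeq n x : ℝ) : ℂ) * h x) atTop
          (𝓝 ((((s.indicator (fun _ => (1 : NNReal)) x : NNReal) : ℝ) : ℂ) * h x)) :=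
        (((Complex.continuous_ofReal.comp NNReal.continuous_coe).tendsto _).comp h1).mul_const _
      convert h2 using 2
      by_cases hx : x ∈ s <;> simp [hx]
  have hz (n : ℕ) : ∫ x, ((hs.apprSeq n x : ℝ) : ℂ) * h x ∂haarAddCircle = 0 :=
    integral_continuous_mul_eq_zero hh h0 ⟨fun x => ((hs.apprSeq n x : ℝ) : ℂ), by fun_prop⟩
  simp only [hz] at hlim
  rw [← integral_indicator hs.measurableSet]
  exact (tendsto_nhds_unique hlim tendsto_const_nhds)

theorem exists_memLp_fourierCoeff_eq {z : ℤ → ℂ} (hz : Summable fun k => ‖z k‖ ^ 2) :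
    ∃ U : AddCircle T → ℂ, MemLp U 2 haarAddCircle ∧ ∀ k, fourierCoeff U k = z k := by
  have hm : Memℓp z 2 := (memℓp_gen_iff (by norm_num)).2 (by simpa using hz)
  refine ⟨(fourierBasis (T := T)).repr.symm ⟨z, hm⟩, Lp.memLp _, fun k => ?_⟩
  rw [← fourierBasis_repr, LinearIsometryEquiv.apply_symm_apply]

theorem fourierCoeff_toLp_memLp {U : AddCircle T → ℂ} (hU : MemLp U 2 haarAddCircle) (k : ℤ) :
    fourierCoeff (hU.toLp U) k = fourierCoeff U k :=
  congrFun (fourierCoeff_congr_ae hU.coeFn_toLp) k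

theorem hasSum_norm_sq_fourierCoeff {U : AddCircle T → ℂ} (hU : MemLp U 2 haarAddCircle) :
    HasSum (fun k => ‖fourierCoeff U k‖ ^ 2) (∫ x, ‖U x‖ ^ 2 ∂haarAddCircle) := by
  have := hasSum_sq_fourierCoeff (hU.toLp U)
  simp only [fourierCoeff_toLp_memLp] at this
  convert this using 1
  refine integral_congr_ae ?_
  filter_upwards [hU.coeFn_toLp] with x hx
  rw [hx]

/-- By Riesz-Fischer some `L²` function has the same coefficients, and integrable functions are
determined by theirs. This is the regularity gain used for `f²` (from membership in `DomJ`) and for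
`f³` (from the Euler-Lagrange equation). -/
theorem memLp_two_of_summable_fourierCoeff {h : AddCircle T → ℂ}
    (hh : Integrable h haarAddCircle) (hs : Summable fun k => ‖fourierCoeff h k‖ ^ 2) :
    MemLp h 2 haarAddCircle := by
  obtain ⟨U, hU, hc⟩ := exists_memLp_fourierCoeff_eq (T := T) hs
  have hUi : Integrable U haarAddCircle := hU.integrable (by norm_num)
  have h0 := ae_eq_zero_of_fourierCoeff_eq_zero (h := fun x => h x + (-1 : ℂ) * U x)
    (hh.add (hUi.const_mul (-1))) (fun n => by
      have := congrFun (fourierCoeff.add hh (hUi.const_mul (-1))) n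
      rw [Pi.add_apply, fourierCoeff.const_mul, hc] at this
      exact this.trans (by ring))
  refine (memLp_congr_ae ?_).2 hU
  filter_upwards [h0] with x hx
  simp only [Pi.zero_apply] at hx
  linear_combination hx

/-- Parseval's identity for the pair `e_k · conj V` and `U`. -/
theorem hasSum_fourierCoeff_mul {U V : AddCircle T → ℂ} (hU : MemLp U 2 haarAddCircle)
    (hV : MemLp V 2 haarAddCircle) (k : ℤ) :
    HasSum (fun l => fourierCoeff U l * fourierCoeff V (k - l))
      (fourierCoeff (fun x => U x * V x) k) := by
  have hW : MemLp (fun x => fourier k x * (starRingEnd ℂ) (V x)) 2 haarAddCircle := by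
    refine MemLp.of_le hV ((fourier k).continuous.aestronglyMeasurable.mul
      (Complex.continuous_conj.comp_aestronglyMeasurable hV.1)) (ae_of_all _ fun x => ?_)
    rw [norm_mul, RCLike.norm_conj, fourier_apply, Circle.norm_coe, one_mul]
  have h := fourierBasis.hasSum_inner_mul_inner (hW.toLp _) (hU.toLp U)
  have e1 (l : ℤ) : inner ℂ (hW.toLp _) (fourierBasis l) = fourierCoeff V (k - l) := by
    rw [coe_fourierBasis, MeasureTheory.L2.inner_def, fourierCoeff]
    refine integral_congr_ae ?_
    filter_upwards [hW.coeFn_toLp, coeFn_fourierLp 2 l] with x h1 h2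
    rw [h1, h2, RCLike.inner_apply, map_mul, RingHomCompTriple.comp_apply, RingHom.id_apply,
      ← fourier_neg, smul_eq_mul, ← mul_assoc, ← fourier_add]
    congr 3
    ring
  have e2 (l : ℤ) : inner ℂ (fourierBasis l) (hU.toLp U) = fourierCoeff U l := by
    rw [← fourierBasis.repr_apply_apply, fourierBasis_repr, fourierCoeff_toLp_memLp]
  have e3 : inner ℂ (hW.toLp _) (hU.toLp U) = fourierCoeff (fun x => U x * V x) k := by
    rw [MeasureTheory.L2.inner_def, fourierCoeff]
    refine integral_congr_ae ?_
    filter_upwards [hW.coeFn_toLp, hU.coeFn_toLp] with x h1 h2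
    rw [h1, h2, RCLike.inner_apply, map_mul, RingHomCompTriple.comp_apply, RingHom.id_apply,
      ← fourier_neg, smul_eq_mul]
    ring
  simp only [e1, e2, e3] at h
  simpa only [mul_comm] using h

end Fourier

/-! ### Sine series on the circle -/

section Sine

open AddCircle

theorem abs_fourier_im_le {T : ℝ} (k : ℤ) (x : AddCircle T) : |(fourier k x).im| ≤ 1 := by
  refine (Complex.abs_im_le_norm _).trans ?_
  rw [fourier_apply, Circle.norm_coe]

theorem continuous_fourier_im {T : ℝ} (k : ℤ) : Continuous fun x : AddCircle T => (fourier k x).im :=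
  Complex.continuous_im.comp (fourier k).continuous

variable {T : ℝ} [hT : Fact (0 < T)]

/-- `f = ∑_k z_k sin_k` in `L²` of the circle, where `sin_k` is the imaginary part of the `k`-th
Fourier monomial (for antisymmetric `z`). -/
structure IsSineSeries (z : ℤ → ℝ) (f : AddCircle T → ℝ) : Prop where
  memLp : MemLp f 2 haarAddCircle
  coeff : ∀ k, fourierCoeff (fun x => (f x : ℂ)) k = -Complex.I * z k

/-- The odd unit vector `δ_k - δ_{-k}`. -/
def oddUnit (k n : ℤ) : ℝ := (if n = k then 1 else 0) - if n = -k then 1 else 0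

theorem fourierCoeff_ofReal_neg (f : AddCircle T → ℝ) (k : ℤ) :
    fourierCoeff (fun x => (f x : ℂ)) (-k) =
      (starRingEnd ℂ) (fourierCoeff (fun x => (f x : ℂ)) k) := by
  simp only [fourierCoeff]
  rw [← integral_conj]
  refine integral_congr_ae (ae_of_all _ fun x => ?_)
  simp

theorem IsSineSeries.antisymm {z : ℤ → ℝ} {f : AddCircle T → ℝ} (h : IsSineSeries z f) (k : ℤ) :
    z (-k) = - z k := by
  have := fourierCoeff_ofReal_neg f k
  rw [h.coeff, h.coeff] at this
  have := congrArg Complex.im this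
  simp at this
  linarith

/-- For real antisymmetric `z` the numbers `-i z_k` have the conjugation symmetry of the
coefficients of a real function; by uniqueness of coefficients the Riesz-Fischer function is real
almost everywhere. -/
theorem exists_isSineSeries {z : ℤ → ℝ} (hz : ∀ k, z (-k) = - z k)
    (hs : Summable fun k => z k ^ 2) : ∃ f : AddCircle T → ℝ, IsSineSeries z f := by
  obtain ⟨U, hU, hc⟩ := exists_memLp_fourierCoeff_eq (T := T) (z := fun k => -Complex.I * z k)
    (by simpa using hs)
  have hUc : MemLp (fun x => (starRingEnd ℂ) (U x)) 2 haarAddCircle := hU.star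
  have hcc (k : ℤ) : fourierCoeff (fun x => (starRingEnd ℂ) (U x)) k = -Complex.I * z k := by
    have : fourierCoeff (fun x => (starRingEnd ℂ) (U x)) k =
        (starRingEnd ℂ) (fourierCoeff U (-k)) := by
      simp only [fourierCoeff, neg_neg]
      rw [← integral_conj]
      refine integral_congr_ae (ae_of_all _ fun x => ?_)
      simp
    rw [this, hc, hz]
    simp
  have i1 : Integrable U haarAddCircle := hU.integrable (by norm_num)
  have i2 : Integrable (fun x => (starRingEnd ℂ) (U x)) haarAddCircle :=
    hUc.integrable (by norm_num)
  have h0 := ae_eq_zero_of_fourierCoeff_eq_zero (h := fun x => U x + (-1 : ℂ) * starRingEnd ℂ (U x))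
    (i1.add (i2.const_mul (-1))) (fun n => by
      have := congrFun (fourierCoeff.add i1 (i2.const_mul (-1))) n
      rw [Pi.add_apply, fourierCoeff.const_mul, hc, hcc] at this
      exact this.trans (by ring))
  have hre : (fun x => (((U x).re : ℝ) : ℂ)) =ᵐ[haarAddCircle] U := by
    filter_upwards [h0] with x hx
    have : (starRingEnd ℂ) (U x) = U x := by
      simp only [Pi.zero_apply] at hx
      linear_combination -hx
    exact Complex.conj_eq_iff_re.1 this
  refine ⟨fun x => (U x).re, hU.re, fun k => ?_⟩
  rw [congrFun (fourierCoeff_congr_ae hre) k, hc]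

namespace IsSineSeries

variable {z y : ℤ → ℝ} {f p : AddCircle T → ℝ}

theorem memLp_ofReal (h : IsSineSeries z f) :
    MemLp (fun x => (f x : ℂ)) 2 haarAddCircle := h.memLp.ofReal

theorem hasSum_sq (h : IsSineSeries z f) :
    HasSum (fun k => z k ^ 2) (∫ x, f x ^ 2 ∂haarAddCircle) := by
  simpa [h.coeff] using hasSum_norm_sq_fourierCoeff h.memLp_ofReal

theorem add_mul (h : IsSineSeries z f) (h' : IsSineSeries y p) (ε : ℝ) :
    IsSineSeries (fun k => z k + ε * y k) (fun x => f x + ε * p x) := by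
  refine ⟨h.memLp.add (h'.memLp.const_mul ε), fun k => ?_⟩
  have i1 : Integrable (fun x => (f x : ℂ)) haarAddCircle :=
    h.memLp_ofReal.integrable (by norm_num)
  have i2 : Integrable (fun x => (p x : ℂ)) haarAddCircle :=
    h'.memLp_ofReal.integrable (by norm_num)
  have := congrFun (fourierCoeff.add i1 (i2.const_mul (ε : ℂ))) k
  rw [Pi.add_apply, fourierCoeff.const_mul, h.coeff, h'.coeff] at this
  push_cast
  refine Eq.trans ?_ (this.trans ?_)
  · rfl
  · ring

/-- The minus sign is `(-i)²`. -/
theorem hasSum_mul (h : IsSineSeries z f) (k : ℤ) :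
    HasSum (fun l => ((z l * z (k - l) : ℝ) : ℂ)) (-fourierCoeff (fun x => ((f x ^ 2 : ℝ) : ℂ)) k) := by
  have := (hasSum_fourierCoeff_mul h.memLp_ofReal h.memLp_ofReal k).neg
  simp only [h.coeff] at this
  have e1 : (fun x => ((f x ^ 2 : ℝ) : ℂ)) = fun x => (f x : ℂ) * (f x : ℂ) := by
    funext x
    push_cast
    ring
  have e2 (l : ℤ) : ((z l * z (k - l) : ℝ) : ℂ) =
      -(-Complex.I * (z l : ℂ) * (-Complex.I * (z (k - l) : ℂ))) := by
    push_cast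
    linear_combination (z l * z (k - l) : ℂ) * Complex.I_sq
  simp only [e1, e2]
  exact this

theorem summable_mul (h : IsSineSeries z f) (k : ℤ) : Summable fun l => z l * z (k - l) :=
  Complex.summable_ofReal.1 (h.hasSum_mul k).summable

theorem fourierCoeff_sq (h : IsSineSeries z f) (k : ℤ) :
    fourierCoeff (fun x => ((f x ^ 2 : ℝ) : ℂ)) k = -(conv z z k : ℂ) := by
  rw [conv, Complex.ofReal_tsum, (h.hasSum_mul k).tsum_eq, neg_neg]

theorem integrable_sq (h : IsSineSeries z f) : Integrable (fun x => f x ^ 2) haarAddCircle :=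
  h.memLp.integrable_sq

theorem memLp_sq_iff (h : IsSineSeries z f) : MemLp (fun x => f x ^ 2) 2 haarAddCircle ↔
    Integrable (fun x => f x ^ 4) haarAddCircle := by
  have hm : AEStronglyMeasurable (fun x => f x ^ 2) haarAddCircle := h.memLp.1.pow 2
  rw [memLp_two_iff_integrable_sq hm]
  simp only [← pow_mul]

theorem hasSum_conv_sq (h : IsSineSeries z f)
    (h4 : Integrable (fun x => f x ^ 4) haarAddCircle) :
    HasSum (fun k => conv z z k ^ 2) (∫ x, f x ^ 4 ∂haarAddCircle) := by
  have hm : MemLp (fun x => ((f x ^ 2 : ℝ) : ℂ)) 2 haarAddCircle := (h.memLp_sq_iff.2 h4).ofReal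
  have := hasSum_norm_sq_fourierCoeff hm
  simp only [h.fourierCoeff_sq, norm_neg, Complex.norm_real, Real.norm_eq_abs, sq_abs,
    ← pow_mul] at this
  exact this

/-- Membership in `DomJ` is exactly the condition `f ∈ L⁴`: a priori `f²` is only integrable, and
square summability of its coefficients puts it in `L²`. -/
theorem integrable_pow_four (h : IsSineSeries z f) (hs : Summable fun k => conv z z k ^ 2) :
    Integrable (fun x => f x ^ 4) haarAddCircle := by
  rw [← h.memLp_sq_iff]
  have hi : Integrable (fun x => ((f x ^ 2 : ℝ) : ℂ)) haarAddCircle := h.integrable_sq.ofReal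
  exact (memLp_two_of_summable_fourierCoeff hi (hs.congr fun k => by
    rw [h.fourierCoeff_sq, norm_neg, Complex.norm_real, Real.norm_eq_abs, sq_abs])).re

theorem mem_DomJ (h : IsSineSeries z f) (h4 : Integrable (fun x => f x ^ 4) haarAddCircle)
    (he : ∀ k, Even k → z k = 0) : z ∈ DomJ :=
  ⟨he, h.antisymm, h.summable_mul, (h.hasSum_conv_sq h4).summable⟩

/-- Parseval for `f²`: the convolution square of an antisymmetric sequence is even, so the zeroth
entry of its own convolution square is a sum of squares. -/
theorem conv_conv_zero (h : IsSineSeries z f)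
    (h4 : Integrable (fun x => f x ^ 4) haarAddCircle) :
    conv (conv z z) (conv z z) 0 = ∫ x, f x ^ 4 ∂haarAddCircle := by
  rw [← (h.hasSum_conv_sq h4).tsum_eq, conv]
  refine tsum_congr fun l => ?_
  have : conv z z (0 - l) = conv z z l := by
    rw [zero_sub, conv, conv, ← (Equiv.neg ℤ).tsum_eq]
    refine tsum_congr fun i => ?_
    rw [Equiv.neg_apply, h.antisymm, show -l - -i = -(l - i) by ring, h.antisymm]
    ring
  rw [this, sq]

theorem hasSum_mul_integral (h : IsSineSeries z f) {q : AddCircle T → ℝ}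
    (hq : MemLp q 2 haarAddCircle) :
    HasSum (fun k => z k * ∫ x, (fourier k x).im * q x ∂haarAddCircle)
      (∫ x, f x * q x ∂haarAddCircle) := by
  have hqc : MemLp (fun x => (q x : ℂ)) 2 haarAddCircle := hq.ofReal
  have hqi := hqc.integrable (q := 2) (by norm_num)
  have key := Complex.hasSum_re (hasSum_fourierCoeff_mul h.memLp_ofReal hqc 0)
  convert key using 1
  · funext k
    rw [h.coeff, zero_sub, fourierCoeff, neg_neg]
    have e : ∫ x, (fourier k x).im * q x ∂haarAddCircle =
        (∫ x, fourier k x • (q x : ℂ) ∂haarAddCircle).im := by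
      have := integral_im (𝕜 := ℂ) (integrable_continuous_mul hqi (fourier k).continuous)
      simp only [smul_eq_mul]
      refine Eq.trans (integral_congr_ae (ae_of_all _ fun x => ?_)) this
      simp
    rw [e]
    simp
  · rw [fourierCoeff]
    have e : ∀ x : AddCircle T, fourier (-0) x • ((f x : ℂ) * (q x : ℂ)) = ((f x * q x : ℝ) : ℂ) := by
      intro x
      simp
    simp only [e]
    rw [integral_complex_ofReal, Complex.ofReal_re]

end IsSineSeries

theorem isSineSeries_oddUnit (k : ℤ) :
    IsSineSeries (oddUnit k) fun x : AddCircle T => 2 * (fourier k x).im := by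
  have hcont : Continuous fun x : AddCircle T => 2 * (fourier k x).im :=
    continuous_const.mul (continuous_fourier_im k)
  refine ⟨hcont.memLp_of_hasCompactSupport (HasCompactSupport.of_compactSpace _), fun n => ?_⟩
  have e : (fun x : AddCircle T => ((2 * (fourier k x).im : ℝ) : ℂ)) =
      (fun x => (-Complex.I) * fourier k x) + fun x => Complex.I * fourier (-k) x := by
    funext x
    simp only [Pi.add_apply, fourier_neg]
    rw [show (fourier k x) = ((fourier k x).re : ℂ) + (fourier k x).im * Complex.I from
      (Complex.re_add_im _).symm]
    apply Complex.ext <;> simp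
    ring
  have hi (j : ℤ) : Integrable (fun x : AddCircle T => fourier j x) haarAddCircle :=
    (fourier j).continuous.integrable_of_hasCompactSupport (HasCompactSupport.of_compactSpace _)
  rw [e, fourierCoeff.add ((hi k).const_mul _) ((hi (-k)).const_mul _), Pi.add_apply,
    fourierCoeff.const_mul, fourierCoeff.const_mul]
  have hf (j : ℤ) : fourierCoeff (fun x : AddCircle T => fourier j x) n = if n = j then 1 else 0 := by
    have := congrFun (fourierCoeff_fourier (T := T) j) n
    rw [Pi.single_apply] at this
    exact this
  rw [hf, hf, oddUnit]
  split_ifs <;> simp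

theorem isSineSeries_zero : IsSineSeries 0 (0 : AddCircle T → ℝ) :=
  ⟨MemLp.zero, fun k => by simp [fourierCoeff]⟩

/-- By antisymmetry, convergence of the convolution at index `0` is the convergence of `-∑ z_k²`. -/
theorem summable_sq_of_mem_DomJ {z : ℤ → ℝ} (hz : z ∈ DomJ) : Summable fun k => z k ^ 2 := by
  have := (hz.2.2.1 0).neg
  refine this.congr fun k => ?_
  rw [zero_sub, hz.2.1]
  ring

theorem exists_isSineSeries_of_mem_DomJ {z : ℤ → ℝ} (hz : z ∈ DomJ) :
    ∃ f : AddCircle T → ℝ, IsSineSeries z f ∧ Integrable (fun x => f x ^ 4) haarAddCircle := by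
  obtain ⟨f, hf⟩ := exists_isSineSeries (T := T) hz.2.1 (summable_sq_of_mem_DomJ hz)
  exact ⟨f, hf, hf.integrable_pow_four hz.2.2.2⟩

end Sine

/-! ### Existence of minimizers -/

/-- Termwise limits can be summed if no mass escapes to infinity: outside a finite set the terms are
controlled by the tail of a fixed summable sequence plus a small multiple of weights of bounded
total mass. Applied with `w = z²`, it handles both weak `L²` limits and the quadratic part of the
functional. -/
theorem tendsto_tsum_of_tight {F w : ℕ → ℤ → ℝ} {G : ℤ → ℝ} {B : ℝ}
    (hF : ∀ n, Summable (F n)) (hG : Summable G) (hw : ∀ n, Summable (w n))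
    (hw0 : ∀ n k, 0 ≤ w n k) (hwB : ∀ n, ∑' k, w n k ≤ B)
    (hlim : ∀ k, Tendsto (fun n => F n k) atTop (𝓝 (G k)))
    (htight : ∀ ε > 0, ∃ b : ℤ → ℝ, Summable b ∧ ∀ n k, |F n k| ≤ b k + ε * w n k) :
    Tendsto (fun n => ∑' k, F n k) atTop (𝓝 (∑' k, G k)) := by
  have hB : 0 ≤ B := (tsum_nonneg (hw0 0)).trans (hwB 0)
  rw [Metric.tendsto_atTop]
  intro ε hε
  -- Four errors of size `ε/4`: the finite sum, the tail of `G`, the tail of `b`, and `δ B`. The `+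
  -- 1` avoids division by zero.
  set δ := ε / (4 * (B + 1))
  have hδ : 0 < δ := by positivity
  have hδB : δ * B < ε / 4 := by
    have : δ * (B + 1) = ε / 4 := by simp only [δ]; field_simp
    nlinarith
  obtain ⟨b, hb, hbF⟩ := htight δ hδ
  have t1 := (tendsto_tsum_compl_atTop_zero b).eventually (gt_mem_nhds (by linarith : 0 < ε / 4))
  have t2 := (tendsto_tsum_compl_atTop_zero G).abs.eventually
    (gt_mem_nhds (by rw [abs_zero]; linarith : |(0 : ℝ)| < ε / 4))
  obtain ⟨S, hS1, hS2⟩ := (t1.and t2).exists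
  have hfin : Tendsto (fun n => ∑ k ∈ S, F n k) atTop (𝓝 (∑ k ∈ S, G k)) :=
    tendsto_finsetSum _ fun k _ => hlim k
  obtain ⟨N, hN⟩ := Metric.tendsto_atTop.1 hfin (ε / 4) (by linarith)
  refine ⟨N, fun n hn => ?_⟩
  have h1 := hN n hn
  rw [Real.dist_eq] at h1 ⊢
  rw [← (hF n).sum_add_tsum_compl (s := S), ← hG.sum_add_tsum_compl (s := S)]
  have hsub : Summable fun k : ((S : Set ℤ)ᶜ : Set ℤ) => F n k := (hF n).subtype _
  have h3 : |∑' k : ((S : Set ℤ)ᶜ : Set ℤ), F n k| ≤ ε / 4 + ε / 4 := by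
    have hsb : Summable fun k : ((S : Set ℤ)ᶜ : Set ℤ) => b k := hb.subtype _
    have hsw : Summable fun k : ((S : Set ℤ)ᶜ : Set ℤ) => w n k := (hw n).subtype _
    calc |∑' k : ((S : Set ℤ)ᶜ : Set ℤ), F n k|
        ≤ ∑' k : ((S : Set ℤ)ᶜ : Set ℤ), |F n k| := by
          have := norm_tsum_le_tsum_norm hsub.norm
          simpa only [Real.norm_eq_abs] using this
      _ ≤ ∑' k : ((S : Set ℤ)ᶜ : Set ℤ), (b k + δ * w n k) :=
          hsub.abs.tsum_le_tsum (fun k => hbF n k) (hsb.add (hsw.mul_left δ))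
      _ = ∑' k : ((S : Set ℤ)ᶜ : Set ℤ), b k + δ * ∑' k : ((S : Set ℤ)ᶜ : Set ℤ), w n k := by
          rw [hsb.tsum_add (hsw.mul_left δ), tsum_mul_left]
      _ ≤ ε / 4 + δ * B := by
          refine add_le_add hS1.le (mul_le_mul_of_nonneg_left ?_ hδ.le)
          exact (Summable.tsum_subtype_le (w n) _ (hw0 n) (hw n)).trans (hwB n)
      _ ≤ _ := by linarith
  change |∑' k : ((S : Set ℤ)ᶜ : Set ℤ), G k| < ε / 4 at hS2
  rw [abs_lt] at h1 hS2 ⊢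
  rw [abs_le] at h3
  constructor
  · have a1 := h1.1
    have a2 := hS2.2
    have a3 := h3.1
    linarith
  · have a1 := h1.2
    have a2 := hS2.1
    have a3 := h3.2
    linarith

theorem tangent_le_pow_four (a b : ℝ) : b ^ 4 + 4 * (b ^ 3 * (a - b)) ≤ a ^ 4 := by
  have : a ^ 4 - (b ^ 4 + 4 * (b ^ 3 * (a - b))) = (a - b) ^ 2 * ((a + b) ^ 2 + 2 * b ^ 2) := by
    ring
  nlinarith [mul_nonneg (sq_nonneg (a - b))
    (add_nonneg (sq_nonneg (a + b)) (mul_nonneg zero_le_two (sq_nonneg b)))]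

/-! ### Weak convergence of sine series and lower semicontinuity of the quartic part -/

section Sine

open AddCircle

variable {T : ℝ} [hT : Fact (0 < T)]

theorem summable_sq_integral_fourier_im_mul {q : AddCircle T → ℝ} (hq : MemLp q 2 haarAddCircle) :
    Summable fun k => (∫ x, (fourier k x).im * q x ∂haarAddCircle) ^ 2 := by
  have hqc : MemLp (fun x => (q x : ℂ)) 2 haarAddCircle := hq.ofReal
  have hqi := hqc.integrable (q := 2) (by norm_num)
  have hs := (hasSum_norm_sq_fourierCoeff hqc).summable
  rw [← (Equiv.neg ℤ).summable_iff] at hs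
  refine Summable.of_nonneg_of_le (fun k => sq_nonneg _) (fun k => ?_) hs
  have e : ∫ x, (fourier k x).im * q x ∂haarAddCircle =
      (fourierCoeff (fun x => (q x : ℂ)) (-k)).im := by
    have := integral_im (𝕜 := ℂ) (integrable_continuous_mul hqi (fourier k).continuous)
    simp only [fourierCoeff, neg_neg, smul_eq_mul]
    refine Eq.trans (integral_congr_ae (ae_of_all _ fun x => ?_)) this
    simp
  rw [e, Function.comp, Equiv.neg_apply]
  exact sq_le_sq' (by linarith [neg_le_of_abs_le (Complex.abs_im_le_norm
    (fourierCoeff (fun x => (q x : ℂ)) (-k)))]) ((le_abs_self _).trans (Complex.abs_im_le_norm _))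

/-- Coefficientwise convergence with bounded `ℓ²` norms is weak convergence in `L²`. Tightness is
Young's inequality `|z s| ≤ s²/(4ε) + ε z²`, the coefficients `s` of `q` being square summable. -/
theorem tendsto_integral_mul_of_tendsto_coeff {z : ℕ → ℤ → ℝ} {y : ℤ → ℝ}
    {f : ℕ → AddCircle T → ℝ} {p q : AddCircle T → ℝ} {B : ℝ}
    (hf : ∀ n, IsSineSeries (z n) (f n)) (hp : IsSineSeries y p)
    (hB : ∀ n, ∑' k, z n k ^ 2 ≤ B) (hlim : ∀ k, Tendsto (fun n => z n k) atTop (𝓝 (y k)))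
    (hq : MemLp q 2 haarAddCircle) :
    Tendsto (fun n => ∫ x, f n x * q x ∂haarAddCircle) atTop
      (𝓝 (∫ x, p x * q x ∂haarAddCircle)) := by
  simp only [← ((hf _).hasSum_mul_integral hq).tsum_eq, ← (hp.hasSum_mul_integral hq).tsum_eq]
  refine tendsto_tsum_of_tight (w := fun n k => z n k ^ 2) (B := B)
    (fun n => ((hf n).hasSum_mul_integral hq).summable) (hp.hasSum_mul_integral hq).summable
    (fun n => (hf n).hasSum_sq.summable) (fun n k => sq_nonneg _) hB
    (fun k => (hlim k).mul_const _) fun ε hε => ?_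
  refine ⟨fun k => (4 * ε)⁻¹ * (∫ x, (fourier k x).im * q x ∂haarAddCircle) ^ 2,
    (summable_sq_integral_fourier_im_mul hq).mul_left _, fun n k => ?_⟩
  set s := ∫ x, (fourier k x).im * q x ∂haarAddCircle
  have e : (4 * ε)⁻¹ * s ^ 2 + ε * z n k ^ 2 - |z n k| * |s| =
      (4 * ε)⁻¹ * (|s| - 2 * ε * |z n k|) ^ 2 := by
    rw [← sq_abs s, ← sq_abs (z n k)]
    field_simp
    ring
  have : 0 ≤ (4 * ε)⁻¹ * (|s| - 2 * ε * |z n k|) ^ 2 := by positivity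
  rw [abs_mul]
  linarith

/-- The truncation of a function at the levels `±N`. -/
def truncate (N : ℕ) (a : ℝ) : ℝ := max (-N) (min a N)

theorem continuous_truncate (N : ℕ) : Continuous (truncate N) := by
  unfold truncate
  fun_prop

theorem abs_truncate_le (N : ℕ) (a : ℝ) : |truncate N a| ≤ N := by
  have : (0 : ℝ) ≤ N := Nat.cast_nonneg N
  rw [abs_le, truncate]
  exact ⟨le_max_left _ _, max_le (by linarith) (min_le_right _ _)⟩

/-- Where `a` exceeds the truncation level, `a - truncate N a` has the sign of the truncation. Thus
the linear term in the tangent inequality at `truncate N a` can be discarded. -/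
theorem truncate_pow_three_mul_nonneg (N : ℕ) (a : ℝ) :
    0 ≤ truncate N a ^ 3 * (a - truncate N a) := by
  have hN : (0 : ℝ) ≤ N := Nat.cast_nonneg N
  rcases le_total a (-N) with h | h
  · have : truncate N a = -N := by
      rw [truncate, min_eq_left (by linarith), max_eq_left h]
    rw [this, show (-(N : ℝ)) ^ 3 * (a - -N) = (N : ℝ) ^ 3 * (-N - a) by ring]
    exact mul_nonneg (by positivity) (by linarith)
  · rcases le_total a N with h' | h'
    · have : truncate N a = a := by rw [truncate, min_eq_left h', max_eq_right h]
      rw [this, sub_self, mul_zero]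
    · have : truncate N a = N := by
        rw [truncate, min_eq_right h', max_eq_right (by linarith)]
      rw [this]
      exact mul_nonneg (by positivity) (by linarith)

theorem tendsto_truncate (a : ℝ) : Tendsto (fun N => truncate N a) atTop (𝓝 a) := by
  obtain ⟨M, hM⟩ := exists_nat_ge |a|
  refine tendsto_const_nhds.congr' ?_
  filter_upwards [eventually_ge_atTop M] with N hN
  have : |a| ≤ N := hM.trans (by exact_mod_cast hN)
  rw [abs_le] at this
  rw [truncate, min_eq_left this.2, max_eq_right this.1]

/-- Weak lower semicontinuity of the fourth power of the `L⁴` norm. -/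
theorem integral_pow_four_le_of_tendsto_coeff {z : ℕ → ℤ → ℝ} {y : ℤ → ℝ}
    {f : ℕ → AddCircle T → ℝ} {p : AddCircle T → ℝ} {B : ℝ} {L : ℝ}
    (hf : ∀ n, IsSineSeries (z n) (f n)) (hp : IsSineSeries y p)
    (hB : ∀ n, ∑' k, z n k ^ 2 ≤ B) (hlim : ∀ k, Tendsto (fun n => z n k) atTop (𝓝 (y k)))
    (h4 : ∀ n, Integrable (fun x => f n x ^ 4) haarAddCircle)
    (hL : Tendsto (fun n => ∫ x, f n x ^ 4 ∂haarAddCircle) atTop (𝓝 L)) :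
    Integrable (fun x => p x ^ 4) haarAddCircle ∧ ∫ x, p x ^ 4 ∂haarAddCircle ≤ L := by
  -- The tangent inequality would have to be tested against `p³`, which is not known to lie in `L²`.
  -- The truncated cube is bounded, so weak convergence applies to it, and the truncation is removed
  -- at the end.
  have hmeas (N : ℕ) : AEStronglyMeasurable (fun x => truncate N (p x)) haarAddCircle :=
    (continuous_truncate N).comp_aestronglyMeasurable hp.memLp.1
  have hbdd (N j : ℕ) (x : AddCircle T) : ‖truncate N (p x) ^ j‖ ≤ N ^ j := by
    rw [norm_pow]
    exact pow_le_pow_left₀ (norm_nonneg _) (abs_truncate_le N _) j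
  have hi (N j : ℕ) : Integrable (fun x => truncate N (p x) ^ j) haarAddCircle :=
    Integrable.of_bound ((hmeas N).pow j) _ (ae_of_all _ (hbdd N j))
  have hm3 (N : ℕ) : MemLp (fun x => truncate N (p x) ^ 3) 2 haarAddCircle :=
    MemLp.of_bound ((hmeas N).pow 3) _ (ae_of_all _ (hbdd N 3))
  have hfi (N : ℕ) {q : AddCircle T → ℝ} (hq : MemLp q 2 haarAddCircle) :
      Integrable (fun x => q x * truncate N (p x) ^ 3) haarAddCircle :=
    hq.integrable_mul (hm3 N)
  have hN (N : ℕ) : ∫ x, truncate N (p x) ^ 4 ∂haarAddCircle ≤ L := by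
    have hexp {q : AddCircle T → ℝ} (hq : MemLp q 2 haarAddCircle) :
        ∫ x, (truncate N (p x) ^ 4 + 4 * (truncate N (p x) ^ 3 * (q x - truncate N (p x))))
          ∂haarAddCircle = 4 * (∫ x, q x * truncate N (p x) ^ 3 ∂haarAddCircle)
            - 3 * ∫ x, truncate N (p x) ^ 4 ∂haarAddCircle := by
      rw [← integral_const_mul, ← integral_const_mul,
        ← integral_sub ((hfi N hq).const_mul 4) ((hi N 4).const_mul 3)]
      refine integral_congr_ae (ae_of_all _ fun x => ?_)
      simp only
      ring
    have hint {q : AddCircle T → ℝ} (hq : MemLp q 2 haarAddCircle) :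
        Integrable (fun x => truncate N (p x) ^ 4 +
          4 * (truncate N (p x) ^ 3 * (q x - truncate N (p x)))) haarAddCircle := by
      refine (((hfi N hq).const_mul 4).sub ((hi N 4).const_mul 3)).congr (ae_of_all _ fun x => ?_)
      simp only [Pi.sub_apply]
      ring
    have h1 (n : ℕ) : 4 * (∫ x, f n x * truncate N (p x) ^ 3 ∂haarAddCircle)
            - 3 * ∫ x, truncate N (p x) ^ 4 ∂haarAddCircle ≤ ∫ x, f n x ^ 4 ∂haarAddCircle := by
      rw [← hexp (hf n).memLp]
      exact integral_mono (hint (hf n).memLp) (h4 n) fun x => tangent_le_pow_four _ _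
    have h2 := ((tendsto_integral_mul_of_tendsto_coeff hf hp hB hlim (hm3 N)).const_mul 4).sub_const
      (3 * ∫ x, truncate N (p x) ^ 4 ∂haarAddCircle)
    have h3 := le_of_tendsto_of_tendsto' h2 hL h1
    rw [← hexp hp.memLp] at h3
    -- The term `4 truncate³ (p - truncate)` is nonnegative and is dropped.
    refine le_trans (integral_mono (hi N 4) (hint hp.memLp) fun x => ?_) h3
    have := truncate_pow_three_mul_nonneg N (p x)
    simp only
    linarith
  have hle (N : ℕ) : ∫⁻ x, ENNReal.ofReal (truncate N (p x) ^ 4) ∂haarAddCircle ≤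
      ENNReal.ofReal L := by
    have h0 : 0 ≤ᵐ[haarAddCircle] fun x => truncate N (p x) ^ 4 :=
      ae_of_all _ fun x => Even.pow_nonneg (by decide) _
    rw [← ofReal_integral_eq_lintegral_ofReal (hi N 4) h0]
    exact ENNReal.ofReal_le_ofReal (hN N)
  have hp0 : 0 ≤ᵐ[haarAddCircle] fun x => p x ^ 4 :=
    ae_of_all _ fun x => Even.pow_nonneg (by decide) _
  have hae (N : ℕ) : AEMeasurable (fun x => ENNReal.ofReal (truncate N (p x) ^ 4))
      haarAddCircle := (hi N 4).1.aemeasurable.ennreal_ofReal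
  -- Fatou's lemma as `N → ∞`; it also yields the integrability of `p⁴`.
  have hlint : ∫⁻ x, ENNReal.ofReal (p x ^ 4) ∂haarAddCircle ≤ ENNReal.ofReal L := by
    calc ∫⁻ x, ENNReal.ofReal (p x ^ 4) ∂haarAddCircle
        = ∫⁻ x, liminf (fun N => ENNReal.ofReal (truncate N (p x) ^ 4)) atTop ∂haarAddCircle := by
          refine lintegral_congr fun x => ?_
          refine (Tendsto.liminf_eq ?_).symm
          exact ENNReal.tendsto_ofReal ((tendsto_truncate (p x)).pow 4)
      _ ≤ liminf (fun N => ∫⁻ x, ENNReal.ofReal (truncate N (p x) ^ 4) ∂haarAddCircle) atTop :=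
          lintegral_liminf_le' hae
      _ ≤ ENNReal.ofReal L := by
          exact (liminf_le_liminf (Eventually.of_forall hle)).trans_eq (liminf_const _)
  have hpm : AEStronglyMeasurable (fun x => p x ^ 4) haarAddCircle := hp.memLp.1.pow 4
  have hL0 : 0 ≤ L := (integral_nonneg fun x => Even.pow_nonneg (by decide) _).trans (hN 0)
  refine ⟨⟨hpm, ?_⟩, ?_⟩
  · rw [hasFiniteIntegral_iff_ofReal hp0]
    exact hlint.trans_lt ENNReal.ofReal_lt_top
  · rw [integral_eq_lintegral_of_nonneg_ae hp0 hpm]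
    exact ENNReal.toReal_le_of_le_ofReal hL0 hlint

end Sine

/-- The functional `J` with general weights in the quadratic part. -/
def weightedJ (b z : ℤ → ℝ) : ℝ :=
  1 / 4 * conv (conv z z) (conv z z) 0 + ∑' k, b k * z k ^ 2

/-- The weights of the quadratic part of `J`, at the odd indices. -/
def weight (g : ℝ → ℝ) (γ ω T : ℝ) (k : ℤ) : ℝ :=
  if Odd k then T / (γ * ω ^ 4) * (PhiDeriv g ω k / (k : ℝ) ^ 2) else 0

theorem J_eq_weightedJ (g : ℝ → ℝ) (γ ω T : ℝ) {z : ℤ → ℝ} (hz : z ∈ DomJ) :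
    J g γ ω T z = weightedJ (weight g γ ω T) z := by
  rw [J, weightedJ, ← tsum_mul_left]
  congr 1
  refine tsum_congr fun k => ?_
  rw [weight]
  split_ifs with h
  · ring
  · rw [hz.1 k (Int.not_odd_iff_even.1 h)]
    ring

/-! ### Coercivity and the direct method -/

section Sine

open AddCircle

variable {T : ℝ} [hT : Fact (0 < T)]

theorem summable_bounded_mul_sq {b z : ℤ → ℝ} {A : ℝ} (hb : ∀ k, |b k| ≤ A)
    (hz : Summable fun k => z k ^ 2) : Summable fun k => b k * z k ^ 2 := by
  refine Summable.of_norm_bounded (hz.mul_left A) fun k => ?_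
  rw [norm_mul, Real.norm_eq_abs, norm_pow, Real.norm_eq_abs, sq_abs]
  exact mul_le_mul_of_nonneg_right (hb k) (sq_nonneg _)

theorem IsSineSeries.weightedJ_eq {z : ℤ → ℝ} {f : AddCircle T → ℝ} (h : IsSineSeries z f)
    (h4 : Integrable (fun x => f x ^ 4) haarAddCircle) (b : ℤ → ℝ) :
    weightedJ b z = 1 / 4 * ∫ x, f x ^ 4 ∂haarAddCircle + ∑' k, b k * z k ^ 2 := by
  rw [weightedJ, h.conv_conv_zero h4]

/-- Keep only the zeroth mode of `f²` in Parseval's identity: in function terms, `(∫ f²)² ≤ ∫ f⁴`.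
-/
theorem IsSineSeries.sq_tsum_sq_le {z : ℤ → ℝ} {f : AddCircle T → ℝ} (h : IsSineSeries z f)
    (h4 : Integrable (fun x => f x ^ 4) haarAddCircle) :
    (∑' k, z k ^ 2) ^ 2 ≤ ∫ x, f x ^ 4 ∂haarAddCircle := by
  have h1 := h.hasSum_conv_sq h4
  have h2 := le_hasSum h1 0 fun k _ => sq_nonneg _
  have h3 : conv z z 0 = - ∑' k, z k ^ 2 := by
    rw [conv, ← tsum_neg]
    refine tsum_congr fun k => ?_
    rw [zero_sub, h.antisymm]
    ring
  rwa [h3, neg_sq] at h2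

/-- Coercivity: the quartic part grows like the square of `s = ∑ z_k²`, while the quadratic part is
at worst `-A s`. -/
theorem IsSineSeries.weightedJ_ge {b z : ℤ → ℝ} {A : ℝ} (hb : ∀ k, |b k| ≤ A)
    {f : AddCircle T → ℝ} (h : IsSineSeries z f)
    (h4 : Integrable (fun x => f x ^ 4) haarAddCircle) :
    1 / 4 * (∑' k, z k ^ 2) ^ 2 - A * ∑' k, z k ^ 2 ≤ weightedJ b z := by
  rw [h.weightedJ_eq h4]
  have h1 := h.sq_tsum_sq_le h4
  have hs := h.hasSum_sq.summable
  have h2 : - (A * ∑' k, z k ^ 2) ≤ ∑' k, b k * z k ^ 2 := by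
    rw [← tsum_mul_left, ← tsum_neg]
    refine ((hs.mul_left A).neg).tsum_le_tsum (fun k => ?_) (summable_bounded_mul_sq hb hs)
    have := neg_le_of_abs_le (hb k)
    nlinarith [sq_nonneg (z k)]
  linarith

theorem tsum_sq_le_of_tendsto {z : ℕ → ℤ → ℝ} {y : ℤ → ℝ} {B : ℝ}
    (hs : ∀ n, Summable fun k => z n k ^ 2) (hB : ∀ n, ∑' k, z n k ^ 2 ≤ B)
    (hlim : ∀ k, Tendsto (fun n => z n k) atTop (𝓝 (y k))) : Summable fun k => y k ^ 2 := by
  refine summable_of_sum_le (c := B) (fun k => sq_nonneg _) fun S => ?_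
  have h1 : Tendsto (fun n => ∑ k ∈ S, z n k ^ 2) atTop (𝓝 (∑ k ∈ S, y k ^ 2)) :=
    tendsto_finsetSum _ fun k _ => (hlim k).pow 2
  exact le_of_tendsto' h1 fun n => ((hs n).sum_le_tsum S fun k _ => sq_nonneg _).trans (hB n)

/-- Diagonal forms with null weights are weakly continuous: only finitely many weights exceed `ε`,
and the remaining ones contribute at most `ε ∑ z_k²`. -/
theorem tendsto_tsum_weight_mul_sq {b : ℤ → ℝ} {z : ℕ → ℤ → ℝ} {y : ℤ → ℝ} {A B : ℝ}
    (hb : ∀ k, |b k| ≤ A) (hb0 : Tendsto b cofinite (𝓝 0))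
    (hs : ∀ n, Summable fun k => z n k ^ 2) (hB : ∀ n, ∑' k, z n k ^ 2 ≤ B)
    (hlim : ∀ k, Tendsto (fun n => z n k) atTop (𝓝 (y k))) :
    Tendsto (fun n => ∑' k, b k * z n k ^ 2) atTop (𝓝 (∑' k, b k * y k ^ 2)) := by
  have hB0 : 0 ≤ B := (tsum_nonneg fun k => sq_nonneg (z 0 k)).trans (hB 0)
  refine tendsto_tsum_of_tight (w := fun n k => z n k ^ 2) (B := B)
    (fun n => summable_bounded_mul_sq hb (hs n))
    (summable_bounded_mul_sq hb (tsum_sq_le_of_tendsto hs hB hlim)) hs (fun n k => sq_nonneg _) hB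
    (fun k => ((hlim k).pow 2).const_mul _) fun ε hε => ?_
  have hfin : {k | ¬ |b k| < ε}.Finite := by
    have := hb0.abs.eventually (gt_mem_nhds (by rwa [abs_zero] : |(0 : ℝ)| < ε))
    exact this
  refine ⟨fun k => if k ∈ hfin.toFinset then A * B else 0, ?_, fun n k => ?_⟩
  · exact summable_of_ne_finset_zero (s := hfin.toFinset) fun k hk => by simp only [hk, if_false]
  · have hzB : z n k ^ 2 ≤ B := ((hs n).le_tsum k fun _ _ => sq_nonneg _).trans (hB n)
    have hz0 := sq_nonneg (z n k)
    rw [abs_mul, abs_of_nonneg hz0]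
    by_cases hk : |b k| < ε
    · have : k ∉ hfin.toFinset := by simpa using hk
      simp only [this, if_false, zero_add]
      exact mul_le_mul_of_nonneg_right hk.le hz0
    · have : k ∈ hfin.toFinset := by simpa using hk
      simp only [this, if_true]
      have h1 : |b k| * z n k ^ 2 ≤ A * B :=
        mul_le_mul (hb k) hzB hz0 ((abs_nonneg _).trans (hb k))
      nlinarith

/-- Weighted functionals attain their minima on the symmetric subspaces. -/
theorem exists_weightedJ_minimizer (T : ℝ) [hT : Fact (0 < T)] {b : ℤ → ℝ} {A : ℝ}
    (hb : ∀ k, |b k| ≤ A)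
    (hb0 : Tendsto b cofinite (𝓝 0)) (r : ℕ) :
    ∃ α ∈ symDom r, ∀ z ∈ symDom r, weightedJ b α ≤ weightedJ b z := by
  have hA : 0 ≤ A := (abs_nonneg _).trans (hb 0)
  have hlow {z : ℤ → ℝ} (hz : z ∈ DomJ) :
      1 / 4 * (∑' k, z k ^ 2) ^ 2 - A * ∑' k, z k ^ 2 ≤ weightedJ b z := by
    obtain ⟨f, hf, h4⟩ := exists_isSineSeries_of_mem_DomJ (T := T) hz
    exact hf.weightedJ_ge hb h4
  have h0 : (0 : ℤ → ℝ) ∈ symDom r :=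
    ⟨(isSineSeries_zero (T := T)).mem_DomJ (by simp) (fun _ _ => rfl), fun _ _ => rfl⟩
  set S := weightedJ b '' symDom r
  have hne : S.Nonempty := ⟨_, 0, h0, rfl⟩
  have hbdd : BddBelow S := by
    -- This is the minimum of `s²/4 - A s`, attained at `s = 2A`.
    refine ⟨-A ^ 2, ?_⟩
    rintro _ ⟨z, hz, rfl⟩
    have := hlow hz.1
    nlinarith [sq_nonneg (∑' k, z k ^ 2 - 2 * A)]
  obtain ⟨u, -, hu, huS⟩ := exists_seq_tendsto_sInf hne hbdd
  choose z hz hzu using huS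
  obtain ⟨K, hK⟩ := hu.bddAbove_range
  have hJK (n : ℕ) : weightedJ b (z n) ≤ K := by
    rw [hzu]
    exact hK ⟨n, rfl⟩
  -- For `s > B` one has `s > 4` and `s/4 - A > |K|/4 + 1`, hence `s²/4 - A s > K`.
  set B := 4 * A + |K| + 4
  have hB (n : ℕ) : ∑' k, z n k ^ 2 ≤ B := by
    have h1 := (hlow (hz n).1).trans (hJK n)
    by_contra hlt
    rw [not_le] at hlt
    have hs : 4 * A + |K| + 4 < ∑' k, z n k ^ 2 := hlt
    have hk := le_abs_self K
    have hk0 := abs_nonneg K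
    nlinarith
  have hsq (n : ℕ) := summable_sq_of_mem_DomJ (hz n).1
  -- Compactness of the product (Tychonoff) gives a coefficientwise convergent subsequence. The side
  -- `B + 1` is chosen because `z_k² ≤ B ≤ (B + 1)²`.
  have hcpt : IsCompact (univ.pi fun _ : ℤ => Icc (-(B + 1)) (B + 1)) :=
    isCompact_univ_pi fun _ => isCompact_Icc
  have hB0 : 0 ≤ B := (tsum_nonneg fun k => sq_nonneg (z 0 k)).trans (hB 0)
  obtain ⟨y, -, φ, hφ, hy⟩ := hcpt.tendsto_subseq (x := z) fun n k _ => by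
    have := ((hsq n).le_tsum k fun _ _ => sq_nonneg _).trans (hB n)
    exact abs_le.1 (abs_le_of_sq_le_sq (by nlinarith) (by positivity))
  have hlim (k : ℤ) : Tendsto (fun n => z (φ n) k) atTop (𝓝 (y k)) := (tendsto_pi_nhds.1 hy) k
  have hyanti (k : ℤ) : y (-k) = - y k := by
    refine tendsto_nhds_unique (hlim (-k)) ?_
    simp only [(hz _).1.2.1 k]
    exact (hlim k).neg
  have hyzero {k : ℤ} (h : ∀ n, z (φ n) k = 0) : y k = 0 := by
    refine tendsto_nhds_unique (hlim k) ?_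
    simp only [h]
    exact tendsto_const_nhds
  have hys := tsum_sq_le_of_tendsto (fun n => hsq (φ n)) (fun n => hB (φ n)) hlim
  obtain ⟨p, hp⟩ := exists_isSineSeries (T := T) hyanti hys
  choose f hf h4 using fun n => exists_isSineSeries_of_mem_DomJ (T := T) (hz n).1
  have hq := tendsto_tsum_weight_mul_sq hb hb0 (fun n => hsq (φ n)) (fun n => hB (φ n)) hlim
  have hJlim : Tendsto (fun n => weightedJ b (z (φ n))) atTop (𝓝 (sInf S)) := by
    simp only [hzu]
    exact hu.comp hφ.tendsto_atTop
  -- Since the quadratic parts converge, the quartic parts converge too, and lower semicontinuity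
  -- compares their limit with the quartic part of `y`.
  have hL : Tendsto (fun n => ∫ x, f (φ n) x ^ 4 ∂haarAddCircle) atTop
      (𝓝 (4 * (sInf S - ∑' k, b k * y k ^ 2))) := by
    refine ((hJlim.sub hq).const_mul 4).congr fun n => ?_
    rw [(hf (φ n)).weightedJ_eq (h4 (φ n))]
    ring
  obtain ⟨hp4, hple⟩ := integral_pow_four_le_of_tendsto_coeff (fun n => hf (φ n)) hp
    (fun n => hB (φ n)) hlim (fun n => h4 (φ n)) hL
  refine ⟨y, ⟨hp.mem_DomJ hp4 fun k hk => hyzero fun n => (hz _).1.1 k hk,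
    fun k hk => hyzero fun n => (hz _).2 k hk⟩, fun z' hz' => ?_⟩
  refine le_trans ?_ (csInf_le hbdd ⟨z', hz', rfl⟩)
  rw [hp.weightedJ_eq hp4]
  linarith

end Sine

/-! ### The Euler-Lagrange equation -/

theorem linear_coeff_eq_zero_of_min {e₁ e₂ e₃ e₄ : ℝ}
    (h : ∀ ε : ℝ, 0 ≤ e₁ * ε + e₂ * ε ^ 2 + e₃ * ε ^ 3 + e₄ * ε ^ 4) : e₁ = 0 := by
  set P : ℝ → ℝ := fun ε => e₁ * ε + e₂ * ε ^ 2 + e₃ * ε ^ 3 + e₄ * ε ^ 4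
  have hd : HasDerivAt P e₁ 0 := by
    have h1 := (((hasDerivAt_id (0 : ℝ)).const_mul e₁).add (((hasDerivAt_id (0 : ℝ)).pow 2).const_mul e₂)).add
      (((hasDerivAt_id (0 : ℝ)).pow 3).const_mul e₃) |>.add (((hasDerivAt_id (0 : ℝ)).pow 4).const_mul e₄)
    refine HasDerivAt.congr_deriv (f := P) h1 (by simp)
  have hmin : IsLocalMin P 0 := by
    refine Eventually.of_forall fun ε => ?_
    have := h ε
    simpa [P] using this
  exact hmin.hasDerivAt_eq_zero hd

section Sine

open AddCircle

variable {T : ℝ} [hT : Fact (0 < T)]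

/-- The residue class of `r` modulo `2r` is invariant under `k ↦ -k`, as `-r ≡ r`, and consists of
odd numbers for odd `r`. Hence `δ_k - δ_{-k}` is an admissible direction in the symmetric class. -/
theorem oddUnit_mem {r : ℕ} (hr : Odd r) {k : ℤ} (hk : k ≡ r [ZMOD (2 * (r : ℤ))]) :
    (∀ n, Even n → oddUnit k n = 0) ∧ ∀ n : ℤ, ¬ n ≡ r [ZMOD (2 * (r : ℤ))] → oddUnit k n = 0 := by
  have hr' : Odd (r : ℤ) := by exact_mod_cast hr
  have hkodd : Odd k := by
    obtain ⟨c, hc⟩ := hk.symm.dvd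
    have : k = r + 2 * (r * c) := by linarith
    rw [this]
    exact hr'.add_even (even_two_mul _)
  have hneg : -k ≡ r [ZMOD (2 * (r : ℤ))] := by
    have h1 : -k ≡ -r [ZMOD (2 * (r : ℤ))] := hk.neg
    refine h1.trans ?_
    exact (Int.modEq_iff_dvd.2 ⟨1, by ring⟩)
  refine ⟨fun n hn => ?_, fun n hn => ?_⟩
  · have h1 : n ≠ k := fun h => Int.not_even_iff_odd.2 hkodd (h ▸ hn)
    have h2 : n ≠ -k := fun h => Int.not_even_iff_odd.2 hkodd.neg (h ▸ hn)
    simp [oddUnit, h1, h2]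
  · have h1 : n ≠ k := fun h => hn (h ▸ hk)
    have h2 : n ≠ -k := fun h => hn (h ▸ hneg)
    simp [oddUnit, h1, h2]

theorem hasSum_mul_oddUnit (F : ℤ → ℝ) (k : ℤ) :
    HasSum (fun n => F n * oddUnit k n) (F k - F (-k)) := by
  have h1 (j : ℤ) : HasSum (fun n => F n * if n = j then 1 else 0) (F j) := by
    have := hasSum_single (f := fun n => F n * if n = j then 1 else 0) j (fun n hn => by simp [hn])
    simpa using this
  simpa [oddUnit, mul_sub] using (h1 k).sub (h1 (-k))

/-- Powers up to the fourth are dominated by `1 + f⁴`, and `q` is bounded on the compact circle. -/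
theorem IsSineSeries.integrable_pow_mul {z : ℤ → ℝ} {f : AddCircle T → ℝ} (h : IsSineSeries z f)
    (h4 : Integrable (fun x => f x ^ 4) haarAddCircle) {i : ℕ} (hi : i ≤ 4) {q : AddCircle T → ℝ}
    (hq : Continuous q) : Integrable (fun x => f x ^ i * q x) haarAddCircle := by
  have hfi : Integrable (fun x => f x ^ i) haarAddCircle := by
    have hm : AEStronglyMeasurable (fun x => f x ^ i) haarAddCircle := h.memLp.1.pow i
    refine ((integrable_const (1 : ℝ)).add h4).mono' hm (ae_of_all _ fun x => ?_)
    rw [norm_pow, Real.norm_eq_abs, Pi.add_apply]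
    have e4 : f x ^ 4 = |f x| ^ 4 := by
      rw [← abs_pow, abs_of_nonneg (Even.pow_nonneg (by decide) _)]
    rw [e4]
    rcases le_total |f x| 1 with h1 | h1
    · have := pow_le_one₀ (n := i) (abs_nonneg _) h1
      have : 0 ≤ |f x| ^ 4 := by positivity
      linarith
    · have := pow_le_pow_right₀ h1 hi
      linarith
  obtain ⟨C, hC⟩ := isCompact_univ.exists_bound_of_continuousOn hq.continuousOn
  have := hfi.bdd_mul hq.aestronglyMeasurable (ae_of_all _ fun x => hC x (mem_univ x))
  simpa only [mul_comm] using this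

/-- The direction `δ_k - δ_{-k}` is the function `2 sin_k`, so along it the functional is a quartic
polynomial in `ε`. The linear coefficient gives the Euler-Lagrange equation; the higher ones,
evaluated at `z = 0`, give a trial sequence of negative energy. -/
theorem IsSineSeries.weightedJ_add_oddUnit {z : ℤ → ℝ} {f : AddCircle T → ℝ}
    (h : IsSineSeries z f) (h4 : Integrable (fun x => f x ^ 4) haarAddCircle) {b : ℤ → ℝ} {A : ℝ}
    (hb : ∀ k, |b k| ≤ A) (k : ℤ) :
    ∃ e₂ e₃ e₄ : ℝ, (e₂ = 6 * ∫ x, f x ^ 2 * (fourier k x).im ^ 2 ∂haarAddCircle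
        + ∑' n, b n * oddUnit k n ^ 2) ∧
      (e₃ = 8 * ∫ x, f x * (fourier k x).im ^ 3 ∂haarAddCircle) ∧
      (e₄ = 4 * ∫ x : AddCircle T, (fourier k x).im ^ 4 ∂haarAddCircle) ∧
      ∀ ε : ℝ, Integrable (fun x => (f x + ε * (2 * (fourier k x).im)) ^ 4) haarAddCircle ∧
      weightedJ b (fun n => z n + ε * oddUnit k n) = weightedJ b z +
        ((2 * ∫ x, f x ^ 3 * (fourier k x).im ∂haarAddCircle
            + 2 * (b k * z k - b (-k) * z (-k))) * ε
          + e₂ * ε ^ 2 + e₃ * ε ^ 3 + e₄ * ε ^ 4) := by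
  refine ⟨_, _, _, rfl, rfl, rfl, fun ε => ?_⟩
  have hc := continuous_fourier_im (T := T) k
  have i0 : Integrable (fun x => f x ^ 0 * (fourier k x).im ^ 4) haarAddCircle :=
    h.integrable_pow_mul h4 (by norm_num) (hc.pow 4)
  have i1 : Integrable (fun x => f x ^ 1 * (fourier k x).im ^ 3) haarAddCircle :=
    h.integrable_pow_mul h4 (by norm_num) (hc.pow 3)
  have i2 : Integrable (fun x => f x ^ 2 * (fourier k x).im ^ 2) haarAddCircle :=
    h.integrable_pow_mul h4 (by norm_num) (hc.pow 2)
  have i3 : Integrable (fun x => f x ^ 3 * (fourier k x).im) haarAddCircle :=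
    h.integrable_pow_mul h4 (by norm_num) hc
  simp only [pow_zero, one_mul, pow_one] at i0 i1
  have e : (fun x => (f x + ε * (2 * (fourier k x).im)) ^ 4) = fun x =>
      f x ^ 4 + (8 * ε) * (f x ^ 3 * (fourier k x).im)
        + (24 * ε ^ 2) * (f x ^ 2 * (fourier k x).im ^ 2)
        + (32 * ε ^ 3) * (f x * (fourier k x).im ^ 3) + (16 * ε ^ 4) * (fourier k x).im ^ 4 := by
    funext x
    ring
  have j3 : Integrable (fun x => f x ^ 4 + (8 * ε) * (f x ^ 3 * (fourier k x).im))
      haarAddCircle := h4.add (i3.const_mul (8 * ε))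
  have j2 : Integrable (fun x => f x ^ 4 + (8 * ε) * (f x ^ 3 * (fourier k x).im)
        + (24 * ε ^ 2) * (f x ^ 2 * (fourier k x).im ^ 2)) haarAddCircle :=
    j3.add (i2.const_mul (24 * ε ^ 2))
  have j1 : Integrable (fun x => f x ^ 4 + (8 * ε) * (f x ^ 3 * (fourier k x).im)
        + (24 * ε ^ 2) * (f x ^ 2 * (fourier k x).im ^ 2)
        + (32 * ε ^ 3) * (f x * (fourier k x).im ^ 3)) haarAddCircle :=
    j2.add (i1.const_mul (32 * ε ^ 3))
  have j0 := j1.add (i0.const_mul (16 * ε ^ 4))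
  have hint : Integrable (fun x => (f x + ε * (2 * (fourier k x).im)) ^ 4) haarAddCircle := by
    rw [e]
    exact j0
  refine ⟨hint, ?_⟩
  rw [(h.add_mul (isSineSeries_oddUnit k) ε).weightedJ_eq hint, h.weightedJ_eq h4, e,
    integral_add j1 (i0.const_mul _), integral_add j2 (i1.const_mul _),
    integral_add j3 (i2.const_mul _), integral_add h4 (i3.const_mul _)]
  simp only [integral_const_mul]
  have hq : ∑' n, b n * (z n + ε * oddUnit k n) ^ 2 = ∑' n, b n * z n ^ 2
      + 2 * ε * (b k * z k - b (-k) * z (-k)) + ε ^ 2 * ∑' n, b n * oddUnit k n ^ 2 := by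
    have s1 := summable_bounded_mul_sq hb h.hasSum_sq.summable
    have s2 := hasSum_mul_oddUnit (fun n => b n * z n) k
    have s3 := summable_bounded_mul_sq hb (isSineSeries_oddUnit (T := T) k).hasSum_sq.summable
    have s4 := (s1.hasSum.add (s2.mul_left (2 * ε))).add (s3.hasSum.mul_left (ε ^ 2))
    rw [← s4.tsum_eq]
    refine tsum_congr fun n => ?_
    ring
  rw [hq]
  ring

/-- The Euler-Lagrange equation of the weighted functional: the cube of the sine series of a
minimizer is again a sine series. -/
theorem IsSineSeries.cube_of_minimizer {α : ℤ → ℝ} {f : AddCircle T → ℝ} {b : ℤ → ℝ} {A : ℝ}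
    {r : ℕ} (hr : Odd r) (hα : α ∈ symDom r) (hmin : ∀ z ∈ symDom r, weightedJ b α ≤ weightedJ b z)
    (hb : ∀ k, |b k| ≤ A) (hbneg : ∀ k, b (-k) = b k)
    (h : IsSineSeries α f) (h4 : Integrable (fun x => f x ^ 4) haarAddCircle) :
    IsSineSeries (fun k => -2 * b k * α k) fun x => f x ^ 3 := by
  have hi3 : Integrable (fun x => f x ^ 3) haarAddCircle := by
    simpa using h.integrable_pow_mul h4 (i := 3) (by norm_num) (continuous_const (y := (1 : ℝ)))
  have hEL {k : ℤ} (hk : k ≡ r [ZMOD (2 * (r : ℤ))]) :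
      ∫ x, f x ^ 3 * (fourier k x).im ∂haarAddCircle = -2 * b k * α k := by
    obtain ⟨e₂, e₃, e₄, -, -, -, hε⟩ := h.weightedJ_add_oddUnit h4 hb k
    have h0 := linear_coeff_eq_zero_of_min
      -- For symmetric weights and antisymmetric `α` this coefficient is `2 ∫ f³ sin_k + 4 b_k α_k`.
      (e₁ := 2 * ∫ x, f x ^ 3 * (fourier k x).im ∂haarAddCircle
            + 2 * (b k * α k - b (-k) * α (-k))) (e₂ := e₂) (e₃ := e₃) (e₄ := e₄) fun ε => by
      obtain ⟨hi, he⟩ := hε ε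
      have hs := h.add_mul (isSineSeries_oddUnit k) ε
      obtain ⟨o1, o2⟩ := oddUnit_mem hr hk
      have := hmin (fun n => α n + ε * oddUnit k n) ⟨hs.mem_DomJ hi fun n hn => by
        rw [hα.1.1 n hn, o1 n hn]; ring, fun n hn => by simp only [hα.2 n hn, o2 n hn]; ring⟩
      rw [he] at this
      linarith
    rw [hbneg, hα.1.2.1] at h0
    linarith
  have hm2 : MemLp (fun x => ((f x ^ 2 : ℝ) : ℂ)) 2 haarAddCircle := (h.memLp_sq_iff.2 h4).ofReal
  -- The coefficients of `f³` as a double convolution of `α`. Realness of these sums makes the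
  -- coefficients purely imaginary, and their support yields the vanishing outside the symmetric
  -- class.
  have hcube (k : ℤ) : HasSum (fun l => ((conv α α l * α (k - l) : ℝ) : ℂ))
      (-Complex.I * fourierCoeff (fun x => ((f x ^ 3 : ℝ) : ℂ)) k) := by
    have := (hasSum_fourierCoeff_mul hm2 h.memLp_ofReal k).mul_left (-Complex.I)
    simp only [h.fourierCoeff_sq, h.coeff] at this
    have e1 : (fun x => ((f x ^ 3 : ℝ) : ℂ)) = fun x => ((f x ^ 2 : ℝ) : ℂ) * (f x : ℂ) := by
      funext x
      push_cast
      ring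
    have e2 (l : ℤ) : ((conv α α l * α (k - l) : ℝ) : ℂ) =
        -Complex.I * (-(conv α α l : ℂ) * (-Complex.I * (α (k - l) : ℂ))) := by
      push_cast
      linear_combination (conv α α l * α (k - l) : ℂ) * Complex.I_sq
    simp only [e1, e2]
    exact this
  have hcoeff (k : ℤ) : fourierCoeff (fun x => ((f x ^ 3 : ℝ) : ℂ)) k =
      -Complex.I * ((-2 * b k * α k : ℝ) : ℂ) := by
    by_cases hk : k ≡ r [ZMOD (2 * (r : ℤ))]
    · have hre : (-Complex.I * fourierCoeff (fun x => ((f x ^ 3 : ℝ) : ℂ)) k).im = 0 := by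
        rw [← (hcube k).tsum_eq, ← Complex.ofReal_tsum, Complex.ofReal_im]
      have him : (fourierCoeff (fun x => ((f x ^ 3 : ℝ) : ℂ)) k).im = - (-2 * b k * α k) := by
        rw [← hEL hk, fourierCoeff, ← integral_neg]
        have := integral_im (𝕜 := ℂ)
          (integrable_continuous_mul hi3.ofReal (fourier (-k)).continuous)
        refine Eq.trans (Eq.symm this) (integral_congr_ae (ae_of_all _ fun x => ?_))
        simp [-Complex.ofReal_pow]
        ring
      apply Complex.ext
      · simpa using hre
      · simpa using him
    -- Outside the class there is no admissible variation. Instead, a nonzero term would write `k`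
    -- as a sum of three indices `≡ r`, whence `k ≡ 3r ≡ r` modulo `2r`.
    · have hz : ∀ l, conv α α l * α (k - l) = 0 := by
        intro l
        by_cases hl : k - l ≡ r [ZMOD (2 * (r : ℤ))]
        · have hconv : conv α α l = 0 := by
            rw [conv]
            refine (tsum_congr fun i => ?_).trans tsum_zero
            by_cases h1 : i ≡ r [ZMOD (2 * (r : ℤ))]
            · by_cases h2 : l - i ≡ r [ZMOD (2 * (r : ℤ))]
              · refine absurd ?_ hk
                obtain ⟨c1, hc1⟩ := hl.dvd
                obtain ⟨c2, hc2⟩ := h1.dvd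
                obtain ⟨c3, hc3⟩ := h2.dvd
                refine Int.modEq_iff_dvd.2 ⟨c1 + c2 + c3 - 1, ?_⟩
                linear_combination hc1 + hc2 + hc3
              · rw [hα.2 _ h2, mul_zero]
            · rw [hα.2 _ h1, zero_mul]
          rw [hconv, zero_mul]
        · rw [hα.2 _ hl, mul_zero]
      have := hcube k
      simp only [hz, Complex.ofReal_zero] at this
      have h0 := this.unique hasSum_zero
      rw [hα.2 k hk]
      simpa using h0
  refine ⟨?_, hcoeff⟩
  -- The equation upgrades regularity: bounded weights times `α ∈ ℓ²` are square summable, so `f³ ∈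
  -- L²`.
  have hs : Summable fun k => ‖fourierCoeff (fun x => ((f x ^ 3 : ℝ) : ℂ)) k‖ ^ 2 := by
    refine Summable.of_nonneg_of_le (fun k => sq_nonneg _) (fun k => ?_)
      (h.hasSum_sq.summable.mul_left ((2 * A) ^ 2))
    rw [hcoeff, norm_mul, norm_neg, Complex.norm_I, one_mul, Complex.norm_real, Real.norm_eq_abs,
      abs_mul, abs_mul, mul_pow, sq_abs (α k)]
    have := hb k
    gcongr
    norm_num
  exact (memLp_two_of_summable_fourierCoeff hi3.ofReal hs).re

/-- A negative weight makes the minimum negative. -/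
theorem exists_weightedJ_neg (T : ℝ) [hT : Fact (0 < T)] {b : ℤ → ℝ} {A : ℝ}
    (hb : ∀ k, |b k| ≤ A) (hbneg : ∀ k, b (-k) = b k) {r : ℕ} (hr : Odd r) {k : ℤ}
    (hk : k ≡ r [ZMOD (2 * (r : ℤ))]) (hk0 : k ≠ 0) (hbk : b k < 0) :
    ∃ z ∈ symDom r, weightedJ b z < 0 := by
  have h := isSineSeries_zero (T := T)
  obtain ⟨e₂, e₃, e₄, h2, h3, h4, hε⟩ := h.weightedJ_add_oddUnit (by simp) hb k
  have hq : ∑' n, b n * oddUnit k n ^ 2 = 2 * b k := by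
    have hkk : k ≠ -k := fun h => hk0 (by omega)
    have s := (hasSum_mul_oddUnit (fun n => b n * oddUnit k n) k).tsum_eq
    have e1 : oddUnit k k = 1 := by simp [oddUnit, hkk]
    have e2 : oddUnit k (-k) = -1 := by simp [oddUnit, hkk.symm]
    rw [e1, e2, hbneg] at s
    rw [show 2 * b k = b k * 1 - b k * -1 by ring, ← s]
    exact tsum_congr fun n => by ring
  simp only [hq, Pi.zero_apply, ne_eq, OfNat.ofNat_ne_zero, not_false_eq_true, zero_pow, zero_mul,
    integral_zero, mul_zero, zero_add] at h2 h3
  have h4' : e₄ ≤ 4 := by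
    rw [h4]
    have : ∫ x : AddCircle T, (fourier k x).im ^ 4 ∂haarAddCircle ≤ ∫ x : AddCircle T, (1 : ℝ) ∂haarAddCircle := by
      refine integral_mono (((continuous_fourier_im k).pow 4).integrable_of_hasCompactSupport
        (HasCompactSupport.of_compactSpace _)) (integrable_const _) fun x => ?_
      have h1 := abs_fourier_im_le k x
      simp only
      rw [← Even.pow_abs (by decide : Even 4)]
      exact pow_le_one₀ (abs_nonneg _) h1
    simp only [integral_const, probReal_univ, smul_eq_mul, mul_one] at this
    linarith
  -- Along `s (δ_k - δ_{-k})` the energy is at most `2 b_k s² + 4 s⁴`. This is the minimizing `s`,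
  -- with value `-b_k²/4`.
  set s := Real.sqrt (- b k / 4)
  have hs : s ^ 2 = - b k / 4 := Real.sq_sqrt (by linarith)
  obtain ⟨hi, he⟩ := hε s
  obtain ⟨o1, o2⟩ := oddUnit_mem hr hk
  refine ⟨fun n => (0 : ℤ → ℝ) n + s * oddUnit k n,
    ⟨(h.add_mul (isSineSeries_oddUnit k) s).mem_DomJ hi fun n hn => by
      simp [o1 n hn], fun n hn => by simp [o2 n hn]⟩, ?_⟩
  rw [he, h.weightedJ_eq (by simp), h2, h3]
  have e4 : s ^ 4 = (b k) ^ 2 / 16 := by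
    rw [show s ^ 4 = (s ^ 2) ^ 2 by ring, hs]
    ring
  rw [e4, hs]
  simp
  nlinarith [mul_pos_of_neg_of_neg hbk hbk, mul_le_mul_of_nonneg_right h4' (sq_nonneg (b k))]

end Sine

/-! ### Test functions on the cylinder -/

theorem measurable_sign_real : Measurable Real.sign := by
  unfold Real.sign
  exact Measurable.ite measurableSet_Iio measurable_const
    (Measurable.ite measurableSet_Ioi measurable_const measurable_const)

theorem abs_sign_le_one (x : ℝ) : |Real.sign x| ≤ 1 := by
  rcases Real.sign_apply_eq x with h | h | h <;> simp [h]

instance isFiniteMeasure_restrict_Ioc (a b : ℝ) :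
    IsFiniteMeasure ((volume : Measure ℝ).restrict (Ioc a b)) :=
  ⟨by simp⟩

theorem ae_stripMeasure_mem (T : ℝ) : ∀ᵐ p ∂(stripMeasure T), p.2 ∈ Ioc 0 T := by
  have h : ∀ᵐ t ∂(volume.restrict (Ioc 0 T)), t ∈ Ioc 0 T := ae_restrict_mem measurableSet_Ioc
  exact Measure.quasiMeasurePreserving_snd.ae h

theorem halfStripMeasure_eq_restrict (T : ℝ) :
    halfStripMeasure T = (stripMeasure T).restrict (Ioi 0 ×ˢ univ) := by
  rw [halfStripMeasure, stripMeasure, ← Measure.prod_restrict, Measure.restrict_univ]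

theorem memLp_strip_of_continuous {T R : ℝ} {F : ℝ × ℝ → ℝ} (hF : Continuous F)
    (hR : ∀ x t, R < |x| → F (x, t) = 0) (p : ENNReal) : MemLp F p (stripMeasure T) := by
  set K : Set (ℝ × ℝ) := Icc (-R) R ×ˢ Icc 0 T
  have hK : IsCompact K := isCompact_Icc.prod isCompact_Icc
  obtain ⟨C, hC⟩ := hK.exists_bound_of_continuousOn hF.continuousOn
  have hae : F =ᵐ[stripMeasure T] K.indicator F := by
    filter_upwards [ae_stripMeasure_mem T] with q hq
    by_cases hx : q ∈ K
    · rw [indicator_of_mem hx]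
    · rw [indicator_of_notMem hx]
      refine hR q.1 q.2 ?_
      by_contra hlt
      rw [not_lt, abs_le] at hlt
      exact hx ⟨hlt, hq.1.le, hq.2⟩
  rw [memLp_congr_ae hae, memLp_indicator_iff_restrict hK.measurableSet]
  have hfin : stripMeasure T K < ⊤ := by
    rw [stripMeasure, Measure.prod_prod]
    exact ENNReal.mul_lt_top (by simp) (measure_lt_top _ _)
  have : IsFiniteMeasure ((stripMeasure T).restrict K) := ⟨by simpa using hfin⟩
  refine MemLp.of_bound hF.aestronglyMeasurable C ?_
  filter_upwards [ae_restrict_mem hK.measurableSet] with q hq using hC q hq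

theorem integrable_strip_of_continuous {T R : ℝ} {F : ℝ × ℝ → ℝ} (hF : Continuous F)
    (hR : ∀ x t, R < |x| → F (x, t) = 0) : Integrable F (stripMeasure T) :=
  memLp_one_iff_integrable.1 (memLp_strip_of_continuous hF hR 1)

theorem integrable_strip_mul_of_continuous {T R G : ℝ} {F : ℝ × ℝ → ℝ} (hF : Continuous F)
    (hR : ∀ x t, R < |x| → F (x, t) = 0) {h : ℝ → ℝ} (hm : AEStronglyMeasurable h volume)
    (hG : ∀ᵐ x, |h x| ≤ G) : Integrable (fun p => h p.1 * F p) (stripMeasure T) := by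
  refine (integrable_strip_of_continuous hF hR).bdd_mul (c := G) ?_ ?_
  · exact hm.comp_quasiMeasurePreserving Measure.quasiMeasurePreserving_fst
  · exact Measure.quasiMeasurePreserving_fst.ae hG

namespace IsTest

variable {T : ℝ} {ψ : ℝ × ℝ → ℝ}

theorem continuous (h : IsTest T ψ) : Continuous ψ := h.1.continuous

theorem hasDerivAt_fst (h : IsTest T ψ) (x t : ℝ) :
    HasDerivAt (fun x => ψ (x, t)) (fderiv ℝ ψ (x, t) (1, 0)) x := by
  have h1 := (h.1.differentiable (by simp) (x, t)).hasFDerivAt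
  exact h1.comp_hasDerivAt x ((hasDerivAt_id x).prodMk (hasDerivAt_const x t))

theorem hasDerivAt_snd (h : IsTest T ψ) (x t : ℝ) :
    HasDerivAt (fun t => ψ (x, t)) (fderiv ℝ ψ (x, t) (0, 1)) t := by
  have h1 := (h.1.differentiable (by simp) (x, t)).hasFDerivAt
  exact h1.comp_hasDerivAt t ((hasDerivAt_const t x).prodMk (hasDerivAt_id t))

theorem dx_eq (h : IsTest T ψ) : dx ψ = fun p => fderiv ℝ ψ p (1, 0) :=
  funext fun p => (h.hasDerivAt_fst p.1 p.2).deriv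

theorem dt_eq (h : IsTest T ψ) : dt ψ = fun p => fderiv ℝ ψ p (0, 1) :=
  funext fun p => (h.hasDerivAt_snd p.1 p.2).deriv

theorem continuous_dx (h : IsTest T ψ) : Continuous (dx ψ) := by
  rw [h.dx_eq]
  exact (h.1.continuous_fderiv (by simp)).clm_apply continuous_const

theorem continuous_dt (h : IsTest T ψ) : Continuous (dt ψ) := by
  rw [h.dt_eq]
  exact (h.1.continuous_fderiv (by simp)).clm_apply continuous_const

theorem dx_eq_zero {R : ℝ} (hR : ∀ x t, R < |x| → ψ (x, t) = 0) (x t : ℝ) (hx : R < |x|) :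
    dx ψ (x, t) = 0 := by
  have : (fun x => ψ (x, t)) =ᶠ[𝓝 x] fun _ => 0 := by
    filter_upwards [continuous_abs.continuousAt.eventually (lt_mem_nhds hx)] with y hy
      using hR y t hy
  rw [dx, this.deriv_eq]
  simp

theorem dt_eq_zero {R : ℝ} (hR : ∀ x t, R < |x| → ψ (x, t) = 0) (x t : ℝ) (hx : R < |x|) :
    dt ψ (x, t) = 0 := by
  have : (fun t => ψ (x, t)) = fun _ => 0 := funext fun s => hR x s hx
  rw [dt, this]
  simp

theorem contDiff_fst (h : IsTest T ψ) (t : ℝ) : ContDiff ℝ (⊤ : ℕ∞) fun x => ψ (x, t) :=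
  h.1.comp (contDiff_id.prodMk contDiff_const)

theorem contDiff_snd (h : IsTest T ψ) (x : ℝ) : ContDiff ℝ (⊤ : ℕ∞) fun t => ψ (x, t) :=
  h.1.comp (contDiff_const.prodMk contDiff_id)

theorem hasCompactSupport_fst (h : IsTest T ψ) (t : ℝ) :
    HasCompactSupport fun x => ψ (x, t) := by
  obtain ⟨R, hR⟩ := h.2.2
  refine HasCompactSupport.intro (isCompact_Icc (a := -R) (b := R)) fun x hx => hR x t ?_
  by_contra hlt
  rw [not_lt, abs_le] at hlt
  exact hx hlt

theorem periodic_snd (h : IsTest T ψ) (x : ℝ) : Function.Periodic (fun t => ψ (x, t)) T :=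
  fun t => h.2.1 x t

end IsTest

/-! ### Integration by parts in the two variables -/

/-- No periodicity of `φ` is required: the sine vanishes at both endpoints. -/
theorem integral_sin_mul_deriv {ω T : ℝ} (hωT : ω * T = 2 * Real.pi) {φ : ℝ → ℝ}
    (hT : 0 < T) (hφ : ContDiff ℝ 1 φ) (k : ℤ) :
    ∫ t in Ioc 0 T, Real.sin (ω * k * t) * deriv φ t =
      -(ω * k) * ∫ t in Ioc 0 T, Real.cos (ω * k * t) * φ t := by
  have hd : Continuous (deriv φ) := hφ.continuous_deriv le_rfl
  have h := intervalIntegral.integral_mul_deriv_eq_deriv_mul (a := 0) (b := T)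
    (u := fun t => Real.sin (ω * k * t)) (u' := fun t => Real.cos (ω * k * t) * (ω * k * 1))
    (v := φ) (v' := deriv φ)
    (fun t _ => ((hasDerivAt_id t).const_mul (ω * k)).sin)
    (fun t _ => (hφ.differentiable (by simp) t).hasDerivAt)
    ((by fun_prop : Continuous _).intervalIntegrable _ _) (hd.intervalIntegrable _ _)
  rw [intervalIntegral.integral_of_le hT.le, intervalIntegral.integral_of_le hT.le] at h
  have hs : Real.sin (ω * k * T) = 0 := by
    rw [show ω * k * T = (2 * k : ℤ) * Real.pi by push_cast; linear_combination (k : ℝ) * hωT]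
    exact Real.sin_int_mul_pi _
  rw [h, hs, ← integral_const_mul]
  simp only [mul_zero, Real.sin_zero, zero_mul, sub_zero, zero_sub]
  rw [← integral_neg]
  refine integral_congr_ae (ae_of_all _ fun t => ?_)
  simp only
  ring

/-- The cosine equals `1` at both endpoints, so the boundary terms cancel by periodicity of `φ`. -/
theorem integral_cos_mul_deriv {ω T : ℝ} (hωT : ω * T = 2 * Real.pi) {φ : ℝ → ℝ}
    (hT : 0 < T) (hφ : ContDiff ℝ 1 φ) (hper : Function.Periodic φ T) (k : ℤ) :
    ∫ t in Ioc 0 T, Real.cos (ω * k * t) * deriv φ t =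
      (ω * k) * ∫ t in Ioc 0 T, Real.sin (ω * k * t) * φ t := by
  have hd : Continuous (deriv φ) := hφ.continuous_deriv le_rfl
  have h := intervalIntegral.integral_mul_deriv_eq_deriv_mul (a := 0) (b := T)
    (u := fun t => Real.cos (ω * k * t)) (u' := fun t => -Real.sin (ω * k * t) * (ω * k * 1))
    (v := φ) (v' := deriv φ)
    (fun t _ => ((hasDerivAt_id t).const_mul (ω * k)).cos)
    (fun t _ => (hφ.differentiable (by simp) t).hasDerivAt)
    ((by fun_prop : Continuous _).intervalIntegrable _ _) (hd.intervalIntegrable _ _)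
  rw [intervalIntegral.integral_of_le hT.le, intervalIntegral.integral_of_le hT.le] at h
  have hs : Real.cos (ω * k * T) = 1 := by
    rw [show ω * k * T = k * (2 * Real.pi) by linear_combination (k : ℝ) * hωT]
    exact Real.cos_int_mul_two_pi _
  have hp : φ T = φ 0 := by simpa using hper 0
  rw [h, hs, hp, ← integral_const_mul]
  simp only [mul_zero, Real.cos_zero, sub_self, zero_sub]
  rw [← integral_neg]
  refine integral_congr_ae (ae_of_all _ fun t => ?_)
  simp only
  ring

theorem integral_eq_Ioi_add_comp_neg {F : ℝ → ℝ} (hF : Integrable F) :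
    ∫ x, F x = ∫ x in Ioi 0, (F x + F (-x)) := by
  have h := integral_comp_neg_Ioi 0 F
  rw [neg_zero] at h
  rw [integral_add hF.integrableOn hF.comp_neg.integrableOn, h, add_comm]
  exact (intervalIntegral.integral_Iic_add_Ioi hF.integrableOn hF.integrableOn).symm

namespace IsProfile

variable {g : ℝ → ℝ} {ω ρ C : ℝ} {k : ℤ} {Φ Ψ V : ℝ → ℝ}

theorem apply_zero (h : IsProfile g ω ρ C k Φ Ψ V) : Φ 0 = 1 := by
  simp [h.eq_primitive 0]

theorem deriv_zero (h : IsProfile g ω ρ C k Φ Ψ V) : Ψ 0 = PhiDeriv g ω k := by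
  simp [h.deriv_eq_primitive 0]

theorem continuous (h : IsProfile g ω ρ C k Φ Ψ V) : Continuous Φ := by
  rw [funext h.eq_primitive]
  exact continuous_const.add
    (continuous_primitive_of_locallyIntegrable h.continuous_deriv.locallyIntegrable)

theorem integral_Ioi (h : IsProfile g ω ρ C k Φ Ψ V) {χ : ℝ → ℝ} (hχ : ContDiff ℝ 1 χ)
    (hc : HasCompactSupport χ) : ∫ x in Ioi 0, (Ψ x * χ x + Φ x * deriv χ x) = - χ 0 := by
  have := integral_Ioi_deriv_mul_add_mul_primitive h.continuous_deriv.locallyIntegrable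
    h.eq_primitive hχ hc
  rw [h.apply_zero, mul_one] at this
  rw [← this]
  refine integral_congr_ae (ae_of_all _ fun x => ?_)
  simp only
  ring

/-- Folding the line at `0` pairs `Φ` with `χ(x) - χ(-x)`, which vanishes at `0`. The even extension
of `Φ` is continuous there, so its weak derivative has no point mass. -/
theorem integral_even (h : IsProfile g ω ρ C k Φ Ψ V) {χ : ℝ → ℝ} (hχ : ContDiff ℝ 1 χ)
    (hc : HasCompactSupport χ) :
    ∫ x, (Real.sign x * (Ψ |x| * χ x) + Φ |x| * deriv χ x) = 0 := by
  have hd : Continuous (deriv χ) := hχ.continuous_deriv le_rfl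
  have hΨ := h.continuous_deriv
  have hΦ := h.continuous
  have i1 : Integrable fun x => Ψ |x| * χ x :=
    ((hΨ.comp continuous_abs).mul hχ.continuous).integrable_of_hasCompactSupport hc.mul_left
  have i2 : Integrable fun x => Φ |x| * deriv χ x :=
    ((hΦ.comp continuous_abs).mul hd).integrable_of_hasCompactSupport hc.deriv.mul_left
  have i3 : Integrable fun x => Real.sign x * (Ψ |x| * χ x) :=
    i1.bdd_mul measurable_sign_real.aestronglyMeasurable (ae_of_all _ abs_sign_le_one)
  refine (integral_eq_Ioi_add_comp_neg (i3.add i2)).trans ?_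
  have hX : ContDiff ℝ 1 fun x => χ x - χ (-x) := hχ.sub (hχ.comp contDiff_neg)
  have hXc : HasCompactSupport fun x => χ x - χ (-x) :=
    hc.sub (hc.comp_homeomorph (Homeomorph.neg ℝ))
  have := h.integral_Ioi hX hXc
  rw [neg_zero, sub_self, neg_zero] at this
  refine Eq.trans ?_ this
  refine setIntegral_congr_fun measurableSet_Ioi fun x hx => ?_
  have hx0 : 0 < x := hx
  have hder : deriv (fun x => χ x - χ (-x)) x = deriv χ x + deriv χ (-x) := by
    have h1 := (hχ.differentiable (by simp) x).hasDerivAt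
    have h2 := (hχ.differentiable (by simp) (-x)).hasDerivAt.scomp x (hasDerivAt_neg x)
    have := (h1.sub h2).deriv
    rw [show (fun x => χ x - χ (-x)) = χ - χ ∘ Neg.neg from rfl]
    rw [this]
    simp
  simp only [Pi.add_apply, hder, Real.sign_of_pos hx0, Real.sign_of_neg (neg_lt_zero.2 hx0), abs_neg,
    abs_of_pos hx0]
  ring

/-- Folding now pairs `Ψ` with `χ(x) + χ(-x)`, whose value at `0` is `2 χ(0)`. The ODE cancels the
bulk, and the boundary term records the jump `2 Φ_k'(0)` in the derivative of the even extension. -/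
theorem integral_equation (h : IsProfile g ω ρ C k Φ Ψ V) (hg : MemLp g ⊤ (volume : Measure ℝ))
    (heven : ∀ᵐ x, g (-x) = g x) {χ : ℝ → ℝ} (hχ : ContDiff ℝ 1 χ)
    (hc : HasCompactSupport χ) :
    ∫ x, (-((k : ℝ) ^ 2 * ω ^ 2) * (g x * (Φ |x| * χ x)) + Real.sign x * (Ψ |x| * deriv χ x)) =
      -2 * PhiDeriv g ω k * χ 0 := by
  obtain ⟨G, -, hG⟩ := exists_ae_abs_le_of_memLp_top hg
  have hd : Continuous (deriv χ) := hχ.continuous_deriv le_rfl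
  have hΨ := h.continuous_deriv
  have hΦ := h.continuous
  have i1 : Integrable fun x => Φ |x| * χ x :=
    ((hΦ.comp continuous_abs).mul hχ.continuous).integrable_of_hasCompactSupport hc.mul_left
  have i2 : Integrable fun x => Ψ |x| * deriv χ x :=
    ((hΨ.comp continuous_abs).mul hd).integrable_of_hasCompactSupport hc.deriv.mul_left
  have i3 : Integrable fun x => Real.sign x * (Ψ |x| * deriv χ x) :=
    i2.bdd_mul measurable_sign_real.aestronglyMeasurable (ae_of_all _ abs_sign_le_one)
  have i4 : Integrable fun x => g x * (Φ |x| * χ x) := i1.bdd_mul hg.1 hG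
  refine (integral_eq_Ioi_add_comp_neg ((i4.const_mul _).add i3)).trans ?_
  have hX : ContDiff ℝ 1 fun x => χ x + χ (-x) := hχ.add (hχ.comp contDiff_neg)
  have hXc : HasCompactSupport fun x => χ x + χ (-x) :=
    hc.add (hc.comp_homeomorph (Homeomorph.neg ℝ))
  have := integral_Ioi_deriv_mul_add_mul_primitive h.locallyIntegrable
    h.deriv_eq_primitive hX hXc
  rw [neg_zero, h.deriv_zero] at this
  rw [show -2 * PhiDeriv g ω k * χ 0 = -((χ 0 + χ 0) * PhiDeriv g ω k) by ring, ← this]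
  refine setIntegral_congr_ae measurableSet_Ioi ?_
  filter_upwards [h.ode, heven] with x hode he hx
  have hx0 : 0 < x := hx
  have hder : deriv (fun x => χ x + χ (-x)) x = deriv χ x - deriv χ (-x) := by
    have h1 := (hχ.differentiable (by simp) x).hasDerivAt
    have h2 := (hχ.differentiable (by simp) (-x)).hasDerivAt.scomp x (hasDerivAt_neg x)
    have := (h1.add h2).deriv
    rw [show (fun x => χ x + χ (-x)) = χ + χ ∘ Neg.neg from rfl]
    rw [this]
    simp [sub_eq_add_neg]
  simp only [Pi.add_apply, hder, Real.sign_of_pos hx0, Real.sign_of_neg (neg_lt_zero.2 hx0), abs_neg,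
    abs_of_pos hx0, hode hx0, he]
  ring

end IsProfile

/-! ### Identities for the single modes on the cylinder -/

theorem integral_strip {T : ℝ} {F : ℝ × ℝ → ℝ} (hF : Integrable F (stripMeasure T)) :
    ∫ p, F p ∂(stripMeasure T) = ∫ x, ∫ t in Ioc 0 T, F (x, t) := by
  rw [stripMeasure] at hF ⊢
  exact integral_prod F hF

theorem integral_strip_symm {T : ℝ} {F : ℝ × ℝ → ℝ} (hF : Integrable F (stripMeasure T)) :
    ∫ p, F p ∂(stripMeasure T) = ∫ t in Ioc 0 T, ∫ x, F (x, t) := by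
  rw [stripMeasure] at hF ⊢
  exact integral_prod_symm F hF

theorem integral_strip_sin_mul_dt {T ω G : ℝ} (hωT : ω * T = 2 * Real.pi) (hT : 0 < T)
    {ψ : ℝ × ℝ → ℝ} (hψ : IsTest T ψ) (k : ℤ) {h : ℝ → ℝ} (hm : AEStronglyMeasurable h volume)
    (hG : ∀ᵐ x, |h x| ≤ G) :
    ∫ p, h p.1 * (Real.sin (ω * k * p.2) * dt ψ p) ∂(stripMeasure T) =
      -(ω * k) * ∫ p, h p.1 * (Real.cos (ω * k * p.2) * ψ p) ∂(stripMeasure T) := by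
  obtain ⟨R, hR⟩ := hψ.2.2
  have hdt := hψ.continuous_dt
  have hc := hψ.continuous
  have i1 : Integrable (fun p => h p.1 * (Real.sin (ω * k * p.2) * dt ψ p)) (stripMeasure T) :=
    integrable_strip_mul_of_continuous (R := R) (F := fun p => Real.sin (ω * k * p.2) * dt ψ p)
      (by fun_prop) (fun x t hx => by simp [IsTest.dt_eq_zero hR x t hx]) hm hG
  have i2 : Integrable (fun p => h p.1 * (Real.cos (ω * k * p.2) * ψ p)) (stripMeasure T) :=
    integrable_strip_mul_of_continuous (R := R) (F := fun p => Real.cos (ω * k * p.2) * ψ p)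
      (by fun_prop) (fun x t hx => by simp [hR x t hx]) hm hG
  rw [integral_strip i1, integral_strip i2, ← integral_const_mul]
  refine integral_congr_ae (ae_of_all _ fun x => ?_)
  simp only [integral_const_mul]
  have := integral_sin_mul_deriv hωT hT ((hψ.contDiff_snd x).of_le (by simp)) k
  rw [show (∫ t in Ioc 0 T, Real.sin (ω * k * t) * dt ψ (x, t)) =
    -(ω * k) * ∫ t in Ioc 0 T, Real.cos (ω * k * t) * ψ (x, t) from this]
  ring

theorem integral_strip_cos_mul_dt {T ω G : ℝ} (hωT : ω * T = 2 * Real.pi) (hT : 0 < T)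
    {ψ : ℝ × ℝ → ℝ} (hψ : IsTest T ψ) (k : ℤ) {h : ℝ → ℝ} (hm : AEStronglyMeasurable h volume)
    (hG : ∀ᵐ x, |h x| ≤ G) :
    ∫ p, h p.1 * (Real.cos (ω * k * p.2) * dt ψ p) ∂(stripMeasure T) =
      (ω * k) * ∫ p, h p.1 * (Real.sin (ω * k * p.2) * ψ p) ∂(stripMeasure T) := by
  obtain ⟨R, hR⟩ := hψ.2.2
  have hdt := hψ.continuous_dt
  have hc := hψ.continuous
  have i1 : Integrable (fun p => h p.1 * (Real.cos (ω * k * p.2) * dt ψ p)) (stripMeasure T) :=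
    integrable_strip_mul_of_continuous (R := R) (F := fun p => Real.cos (ω * k * p.2) * dt ψ p)
      (by fun_prop) (fun x t hx => by simp [IsTest.dt_eq_zero hR x t hx]) hm hG
  have i2 : Integrable (fun p => h p.1 * (Real.sin (ω * k * p.2) * ψ p)) (stripMeasure T) :=
    integrable_strip_mul_of_continuous (R := R) (F := fun p => Real.sin (ω * k * p.2) * ψ p)
      (by fun_prop) (fun x t hx => by simp [hR x t hx]) hm hG
  rw [integral_strip i1, integral_strip i2, ← integral_const_mul]
  refine integral_congr_ae (ae_of_all _ fun x => ?_)
  simp only [integral_const_mul]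
  have := integral_cos_mul_deriv hωT hT ((hψ.contDiff_snd x).of_le (by simp))
    (hψ.periodic_snd x) k
  rw [show (∫ t in Ioc 0 T, Real.cos (ω * k * t) * dt ψ (x, t)) =
    (ω * k) * ∫ t in Ioc 0 T, Real.sin (ω * k * t) * ψ (x, t) from this]
  ring

namespace IsProfile

variable {g : ℝ → ℝ} {ω ρ C : ℝ} {k : ℤ} {Φ Ψ V : ℝ → ℝ}

theorem integral_strip_dx (h : IsProfile g ω ρ C k Φ Ψ V) {T : ℝ} {ψ : ℝ × ℝ → ℝ}
    (hψ : IsTest T ψ) :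
    ∫ p, Φ |p.1| * (Real.cos (ω * k * p.2) * dx ψ p) ∂(stripMeasure T) =
      - ∫ p, Real.sign p.1 * (Ψ |p.1| * (Real.cos (ω * k * p.2) * ψ p)) ∂(stripMeasure T) := by
  obtain ⟨R, hR⟩ := hψ.2.2
  have hdx := hψ.continuous_dx
  have hc := hψ.continuous
  have hΨ := h.continuous_deriv
  have hΦ := h.continuous
  have i1 : Integrable (fun p => Φ |p.1| * (Real.cos (ω * k * p.2) * dx ψ p)) (stripMeasure T) :=
    integrable_strip_of_continuous (R := R) (by fun_prop)
      (fun x t hx => by simp [IsTest.dx_eq_zero hR x t hx])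
  have i2 : Integrable (fun p => Real.sign p.1 * (Ψ |p.1| * (Real.cos (ω * k * p.2) * ψ p)))
      (stripMeasure T) :=
    integrable_strip_mul_of_continuous (R := R) (F := fun p => Ψ |p.1| * (Real.cos (ω * k * p.2) * ψ p))
      (by fun_prop) (fun x t hx => by simp [hR x t hx]) measurable_sign_real.aestronglyMeasurable
      (ae_of_all _ abs_sign_le_one)
  rw [eq_neg_iff_add_eq_zero, ← integral_add' i1 i2, integral_strip_symm (i1.add i2)]
  refine integral_eq_zero_of_ae (ae_of_all _ fun t => ?_)
  have := h.integral_even ((hψ.contDiff_fst t).of_le (by simp)) (hψ.hasCompactSupport_fst t)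
  have h2 := congrArg (fun s => Real.cos (ω * k * t) * s) this
  simp only [← integral_const_mul, mul_zero] at h2
  simp only [Pi.add_apply, Pi.zero_apply]
  rw [← h2]
  refine integral_congr_ae (ae_of_all _ fun x => ?_)
  simp only [dx]
  ring

theorem integral_halfStrip (h : IsProfile g ω ρ C k Φ Ψ V) {T : ℝ} {ψ : ℝ × ℝ → ℝ}
    (hψ : IsTest T ψ) :
    (∫ p, Real.sign p.1 * (Ψ |p.1| * (Real.cos (ω * k * p.2) * ψ p)) ∂(halfStripMeasure T))
      + ∫ p, Φ |p.1| * (Real.cos (ω * k * p.2) * dx ψ p) ∂(halfStripMeasure T) =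
      - ∫ t in Ioc 0 T, Real.cos (ω * k * t) * ψ (0, t) := by
  obtain ⟨R, hR⟩ := hψ.2.2
  have hdx := hψ.continuous_dx
  have hc := hψ.continuous
  have hΨ := h.continuous_deriv
  have hΦ := h.continuous
  have i1 : Integrable (fun p => Φ |p.1| * (Real.cos (ω * k * p.2) * dx ψ p))
      (halfStripMeasure T) := by
    rw [halfStripMeasure_eq_restrict]
    exact (integrable_strip_of_continuous (R := R) (by fun_prop)
      (fun x t hx => by simp [IsTest.dx_eq_zero hR x t hx])).integrableOn
  have i2 : Integrable (fun p => Real.sign p.1 * (Ψ |p.1| * (Real.cos (ω * k * p.2) * ψ p)))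
      (halfStripMeasure T) := by
    rw [halfStripMeasure_eq_restrict]
    exact (integrable_strip_mul_of_continuous (R := R)
      (F := fun p => Ψ |p.1| * (Real.cos (ω * k * p.2) * ψ p))
      (by fun_prop) (fun x t hx => by simp [hR x t hx]) measurable_sign_real.aestronglyMeasurable
      (ae_of_all _ abs_sign_le_one)).integrableOn
  have i3 := i2.add i1
  rw [← integral_add i2 i1, ← integral_neg]
  rw [halfStripMeasure] at i3 ⊢
  refine (integral_prod_symm _ i3).trans (integral_congr_ae (ae_of_all _ fun t => ?_))
  have := h.integral_Ioi ((hψ.contDiff_fst t).of_le (by simp)) (hψ.hasCompactSupport_fst t)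
  have h2 := congrArg (fun s => Real.cos (ω * k * t) * s) this
  simp only [← integral_const_mul] at h2
  simp only [Pi.add_apply]
  rw [← mul_neg, ← h2]
  refine setIntegral_congr_fun measurableSet_Ioi fun x hx => ?_
  simp only [dx, Real.sign_of_pos hx, abs_of_pos (mem_Ioi.1 hx)]
  ring

theorem integral_strip_equation (h : IsProfile g ω ρ C k Φ Ψ V)
    (hg : MemLp g ⊤ (volume : Measure ℝ)) (heven : ∀ᵐ x, g (-x) = g x) {T : ℝ} {ψ : ℝ × ℝ → ℝ}
    (hψ : IsTest T ψ) :
    -((k : ℝ) ^ 2 * ω ^ 2) *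
        (∫ p, g p.1 * (Φ |p.1| * (Real.cos (ω * k * p.2) * ψ p)) ∂(stripMeasure T))
      + ∫ p, Real.sign p.1 * (Ψ |p.1| * (Real.cos (ω * k * p.2) * dx ψ p)) ∂(stripMeasure T) =
      -2 * PhiDeriv g ω k * ∫ t in Ioc 0 T, Real.cos (ω * k * t) * ψ (0, t) := by
  obtain ⟨G, -, hG⟩ := exists_ae_abs_le_of_memLp_top hg
  obtain ⟨R, hR⟩ := hψ.2.2
  have hdx := hψ.continuous_dx
  have hc := hψ.continuous
  have hΨ := h.continuous_deriv
  have hΦ := h.continuous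
  have i1 : Integrable (fun p => g p.1 * (Φ |p.1| * (Real.cos (ω * k * p.2) * ψ p)))
      (stripMeasure T) :=
    integrable_strip_mul_of_continuous (R := R) (F := fun p => Φ |p.1| * (Real.cos (ω * k * p.2) * ψ p))
      (by fun_prop) (fun x t hx => by simp [hR x t hx]) hg.1 hG
  have i2 : Integrable (fun p => Real.sign p.1 * (Ψ |p.1| * (Real.cos (ω * k * p.2) * dx ψ p)))
      (stripMeasure T) :=
    integrable_strip_mul_of_continuous (R := R) (F := fun p => Ψ |p.1| * (Real.cos (ω * k * p.2) * dx ψ p))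
      (by fun_prop) (fun x t hx => by simp [IsTest.dx_eq_zero hR x t hx])
      measurable_sign_real.aestronglyMeasurable (ae_of_all _ abs_sign_le_one)
  have i1' := i1.const_mul (-((k : ℝ) ^ 2 * ω ^ 2))
  rw [← integral_const_mul, ← integral_add' i1' i2,
    integral_strip_symm (i1'.add i2), ← integral_const_mul]
  refine integral_congr_ae (ae_of_all _ fun t => ?_)
  have := h.integral_equation hg heven ((hψ.contDiff_fst t).of_le (by simp))
    (hψ.hasCompactSupport_fst t)
  have h2 := congrArg (fun s => Real.cos (ω * k * t) * s) this
  simp only [← integral_const_mul] at h2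
  simp only [Pi.add_apply]
  rw [show -2 * PhiDeriv g ω k * (Real.cos (ω * k * t) * ψ (0, t)) =
    Real.cos (ω * k * t) * (-2 * PhiDeriv g ω k * ψ (0, t)) by ring, ← h2]
  refine integral_congr_ae (ae_of_all _ fun x => ?_)
  simp only [dx]
  ring

end IsProfile

/-! ### Orthogonal series on the cylinder -/

theorem integral_Ioc_exp {ω T : ℝ} (hωT : ω * T = 2 * Real.pi) (hω : 0 < ω) (hT : 0 < T) {m : ℤ}
    (hm : m ≠ 0) : ∫ t in Ioc 0 T, Complex.exp (Complex.I * ω * m * t) = 0 := by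
  have hc : Complex.I * (ω : ℂ) * (m : ℂ) ≠ 0 := by
    simp [hm, hω.ne']
  rw [← intervalIntegral.integral_of_le hT.le, integral_exp_mul_complex hc]
  have : Complex.I * (ω : ℂ) * (m : ℂ) * (T : ℂ) = m * (2 * Real.pi * Complex.I) := by
    have := congrArg (fun s : ℝ => (s : ℂ)) hωT
    push_cast at this
    linear_combination (Complex.I * m) * this
  rw [this, Complex.exp_int_mul_two_pi_mul_I]
  simp

/-- Square summable superpositions of the temporal modes converge in `L²` of the cylinder. -/
theorem exists_memLp_strip {ω T : ℝ} (hωT : ω * T = 2 * Real.pi) (hω : 0 < ω) (hT : 0 < T)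
    {c : ℤ → ℝ → ℝ} (hc : ∀ k, MemLp (c k) 2 volume)
    (hs : Summable fun k => ∫ x, c k x ^ 2) :
    ∃ Wc Ws : ℝ × ℝ → ℝ, MemLp Wc 2 (stripMeasure T) ∧ MemLp Ws 2 (stripMeasure T) ∧
      ∀ q : ℝ × ℝ → ℝ, MemLp q 2 (stripMeasure T) →
        HasSum (fun k : ℤ => ∫ p, c k p.1 * (Real.cos (ω * k * p.2) * q p) ∂(stripMeasure T))
          (∫ p, Wc p * q p ∂(stripMeasure T)) ∧
        HasSum (fun k : ℤ => ∫ p, c k p.1 * (Real.sin (ω * k * p.2) * q p) ∂(stripMeasure T))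
          (∫ p, Ws p * q p ∂(stripMeasure T)) := by
  set μ := stripMeasure T
  set E : ℤ → ℝ → ℂ := fun k t => Complex.exp (Complex.I * ω * k * t)
  have hE (k : ℤ) (t : ℝ) : E k t = Real.cos (ω * k * t) + Real.sin (ω * k * t) * Complex.I := by
    simp only [E]
    rw [show Complex.I * ω * k * t = ((ω * k * t : ℝ) : ℂ) * Complex.I by push_cast; ring,
      Complex.exp_mul_I]
    push_cast
    rfl
  have hEn (k : ℤ) (t : ℝ) : ‖E k t‖ = 1 := by
    simp only [E]
    rw [show Complex.I * ω * k * t = ((ω * k * t : ℝ) : ℂ) * Complex.I by push_cast; ring,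
      Complex.norm_exp_ofReal_mul_I]
  have hEc (k : ℤ) : Continuous (E k) := by
    simp only [E]
    fun_prop
  have hc1 (k : ℤ) : MemLp (fun p : ℝ × ℝ => (c k p.1 : ℂ)) 2 μ := by
    have h1 : AEStronglyMeasurable (fun p : ℝ × ℝ => (c k p.1 : ℂ)) μ :=
      (Complex.continuous_ofReal.comp_aestronglyMeasurable (hc k).1).comp_quasiMeasurePreserving
        Measure.quasiMeasurePreserving_fst
    rw [memLp_two_iff_integrable_sq_norm h1]
    have h2 := (hc k).integrable_sq.mul_prod (ν := volume.restrict (Ioc 0 T))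
      (integrable_const (1 : ℝ))
    refine h2.congr (ae_of_all _ fun p => ?_)
    simp
  have hv (k : ℤ) : MemLp (fun p : ℝ × ℝ => (c k p.1 : ℂ) * E k p.2) 2 μ := by
    refine (hc1 k).of_le ((hc1 k).1.mul ((hEc k).comp continuous_snd).aestronglyMeasurable)
      (ae_of_all _ fun p => ?_)
    rw [norm_mul, hEn, mul_one]
  set v : ℤ → Lp ℂ 2 μ := fun k => (hv k).toLp _
  -- Fubini splits the inner product; the temporal factor vanishes for `j ≠ k`, whatever the spatial
  -- profiles are.
  have hinner (j k : ℤ) : inner ℂ (v j) (v k) =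
      (∫ x, ((c j x * c k x : ℝ) : ℂ)) * ∫ t in Ioc 0 T, Complex.exp (Complex.I * ω * (k - j : ℤ) * t) := by
    rw [MeasureTheory.L2.inner_def]
    refine Eq.trans (integral_congr_ae (g := fun p : ℝ × ℝ => ((c j p.1 * c k p.1 : ℝ) : ℂ) *
      Complex.exp (Complex.I * ω * (k - j : ℤ) * p.2)) ?_) (integral_prod_mul
        (fun x => ((c j x * c k x : ℝ) : ℂ))
        (fun t : ℝ => Complex.exp (Complex.I * ω * (k - j : ℤ) * t)))
    filter_upwards [(hv j).coeFn_toLp, (hv k).coeFn_toLp] with p h1 h2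
    rw [h1, h2, RCLike.inner_apply, map_mul, Complex.conj_ofReal]
    have : (starRingEnd ℂ) (E j p.2) = Complex.exp (-(Complex.I * ω * j * p.2)) := by
      simp only [E]
      rw [← Complex.exp_conj]
      congr 1
      simp
    rw [this]
    simp only [E]
    rw [show Complex.I * ω * ((k - j : ℤ) : ℂ) * p.2 =
      Complex.I * ω * k * p.2 + -(Complex.I * ω * j * p.2) by push_cast; ring, Complex.exp_add]
    push_cast
    ring
  have hfam : OrthogonalFamily ℂ (fun k => Submodule.span ℂ {v k})
      fun k => (Submodule.span ℂ {v k}).subtypeₗᵢ := by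
    refine OrthogonalFamily.of_pairwise fun j k hjk => ?_
    simp only [Function.onFun]
    rw [Submodule.isOrtho_span]
    rintro _ rfl _ rfl
    rw [hinner, integral_Ioc_exp hωT hω hT (sub_ne_zero.2 hjk.symm), mul_zero]
  have hnorm (k : ℤ) : ‖v k‖ ^ 2 = T * ∫ x, c k x ^ 2 := by
    have h1 := hinner k k
    rw [inner_self_eq_norm_sq_to_K] at h1
    simp only [sub_self, Int.cast_zero, mul_zero, zero_mul, Complex.exp_zero, integral_const,
      integral_complex_ofReal] at h1
    have h2 := congrArg Complex.re h1
    simp [← sq, hT.le] at h2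
    rw [mul_comm, ← h2]
    norm_cast
  -- For an orthogonal family, summability in Hilbert space only requires summable squared norms.
  have hsum : Summable v := by
    have h1 := (hfam.summable_iff_norm_sq_summable
      (fun k => (⟨v k, Submodule.mem_span_singleton_self _⟩ : Submodule.span ℂ {v k}))).2 (by
        simp only [Submodule.coe_norm, hnorm]
        exact hs.mul_left T)
    exact h1
  set W : Lp ℂ 2 μ := ∑' k, v k
  have key (q : ℝ × ℝ → ℝ) (hq : MemLp q 2 μ) :
      HasSum (fun k : ℤ => ∫ p, ((c k p.1 : ℂ) * E k p.2) * (q p : ℂ) ∂μ)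
        (∫ p, W p * (q p : ℂ) ∂μ) := by
    have hqc : MemLp (fun p => (q p : ℂ)) 2 μ := hq.ofReal
    have h1 := hsum.hasSum.mapL (innerSL ℂ (hqc.toLp _))
    have e (u : Lp ℂ 2 μ) : inner ℂ (hqc.toLp _) u = ∫ p, u p * (q p : ℂ) ∂μ := by
      rw [MeasureTheory.L2.inner_def]
      refine integral_congr_ae ?_
      filter_upwards [hqc.coeFn_toLp] with p hp
      rw [hp, RCLike.inner_apply, Complex.conj_ofReal]
    have e2 (k : ℤ) : ∫ p, v k p * (q p : ℂ) ∂μ =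
        ∫ p, ((c k p.1 : ℂ) * E k p.2) * (q p : ℂ) ∂μ := by
      refine integral_congr_ae ?_
      filter_upwards [(hv k).coeFn_toLp] with p hp
      rw [hp]
    simp only [innerSL_apply_apply, e, e2] at h1
    exact h1
  have hmul {u : ℝ × ℝ → ℂ} (hu : MemLp u 2 μ) {q : ℝ × ℝ → ℝ} (hq : MemLp q 2 μ) :
      (∫ p, u p * (q p : ℂ) ∂μ).re = ∫ p, (u p).re * q p ∂μ ∧
      (∫ p, u p * (q p : ℂ) ∂μ).im = ∫ p, (u p).im * q p ∂μ := by
    have hqc : MemLp (fun p => (q p : ℂ)) 2 μ := hq.ofReal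
    have hi : Integrable (fun p => u p * (q p : ℂ)) μ := hu.integrable_mul hqc
    constructor
    · refine Eq.trans (integral_re (𝕜 := ℂ) hi).symm (integral_congr_ae (ae_of_all _ fun p => ?_))
      simp
    · refine Eq.trans (integral_im (𝕜 := ℂ) hi).symm (integral_congr_ae (ae_of_all _ fun p => ?_))
      simp
  -- Real and imaginary parts of the complex sum carry the cosine and sine series, because the
  -- profiles and the test functions are real.
  refine ⟨fun p => (W p).re, fun p => (W p).im, (Lp.memLp W).re, (Lp.memLp W).im,
    fun q hq => ⟨?_, ?_⟩⟩
  · have := Complex.hasSum_re (key q hq)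
    simp only [(hmul (hv _) hq).1, (hmul (Lp.memLp W) hq).1] at this
    convert this using 3 with k
    funext p
    rw [hE, mul_add, ← mul_assoc]
    simp [-Complex.ofReal_cos, -Complex.ofReal_sin]
  · have := Complex.hasSum_im (key q hq)
    simp only [(hmul (hv _) hq).2, (hmul (Lp.memLp W) hq).2] at this
    convert this using 3 with k
    funext p
    rw [hE, mul_add, ← mul_assoc]
    simp [-Complex.ofReal_cos, -Complex.ofReal_sin]

theorem hasSum_integral_of_abs_le {X : Type*} [MeasurableSpace X] {μ : Measure X} {F : ℤ → X → ℝ}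
    {w q : X → ℝ} {B : ℤ → ℝ} (hF : ∀ k, AEStronglyMeasurable (F k) μ) (hB : Summable B)
    (hFB : ∀ k x, |F k x| ≤ B k) (hw : ∀ x, HasSum (fun k => F k x) (w x)) (hq : Integrable q μ) :
    HasSum (fun k => ∫ x, F k x * q x ∂μ) (∫ x, w x * q x ∂μ) := by
  refine hasSum_integral_of_dominated_convergence (fun k x => B k * |q x|)
    (fun k => (hF k).mul hq.1) (fun k => ae_of_all _ fun x => ?_)
    (ae_of_all _ fun x => hB.mul_right _) ?_ (ae_of_all _ fun x => (hw x).mul_right _)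
  · rw [norm_mul]
    exact mul_le_mul_of_nonneg_right (hFB k x) (abs_nonneg _)
  · simp only [tsum_mul_right]
    exact hq.abs.const_mul _

theorem _root_.HasSum.of_forall_eq {ι M : Type*} [AddCommMonoid M] [TopologicalSpace M] {f g : ι → M}
    {a : M} (h : HasSum f a)
    (e : ∀ k, g k = f k) : HasSum g a := by
  rwa [funext e]


/-! ### Sine series on the line -/

section Transfer

open AddCircle

variable {T : ℝ} [hT : Fact (0 < T)]

theorem fourier_coe_im {T ω : ℝ} (hT : 0 < T) (hωT : ω * T = 2 * Real.pi) (k : ℤ) (t : ℝ) :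
    (fourier k (t : AddCircle T)).im = Real.sin (ω * k * t) := by
  have hω : ω = 2 * Real.pi / T := by rw [← hωT]; field_simp
  rw [fourier_coe_apply, hω, ← Complex.exp_ofReal_mul_I_im]
  congr 2
  push_cast
  ring

theorem setIntegral_Ioc_coe (F : AddCircle T → ℝ) :
    ∫ t in Ioc 0 T, F t = T * ∫ x, F x ∂haarAddCircle := by
  have := AddCircle.integral_preimage T 0 F
  rw [zero_add] at this
  rw [this, integral_haarAddCircle, smul_eq_mul, mul_inv_cancel_left₀ hT.out.ne']

theorem memLp_comp_coe {F : AddCircle T → ℝ} {p : ENNReal} (hF : MemLp F p haarAddCircle) :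
    MemLp (fun t : ℝ => F t) p (volume.restrict (Ioc 0 T)) := by
  have h1 : MemLp F p (volume : Measure (AddCircle T)) := by
    rw [volume_eq_smul_haarAddCircle]
    exact hF.smul_measure ENNReal.ofReal_ne_top
  have h2 := AddCircle.measurePreserving_mk T 0
  rw [zero_add] at h2
  exact h1.comp_measurePreserving h2

theorem IsSineSeries.hasSum_setIntegral {z : ℤ → ℝ} {f : AddCircle T → ℝ} (h : IsSineSeries z f)
    {ω : ℝ} (hωT : ω * T = 2 * Real.pi) {φ : ℝ → ℝ} (hφ : Continuous φ)
    (hper : Function.Periodic φ T) :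
    HasSum (fun k => z k * ∫ t in Ioc 0 T, Real.sin (ω * k * t) * φ t)
      (∫ t in Ioc 0 T, f t * φ t) := by
  have hq : Continuous hper.lift := hφ.quotient_liftOn' _
  have hs := (h.hasSum_mul_integral (q := hper.lift)
    (hq.memLp_of_hasCompactSupport (HasCompactSupport.of_compactSpace _))).mul_left T
  rw [← setIntegral_Ioc_coe] at hs
  simp only [Function.Periodic.lift_coe] at hs
  refine hs.of_forall_eq fun k => ?_
  rw [mul_left_comm, ← setIntegral_Ioc_coe]
  simp only [fourier_coe_im hT.out hωT, Function.Periodic.lift_coe]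

end Transfer

/-! ### The weights -/

theorem weight_neg (g : ℝ → ℝ) (γ ω T : ℝ) (k : ℤ) : weight g γ ω T (-k) = weight g γ ω T k := by
  simp only [weight, PhiDeriv, Phi_neg, Int.cast_neg, neg_sq, odd_neg]

/-- The slopes `Φ_k'(0)` of odd index grow at most linearly. -/
def HasLinearSlopes (g : ℝ → ℝ) (ω C : ℝ) : Prop := ∀ k : ℤ, Odd k → |PhiDeriv g ω k| ≤ C * |(k : ℝ)|

theorem HasLinearSlopes.abs_weight_le {g : ℝ → ℝ} {ω C : ℝ} (h : HasLinearSlopes g ω C)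
    (hC : 0 < C) (γ T : ℝ) (k : ℤ) :
    |weight g γ ω T k| ≤ |T / (γ * ω ^ 4)| * C * |(k : ℝ)|⁻¹ := by
  rw [weight]
  split_ifs with hk
  · have hk0 : (k : ℝ) ≠ 0 := by
      intro h0
      rw [Int.cast_eq_zero.1 h0] at hk
      exact absurd hk (by decide)
    rw [abs_mul, abs_div (PhiDeriv g ω k), mul_assoc, abs_pow]
    refine mul_le_mul_of_nonneg_left ?_ (abs_nonneg _)
    rw [div_le_iff₀ (by positivity)]
    refine (h k hk).trans_eq ?_
    field_simp
  · rw [abs_zero]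
    positivity

theorem HasLinearSlopes.abs_weight_le_const {g : ℝ → ℝ} {ω C : ℝ} (h : HasLinearSlopes g ω C)
    (hC : 0 < C) (γ T : ℝ) (k : ℤ) : |weight g γ ω T k| ≤ |T / (γ * ω ^ 4)| * C := by
  refine (h.abs_weight_le hC γ T k).trans ?_
  refine mul_le_of_le_one_right (by positivity) ?_
  rcases eq_or_ne k 0 with rfl | hk
  · simp
  · refine inv_le_one_of_one_le₀ ?_
    exact_mod_cast Int.one_le_abs hk

/-- Slopes of size `O(k)` divided by `k²` leave `O(1/|k|)`. This is the source of compactness for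
the quadratic part. -/
theorem HasLinearSlopes.tendsto_weight {g : ℝ → ℝ} {ω C : ℝ} (h : HasLinearSlopes g ω C)
    (hC : 0 < C) (γ T : ℝ) : Tendsto (weight g γ ω T) cofinite (𝓝 0) := by
  have h1 : Tendsto (fun k : ℤ => |(k : ℝ)|⁻¹) cofinite (𝓝 0) := by
    refine tendsto_inv_atTop_zero.comp ?_
    exact (tendsto_norm_cocompact_atTop (E := ℝ)).comp Int.tendsto_coe_cofinite
  refine squeeze_zero_norm (h.abs_weight_le hC γ T) ?_
  simpa using h1.const_mul (|T / (γ * ω ^ 4)| * C)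

/-! ### The breather -/

/-- The superposition of the modes with coefficients `α_k / k`. -/
def waveFun (Φ : ℤ → ℝ → ℝ) (ω T : ℝ) (α : ℤ → ℝ) (p : ℝ × ℝ) : ℝ :=
  ∑' k : ℤ, α k / k / Real.sqrt T * (Φ k |p.1| * Real.cos (ω * k * p.2))

theorem integrable_exp_neg_mul_abs {ρ : ℝ} (hρ : 0 < ρ) :
    Integrable fun x : ℝ => Real.exp (-ρ * |x|) := by
  rw [← integrableOn_univ, ← Iic_union_Ioi (a := (0 : ℝ))]
  refine IntegrableOn.union ?_ ?_
  · refine (integrableOn_exp_mul_Iic hρ 0).congr_fun (fun x hx => ?_) measurableSet_Iic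
    simp only [abs_of_nonpos (mem_Iic.1 hx)]
    ring_nf
  · refine (integrableOn_exp_mul_Ioi (neg_lt_zero.2 hρ) 0).congr_fun (fun x hx => ?_)
      measurableSet_Ioi
    simp only [abs_of_pos (mem_Ioi.1 hx)]

theorem memLp_two_of_abs_le_exp {ρ K : ℝ} (hρ : 0 < ρ) {c : ℝ → ℝ}
    (hm : AEStronglyMeasurable c volume) (hc : ∀ x, |c x| ≤ K * Real.exp (-ρ * |x|)) :
    MemLp c 2 volume ∧ ∫ x, c x ^ 2 ≤ K ^ 2 * ∫ x : ℝ, Real.exp (-(2 * ρ) * |x|) := by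
  have hi := (integrable_exp_neg_mul_abs (by positivity : 0 < 2 * ρ)).const_mul (K ^ 2)
  have hb (x : ℝ) : c x ^ 2 ≤ K ^ 2 * Real.exp (-(2 * ρ) * |x|) := by
    rw [← sq_abs, show -(2 * ρ) * |x| = -ρ * |x| + -ρ * |x| by ring, Real.exp_add]
    calc |c x| ^ 2 ≤ (K * Real.exp (-ρ * |x|)) ^ 2 := by
          gcongr
          exact hc x
      _ = _ := by ring
  have hsq : Integrable fun x => c x ^ 2 :=
    hi.mono' (hm.pow 2) (ae_of_all _ fun x => by
      rw [Real.norm_eq_abs, abs_of_nonneg (sq_nonneg _)]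
      exact hb x)
  refine ⟨(memLp_two_iff_integrable_sq hm).2 hsq, ?_⟩
  rw [← integral_const_mul]
  exact integral_mono hsq hi hb

/-- By `|α_k| |k|⁻¹ ≤ α_k² + k⁻²`; it makes the wave series absolutely and uniformly convergent. -/
theorem summable_abs_div_int {α : ℤ → ℝ} (hs : Summable fun k => α k ^ 2) :
    Summable fun k : ℤ => |α k / k| := by
  have h2 : Summable fun k : ℤ => ((k : ℝ) ^ 2)⁻¹ := by
    have := Real.summable_one_div_int_pow.2 (by norm_num : 1 < 2)
    simpa using this
  refine Summable.of_nonneg_of_le (fun k => abs_nonneg _) (fun k => ?_) (hs.add h2)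
  rw [abs_div, div_eq_mul_inv, ← sq_abs (α k), ← sq_abs (k : ℝ), ← inv_pow]
  nlinarith [sq_nonneg (|α k| - |(k : ℝ)|⁻¹), sq_nonneg (|α k|), sq_nonneg (|(k : ℝ)|⁻¹)]

/-- A system of profiles of the decaying solutions, trivial at the even indices. -/
structure IsProfileSystem (g : ℝ → ℝ) (ω ρ C : ℝ) (Φ Ψ V : ℤ → ℝ → ℝ) : Prop where
  pos_rate : 0 < ρ
  pos_const : 0 < C
  profile : ∀ k, Odd k → IsProfile g ω ρ C k (Φ k) (Ψ k) (V k)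
  even_zero : ∀ k, ¬ Odd k → Φ k = 0 ∧ Ψ k = 0

namespace IsProfileSystem

variable {g : ℝ → ℝ} {ω ρ C : ℝ} {Φ Ψ V : ℤ → ℝ → ℝ}

theorem hasLinearSlopes (h : IsProfileSystem g ω ρ C Φ Ψ V) : HasLinearSlopes g ω C := by
  intro k hk
  have := (h.profile k hk).bound_deriv 0 le_rfl
  rw [(h.profile k hk).deriv_zero] at this
  simpa using this

theorem continuous (h : IsProfileSystem g ω ρ C Φ Ψ V) (k : ℤ) : Continuous (Φ k) := by
  by_cases hk : Odd k
  · exact (h.profile k hk).continuous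
  · rw [(h.even_zero k hk).1]
    exact continuous_zero

theorem continuous_deriv (h : IsProfileSystem g ω ρ C Φ Ψ V) (k : ℤ) : Continuous (Ψ k) := by
  by_cases hk : Odd k
  · exact (h.profile k hk).continuous_deriv
  · rw [(h.even_zero k hk).2]
    exact continuous_zero

theorem bound (h : IsProfileSystem g ω ρ C Φ Ψ V) (k : ℤ) (x : ℝ) :
    |Φ k (|x|)| ≤ C * Real.exp (-ρ * |x|) := by
  by_cases hk : Odd k
  · exact (h.profile k hk).bound _ (abs_nonneg _)
  · rw [(h.even_zero k hk).1, Pi.zero_apply, abs_zero]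
    have := h.pos_const
    positivity

theorem bound_deriv (h : IsProfileSystem g ω ρ C Φ Ψ V) (k : ℤ) (x : ℝ) :
    |Ψ k (|x|)| ≤ C * |(k : ℝ)| * Real.exp (-ρ * |x|) := by
  by_cases hk : Odd k
  · exact (h.profile k hk).bound_deriv _ (abs_nonneg _)
  · rw [(h.even_zero k hk).2, Pi.zero_apply, abs_zero]
    have := h.pos_const
    positivity

theorem abs_term_le (h : IsProfileSystem g ω ρ C Φ Ψ V) (T : ℝ) (α : ℤ → ℝ) (k : ℤ)
    (p : ℝ × ℝ) : |α k / k / Real.sqrt T * (Φ k |p.1| * Real.cos (ω * k * p.2))| ≤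
      |α k / k| * (C / Real.sqrt T * Real.exp (-ρ * |p.1|)) := by
  have h1 := h.bound k p.1
  have h2 := Real.abs_cos_le_one (ω * k * p.2)
  have hC := h.pos_const
  rw [abs_mul, abs_mul, abs_div _ (Real.sqrt T), abs_of_nonneg (Real.sqrt_nonneg T)]
  calc |α k / k| / Real.sqrt T * (|Φ k (|p.1|)| * |Real.cos (ω * k * p.2)|)
      ≤ |α k / k| / Real.sqrt T * ((C * Real.exp (-ρ * |p.1|)) * 1) := by gcongr
    _ = _ := by ring

theorem abs_term_le' (h : IsProfileSystem g ω ρ C Φ Ψ V) (T : ℝ) (α : ℤ → ℝ) (k : ℤ)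
    (p : ℝ × ℝ) : |α k / k / Real.sqrt T * (Φ k |p.1| * Real.cos (ω * k * p.2))| ≤
      |α k / k| * (C / Real.sqrt T) := by
  refine (h.abs_term_le T α k p).trans ?_
  have hC := h.pos_const
  have : Real.exp (-ρ * |p.1|) ≤ 1 := by
    rw [Real.exp_le_one_iff]
    nlinarith [h.pos_rate, abs_nonneg p.1]
  refine mul_le_mul_of_nonneg_left (mul_le_of_le_one_right (by positivity) this) (abs_nonneg _)

variable {T : ℝ} {α : ℤ → ℝ}

theorem hasSum_waveFun (h : IsProfileSystem g ω ρ C Φ Ψ V) (hα : Summable fun k => α k ^ 2)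
    (p : ℝ × ℝ) : HasSum (fun k : ℤ => α k / k / Real.sqrt T * (Φ k |p.1| * Real.cos (ω * k * p.2)))
      (waveFun Φ ω T α p) :=
  (Summable.of_norm_bounded ((summable_abs_div_int hα).mul_right _)
    (fun k => h.abs_term_le' T α k p)).hasSum

theorem continuous_waveFun (h : IsProfileSystem g ω ρ C Φ Ψ V) (hα : Summable fun k => α k ^ 2) :
    Continuous (waveFun Φ ω T α) := by
  refine continuous_tsum (fun k => ?_) ((summable_abs_div_int hα).mul_right (C / Real.sqrt T))
    (fun k p => h.abs_term_le' T α k p)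
  have := h.continuous k
  fun_prop

theorem abs_waveFun_le (h : IsProfileSystem g ω ρ C Φ Ψ V) (hα : Summable fun k => α k ^ 2)
    (p : ℝ × ℝ) : |waveFun Φ ω T α p| ≤
      (∑' k : ℤ, |α k / k|) * (C / Real.sqrt T) * Real.exp (-ρ * |p.1|) := by
  have hs := (summable_abs_div_int hα).mul_right (C / Real.sqrt T * Real.exp (-ρ * |p.1|))
  have := tsum_of_norm_bounded
    (f := fun k : ℤ => α k / k / Real.sqrt T * (Φ k |p.1| * Real.cos (ω * k * p.2)))
    hs.hasSum (fun k => h.abs_term_le T α k p)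
  rw [tsum_mul_right, ← mul_assoc] at this
  exact this

theorem memLp_waveFun (h : IsProfileSystem g ω ρ C Φ Ψ V) (hα : Summable fun k => α k ^ 2) :
    MemLp (waveFun Φ ω T α) 2 (stripMeasure T) := by
  set K := (∑' k : ℤ, |α k / k|) * (C / Real.sqrt T)
  have hm := (h.continuous_waveFun (T := T) hα).aestronglyMeasurable (μ := stripMeasure T)
  have h1 : MemLp (fun x : ℝ => K * Real.exp (-ρ * |x|)) 2 volume :=
    (memLp_two_of_abs_le_exp h.pos_rate (K := |K|)
      (by fun_prop : Continuous fun x : ℝ => K * Real.exp (-ρ * |x|)).aestronglyMeasurable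
      fun x => by rw [abs_mul, abs_of_pos (Real.exp_pos _)]).1
  rw [memLp_two_iff_integrable_sq hm]
  have h2 : Integrable (fun p : ℝ × ℝ => (K * Real.exp (-ρ * |p.1|)) ^ 2 * 1) (stripMeasure T) :=
    h1.integrable_sq.mul_prod (integrable_const (1 : ℝ))
  refine h2.mono' (hm.pow 2) (ae_of_all _ fun p => ?_)
  rw [mul_one, norm_pow, Real.norm_eq_abs]
  exact pow_le_pow_left₀ (abs_nonneg _) (h.abs_waveFun_le hα p) 2

theorem timePeriodic_waveFun (hωT : ω * T = 2 * Real.pi) (Φ : ℤ → ℝ → ℝ) (α : ℤ → ℝ) :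
    TimePeriodic T (waveFun Φ ω T α) := by
  intro x t
  refine tsum_congr fun k => ?_
  have : ω * k * (t + T) = ω * k * t + k * (2 * Real.pi) := by linear_combination (k : ℝ) * hωT
  simp only [this, Real.cos_add_int_mul_two_pi]

theorem hasSum_integral_waveFun (h : IsProfileSystem g ω ρ C Φ Ψ V)
    (hα : Summable fun k => α k ^ 2) {μ : Measure (ℝ × ℝ)} {q : ℝ × ℝ → ℝ} (hq : Integrable q μ) :
    HasSum (fun k : ℤ => α k / k / Real.sqrt T *
        ∫ p, Φ k |p.1| * (Real.cos (ω * k * p.2) * q p) ∂μ)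
      (∫ p, waveFun Φ ω T α p * q p ∂μ) := by
  have := hasSum_integral_of_abs_le (μ := μ) (q := q)
    (F := fun (k : ℤ) p => α k / k / Real.sqrt T * (Φ k |p.1| * Real.cos (ω * k * p.2)))
    (w := waveFun Φ ω T α) (B := fun k => |α k / k| * (C / Real.sqrt T))
    (fun k => by
      have := h.continuous k
      exact (by fun_prop : Continuous _).aestronglyMeasurable)
    ((summable_abs_div_int hα).mul_right _) (fun k p => h.abs_term_le' T α k p)
    (fun p => h.hasSum_waveFun hα p) hq
  refine this.of_forall_eq fun k => ?_
  rw [← integral_const_mul]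
  refine integral_congr_ae (ae_of_all _ fun p => ?_)
  simp only
  ring

theorem hasSum_setIntegral_waveFun_zero (h : IsProfileSystem g ω ρ C Φ Ψ V)
    (hα : Summable fun k => α k ^ 2) (hαe : ∀ k, Even k → α k = 0) {μ : Measure ℝ} {q : ℝ → ℝ}
    (hq : Integrable q μ) :
    HasSum (fun k : ℤ => α k / k / Real.sqrt T * ∫ t, Real.cos (ω * k * t) * q t ∂μ)
      (∫ t, waveFun Φ ω T α (0, t) * q t ∂μ) := by
  have := hasSum_integral_of_abs_le (μ := μ) (q := q)
    (F := fun (k : ℤ) t => α k / k / Real.sqrt T * (Φ k |(0 : ℝ)| * Real.cos (ω * k * t)))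
    (w := fun t => waveFun Φ ω T α (0, t)) (B := fun k => |α k / k| * (C / Real.sqrt T))
    (fun k => (by fun_prop : Continuous _).aestronglyMeasurable)
    ((summable_abs_div_int hα).mul_right _) (fun k t => h.abs_term_le' T α k (0, t))
    (fun t => h.hasSum_waveFun hα (0, t)) hq
  refine this.of_forall_eq fun k => ?_
  rw [← integral_const_mul]
  refine integral_congr_ae (ae_of_all _ fun t => ?_)
  by_cases hk : Odd k
  · simp only [abs_zero, (h.profile k hk).apply_zero]
    ring
  · simp [hαe k (Int.not_odd_iff_even.1 hk)]

/-- The time derivative of the breather. -/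
theorem exists_time_series (h : IsProfileSystem g ω ρ C Φ Ψ V) (hω : 0 < ω) (hT : 0 < T)
    (hωT : ω * T = 2 * Real.pi) (hα : Summable fun k => α k ^ 2) :
    ∃ W : ℝ × ℝ → ℝ, MemLp W 2 (stripMeasure T) ∧ ∀ q, MemLp q 2 (stripMeasure T) →
      HasSum (fun k : ℤ => -(ω * α k / Real.sqrt T) *
        ∫ p, Φ k |p.1| * (Real.sin (ω * k * p.2) * q p) ∂(stripMeasure T))
        (∫ p, W p * q p ∂(stripMeasure T)) := by
  -- Differentiation in time cancels the factor `1/k`, and the coefficients are merely square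
  -- summable. Hence convergence is taken in `L²`, by orthogonality of the temporal modes.
  have hc (k : ℤ) := memLp_two_of_abs_le_exp h.pos_rate
    (c := fun x => -(ω * α k / Real.sqrt T) * Φ k |x|) (K := |ω * α k / Real.sqrt T| * C)
    (by
      have := h.continuous k
      exact (by fun_prop : Continuous _).aestronglyMeasurable)
    (fun x => by
      rw [abs_mul, abs_neg, mul_assoc]
      exact mul_le_mul_of_nonneg_left (h.bound k x) (abs_nonneg _))
  obtain ⟨_, W, -, hW, hs⟩ := exists_memLp_strip hωT hω hT (fun k => (hc k).1) (by
    refine Summable.of_nonneg_of_le (fun k => integral_nonneg fun x => sq_nonneg _)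
      (fun k => (hc k).2) ?_
    refine ((hα.mul_left ((ω / Real.sqrt T * C) ^ 2)).mul_right
      (∫ x : ℝ, Real.exp (-(2 * ρ) * |x|))).congr fun k => ?_
    rw [mul_pow |ω * α k / Real.sqrt T|, sq_abs]
    ring)
  refine ⟨W, hW, fun q hq => ?_⟩
  refine ((hs q hq).2).of_forall_eq fun k => ?_
  rw [← integral_const_mul]
  simp only [mul_assoc]

/-- The space derivative of the breather. -/
theorem exists_space_series (h : IsProfileSystem g ω ρ C Φ Ψ V) (hω : 0 < ω) (hT : 0 < T)
    (hωT : ω * T = 2 * Real.pi) (hα : Summable fun k => α k ^ 2) :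
    ∃ W : ℝ × ℝ → ℝ, MemLp W 2 (stripMeasure T) ∧ ∀ q, MemLp q 2 (stripMeasure T) →
      HasSum (fun k : ℤ => α k / k / Real.sqrt T *
        ∫ p, Real.sign p.1 * (Ψ k |p.1| * (Real.cos (ω * k * p.2) * q p)) ∂(stripMeasure T))
        (∫ p, W p * q p ∂(stripMeasure T)) := by
  have hC := h.pos_const
  have hc (k : ℤ) := memLp_two_of_abs_le_exp h.pos_rate
    (c := fun x => α k / k / Real.sqrt T * (Real.sign x * Ψ k |x|)) (K := |α k| * (C / Real.sqrt T))
    (by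
      have h1 := h.continuous_deriv k
      have h2 : Continuous fun x => Ψ k |x| := by fun_prop
      exact (measurable_sign_real.mul h2.measurable).const_mul _ |>.aestronglyMeasurable)
    (fun x => by
      have h1 := h.bound_deriv k x
      have h2 := abs_sign_le_one x
      rw [abs_mul, abs_mul, abs_div, abs_div, abs_of_nonneg (Real.sqrt_nonneg T)]
      -- The growth `O(k)` of `Ψ_k` is compensated by `1/k`; the bound `|k|/|k| ≤ 1` also covers `k
      -- = 0`.
      calc |α k| / |(k : ℝ)| / Real.sqrt T * (|Real.sign x| * |Ψ k (|x|)|)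
          ≤ |α k| / |(k : ℝ)| / Real.sqrt T * (1 * (C * |(k : ℝ)| * Real.exp (-ρ * |x|))) := by
            gcongr
        _ = |α k| * (C / Real.sqrt T) * Real.exp (-ρ * |x|) * (|(k : ℝ)| / |(k : ℝ)|) := by ring
        _ ≤ |α k| * (C / Real.sqrt T) * Real.exp (-ρ * |x|) * 1 := by
            gcongr
            exact div_self_le_one _
        _ = _ := mul_one _)
  obtain ⟨W, _, hW, -, hs⟩ := exists_memLp_strip hωT hω hT (fun k => (hc k).1) (by
    refine Summable.of_nonneg_of_le (fun k => integral_nonneg fun x => sq_nonneg _)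
      (fun k => (hc k).2) ?_
    refine ((hα.mul_left ((C / Real.sqrt T) ^ 2)).mul_right
      (∫ x : ℝ, Real.exp (-(2 * ρ) * |x|))).congr fun k => ?_
    rw [mul_pow |α k|, sq_abs]
    ring)
  refine ⟨W, hW, fun q hq => ?_⟩
  refine ((hs q hq).1).of_forall_eq fun k => ?_
  rw [← integral_const_mul]
  simp only [mul_assoc]

end IsProfileSystem

/-! ### The breather is a weak solution -/

theorem setIntegral_indicator_mul {T : ℝ} (F ψ : ℝ × ℝ → ℝ) :
    ∫ p, F p * (Ioi (0 : ℝ) ×ˢ (univ : Set ℝ)).indicator ψ p ∂(stripMeasure T) =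
      ∫ p, F p * ψ p ∂(halfStripMeasure T) := by
  have hm : MeasurableSet (Ioi (0 : ℝ) ×ˢ (univ : Set ℝ)) := measurableSet_Ioi.prod .univ
  rw [halfStripMeasure_eq_restrict, ← integral_indicator hm]
  refine integral_congr_ae (ae_of_all _ fun p => ?_)
  by_cases hp : p ∈ Ioi (0 : ℝ) ×ˢ (univ : Set ℝ)
  · simp only [indicator_of_mem hp]
  · simp only [indicator_of_notMem hp, mul_zero]

theorem memLp_three_of_integrable_abs_pow {X : Type*} [MeasurableSpace X] {μ : Measure X}
    {u : X → ℝ} (hu : AEStronglyMeasurable u μ) (h : Integrable (fun x => u x ^ 3) μ) :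
    MemLp u 3 μ := by
  rw [← integrable_norm_rpow_iff hu (by norm_num) (by norm_num)]
  refine h.norm.congr (ae_of_all _ fun x => ?_)
  simp [norm_pow]

namespace IsProfileSystem

variable {g : ℝ → ℝ} {ω ρ C γ T : ℝ} {Φ Ψ V : ℤ → ℝ → ℝ} {α : ℤ → ℝ}

theorem isWeakDx_waveFun (h : IsProfileSystem g ω ρ C Φ Ψ V) (hα : Summable fun k => α k ^ 2)
    {W : ℝ × ℝ → ℝ} (hW : ∀ q, MemLp q 2 (stripMeasure T) →
      HasSum (fun k : ℤ => α k / k / Real.sqrt T *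
        ∫ p, Real.sign p.1 * (Ψ k |p.1| * (Real.cos (ω * k * p.2) * q p)) ∂(stripMeasure T))
        (∫ p, W p * q p ∂(stripMeasure T))) : IsWeakDx T (waveFun Φ ω T α) W := by
  intro ψ hψ
  obtain ⟨R, hR⟩ := hψ.2.2
  have s1 := h.hasSum_integral_waveFun (T := T) hα
    (integrable_strip_of_continuous (T := T) hψ.continuous_dx (IsTest.dx_eq_zero hR))
  have s2 := (hW ψ (memLp_strip_of_continuous hψ.continuous hR 2)).neg
  refine s1.unique (s2.of_forall_eq fun k => ?_)
  by_cases hk : Odd k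
  · rw [(h.profile k hk).integral_strip_dx hψ]
    ring
  · simp [(h.even_zero k hk).1, (h.even_zero k hk).2]

theorem isWeakDt_waveFun (h : IsProfileSystem g ω ρ C Φ Ψ V) (hT : 0 < T)
    (hωT : ω * T = 2 * Real.pi) (hα : Summable fun k => α k ^ 2) (hαe : ∀ k, Even k → α k = 0)
    {W : ℝ × ℝ → ℝ} (hW : ∀ q, MemLp q 2 (stripMeasure T) →
      HasSum (fun k : ℤ => -(ω * α k / Real.sqrt T) *
        ∫ p, Φ k |p.1| * (Real.sin (ω * k * p.2) * q p) ∂(stripMeasure T))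
        (∫ p, W p * q p ∂(stripMeasure T))) : IsWeakDt T (waveFun Φ ω T α) W := by
  intro ψ hψ
  obtain ⟨R, hR⟩ := hψ.2.2
  have s1 := h.hasSum_integral_waveFun (T := T) hα
    (integrable_strip_of_continuous (T := T) hψ.continuous_dt (IsTest.dt_eq_zero hR))
  have s2 := (hW ψ (memLp_strip_of_continuous hψ.continuous hR 2)).neg
  refine s1.unique (s2.of_forall_eq fun k => ?_)
  by_cases hk : Odd k
  · have hk0 : (k : ℝ) ≠ 0 := by
      intro h0
      rw [Int.cast_eq_zero.1 h0] at hk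
      exact absurd hk (by decide)
    have hc := h.continuous k
    rw [integral_strip_cos_mul_dt (G := C) hωT hT hψ k (h := fun x => Φ k |x|)
      (by fun_prop : Continuous fun x => Φ k |x|).aestronglyMeasurable]
    · field_simp
    · refine ae_of_all _ fun x => (h.bound k x).trans ?_
      refine mul_le_of_le_one_right h.pos_const.le ?_
      rw [Real.exp_le_one_iff]
      nlinarith [h.pos_rate, abs_nonneg x]
  · simp [hαe k (Int.not_odd_iff_even.1 hk)]

theorem isTraceAtZero_waveFun (h : IsProfileSystem g ω ρ C Φ Ψ V)
    (hα : Summable fun k => α k ^ 2) (hαe : ∀ k, Even k → α k = 0)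
    {W : ℝ × ℝ → ℝ} (hWL : MemLp W 2 (stripMeasure T)) (hW : ∀ q, MemLp q 2 (stripMeasure T) →
      HasSum (fun k : ℤ => α k / k / Real.sqrt T *
        ∫ p, Real.sign p.1 * (Ψ k |p.1| * (Real.cos (ω * k * p.2) * q p)) ∂(stripMeasure T))
        (∫ p, W p * q p ∂(stripMeasure T))) :
    IsTraceAtZero T (waveFun Φ ω T α) W fun t => waveFun Φ ω T α (0, t) := by
  have hw := h.continuous_waveFun (T := T) hα
  refine ⟨?_, fun ψ hψ => ?_⟩
  · refine MemLp.of_bound (Continuous.aestronglyMeasurable (by fun_prop))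
      ((∑' k : ℤ, |α k / k|) * (C / Real.sqrt T) * Real.exp (-ρ * |(0 : ℝ)|))
      (ae_of_all _ fun t => ?_)
    rw [Real.norm_eq_abs]
    exact h.abs_waveFun_le hα (0, t)
  obtain ⟨R, hR⟩ := hψ.2.2
  have hm : MeasurableSet (Ioi (0 : ℝ) ×ˢ (univ : Set ℝ)) := measurableSet_Ioi.prod .univ
  have hψ2 := memLp_strip_of_continuous (T := T) hψ.continuous hR 2
  have i1 : Integrable (dx ψ) (stripMeasure T) :=
    integrable_strip_of_continuous (T := T) hψ.continuous_dx (IsTest.dx_eq_zero hR)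
  have i2 : Integrable (dx ψ) (halfStripMeasure T) := by
    rw [halfStripMeasure_eq_restrict]
    exact i1.restrict
  -- The series for `∂_x w` may be tested with any `L²` function, in particular with `ψ` cut off to
  -- the half cylinder. Green's formula then reduces to the single modes, where `Φ_k(0) = 1`.
  have s1 := hW _ (hψ2.indicator hm)
  rw [setIntegral_indicator_mul] at s1
  have s2 := h.hasSum_integral_waveFun (T := T) hα i2
  have iφ : Integrable (fun t => ψ (0, t)) (volume.restrict (Ioc 0 T)) := by
    have := hψ.continuous
    exact (Continuous.integrableOn_Icc (by fun_prop)).mono_set Ioc_subset_Icc_self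
  have s3 := (h.hasSum_setIntegral_waveFun_zero (T := T) hα hαe iφ).neg
  rw [integral_add]
  · refine (s1.add s2).unique (s3.of_forall_eq fun k => ?_)
    by_cases hk : Odd k
    · have e := (h.profile k hk).integral_halfStrip (T := T) hψ
      have e2 := setIntegral_indicator_mul (T := T)
        (fun p => Real.sign p.1 * (Ψ k |p.1| * Real.cos (ω * k * p.2))) ψ
      simp only [mul_assoc] at e e2 ⊢
      rw [e2, ← mul_add, e]
      ring
    · simp [hαe k (Int.not_odd_iff_even.1 hk)]
  · rw [halfStripMeasure_eq_restrict]
    exact (hWL.integrable_mul hψ2).restrict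
  · rw [halfStripMeasure_eq_restrict] at i2 ⊢
    refine i2.bdd_mul (c := (∑' k : ℤ, |α k / k|) * (C / Real.sqrt T)) hw.aestronglyMeasurable
      (ae_of_all _ fun p => ?_)
    have hC := h.pos_const
    refine (h.abs_waveFun_le hα p).trans (mul_le_of_le_one_right ?_ ?_)
    · exact mul_nonneg (tsum_nonneg fun k => abs_nonneg _) (by positivity)
    · rw [Real.exp_le_one_iff]
      nlinarith [h.pos_rate, abs_nonneg p.1]

variable [hT : Fact (0 < T)]

theorem isWeakDerivCircle_waveFun (h : IsProfileSystem g ω ρ C Φ Ψ V)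
    (hωT : ω * T = 2 * Real.pi) (hα : Summable fun k => α k ^ 2) (hαe : ∀ k, Even k → α k = 0)
    {f : AddCircle T → ℝ} (hf : IsSineSeries α f) :
    IsWeakDerivCircle T (fun t => waveFun Φ ω T α (0, t))
      (fun t => -(ω / Real.sqrt T) * f t) := by
  intro φ hφ hper
  have hd : Continuous (deriv φ) := hφ.continuous_deriv (by simp)
  have s1 := h.hasSum_setIntegral_waveFun_zero (T := T) hα hαe
    ((hd.integrableOn_Icc (a := 0) (b := T) (μ := volume)).mono_set Ioc_subset_Icc_self)
  have s2 := ((hf.hasSum_setIntegral hωT hφ.continuous hper).mul_left (ω / Real.sqrt T))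
  have e : -∫ t in Ioc 0 T, -(ω / Real.sqrt T) * f t * φ t =
      ω / Real.sqrt T * ∫ t in Ioc 0 T, f t * φ t := by
    rw [← integral_neg, ← integral_const_mul]
    refine integral_congr_ae (ae_of_all _ fun t => ?_)
    simp only
    ring
  rw [e]
  refine s1.unique (s2.of_forall_eq fun k => ?_)
  by_cases hk : Odd k
  · have hk0 : (k : ℝ) ≠ 0 := by
      intro h0
      rw [Int.cast_eq_zero.1 h0] at hk
      exact absurd hk (by decide)
    rw [integral_cos_mul_deriv hωT hT.out (hφ.of_le (by simp)) hper]
    field_simp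
  · simp [hαe k (Int.not_odd_iff_even.1 hk)]

/-- Both sides are sums over `k`. In each mode the ODE cancels the bulk terms, leaving `-2 Φ_k'(0)`
times the trace of the test function, and the weights are normalized so that the `k`-th coefficient
of `f³` produces the same number. -/
theorem weak_equation (h : IsProfileSystem g ω ρ C Φ Ψ V) (hg : MemLp g ⊤ (volume : Measure ℝ))
    (heven : ∀ᵐ x, g (-x) = g x) (hγ : γ ≠ 0) (hω : 0 < ω)
    (hωT : ω * T = 2 * Real.pi) (hαe : ∀ k, Even k → α k = 0)
    {f : AddCircle T → ℝ}
    (hf3 : IsSineSeries (fun k => -2 * weight g γ ω T k * α k) (fun x => f x ^ 3))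
    {Wx Wt : ℝ × ℝ → ℝ} (hxL : MemLp Wx 2 (stripMeasure T)) (htL : MemLp Wt 2 (stripMeasure T))
    (hx : ∀ q, MemLp q 2 (stripMeasure T) →
      HasSum (fun k : ℤ => α k / k / Real.sqrt T *
        ∫ p, Real.sign p.1 * (Ψ k |p.1| * (Real.cos (ω * k * p.2) * q p)) ∂(stripMeasure T))
        (∫ p, Wx p * q p ∂(stripMeasure T)))
    (ht : ∀ q, MemLp q 2 (stripMeasure T) →
      HasSum (fun k : ℤ => -(ω * α k / Real.sqrt T) *
        ∫ p, Φ k |p.1| * (Real.sin (ω * k * p.2) * q p) ∂(stripMeasure T))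
        (∫ p, Wt p * q p ∂(stripMeasure T))) {ψ : ℝ × ℝ → ℝ} (hψ : IsTest T ψ) :
    ∫ p, (- g p.1 * Wt p * dt ψ p + Wx p * dx ψ p) ∂(stripMeasure T)
      - γ * ∫ t in Ioc 0 T, (-(ω / Real.sqrt T) * f t) ^ 3 * dt ψ (0, t) = 0 := by
  obtain ⟨G, hG0, hG⟩ := exists_ae_abs_le_of_memLp_top hg
  obtain ⟨R, hR⟩ := hψ.2.2
  have hT0 := hT.out
  have hdx := memLp_strip_of_continuous (T := T) hψ.continuous_dx (IsTest.dx_eq_zero hR) 2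
  have hdt := memLp_strip_of_continuous (T := T) hψ.continuous_dt (IsTest.dt_eq_zero hR) 2
  -- Boundedness of `g` lets it be moved onto the test function, so that the series for `∂_t w` can
  -- be paired with it.
  have hgd : MemLp (fun p : ℝ × ℝ => -g p.1 * dt ψ p) 2 (stripMeasure T) := by
    refine MemLp.of_le_mul (c := G) hdt ?_ ?_
    · exact (hg.1.comp_quasiMeasurePreserving Measure.quasiMeasurePreserving_fst).neg.mul hdt.1
    · filter_upwards [Measure.quasiMeasurePreserving_fst.ae hG] with p hp
      rw [norm_mul, norm_neg]
      exact mul_le_mul_of_nonneg_right hp (norm_nonneg _)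
  have s1 := (ht _ hgd).add (hx _ hdx)
  have hcont0 : Continuous fun t => dt ψ (0, t) := by
    have := hψ.continuous_dt
    fun_prop
  have hper : Function.Periodic (fun t => dt ψ (0, t)) T := by
    have e : (fun t => dt ψ (0, t)) = deriv fun t => ψ (0, t) := rfl
    rw [e]
    intro t
    rw [← deriv_comp_add_const]
    congr 1
    exact funext fun s => hψ.2.1 0 s
  have s2 := (hf3.hasSum_setIntegral hωT hcont0 hper).mul_left (-(γ * (ω / Real.sqrt T) ^ 3))
  have e1 : ∫ p, (- g p.1 * Wt p * dt ψ p + Wx p * dx ψ p) ∂(stripMeasure T) =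
      (∫ p, Wt p * (-g p.1 * dt ψ p) ∂(stripMeasure T)) + ∫ p, Wx p * dx ψ p ∂(stripMeasure T) := by
    have i1 : Integrable (fun p => Wt p * (-g p.1 * dt ψ p)) (stripMeasure T) :=
      htL.integrable_mul hgd
    have i2 : Integrable (fun p => Wx p * dx ψ p) (stripMeasure T) := hxL.integrable_mul hdx
    rw [← integral_add i1 i2]
    refine integral_congr_ae (ae_of_all _ fun p => ?_)
    simp only
    ring
  have e2 : γ * ∫ t in Ioc 0 T, (-(ω / Real.sqrt T) * f t) ^ 3 * dt ψ (0, t) =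
      -(γ * (ω / Real.sqrt T) ^ 3) * ∫ t in Ioc 0 T, f t ^ 3 * dt ψ (0, t) := by
    rw [← integral_const_mul, ← integral_const_mul]
    refine integral_congr_ae (ae_of_all _ fun p => ?_)
    simp only
    ring
  rw [e1, e2, sub_eq_zero]
  refine s1.unique (s2.of_forall_eq fun k => ?_)
  by_cases hk : Odd k
  · have hk0 : (k : ℝ) ≠ 0 := by
      intro h0
      rw [Int.cast_eq_zero.1 h0] at hk
      exact absurd hk (by decide)
    have e := (h.profile k hk).integral_strip_equation hg heven (T := T) hψ
    have hc := h.continuous k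
    have e3 : ∫ p, Φ k |p.1| * (Real.sin (ω * k * p.2) * (-g p.1 * dt ψ p)) ∂(stripMeasure T) =
        ω * k * ∫ p, g p.1 * (Φ k |p.1| * (Real.cos (ω * k * p.2) * ψ p)) ∂(stripMeasure T) := by
      have := integral_strip_sin_mul_dt (G := G * C) hωT hT0 hψ k (h := fun x => g x * Φ k |x|)
        (hg.1.mul (by fun_prop : Continuous fun x => Φ k |x|).aestronglyMeasurable) (by
          filter_upwards [hG] with x hx
          rw [abs_mul]
          refine mul_le_mul hx ((h.bound k x).trans ?_) (abs_nonneg _) hG0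
          refine mul_le_of_le_one_right h.pos_const.le ?_
          rw [Real.exp_le_one_iff]
          nlinarith [h.pos_rate, abs_nonneg x])
      simp only [mul_assoc (g _)] at this
      rw [← neg_inj, ← neg_mul, ← this, ← integral_neg]
      refine integral_congr_ae (ae_of_all _ fun p => ?_)
      simp only
      ring
    have e4 : ∫ t in Ioc 0 T, Real.sin (ω * k * t) * dt ψ (0, t) =
        -(ω * k) * ∫ t in Ioc 0 T, Real.cos (ω * k * t) * ψ (0, t) :=
      integral_sin_mul_deriv hωT hT0 ((hψ.contDiff_snd 0).of_le (by simp)) k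
    rw [e3, e4, weight, if_pos hk]
    have hs : Real.sqrt T ≠ 0 := (Real.sqrt_pos.2 hT0).ne'
    have hsq : T = Real.sqrt T ^ 2 := (Real.sq_sqrt hT0.le).symm
    have e5 : T / (γ * ω ^ 4) * (PhiDeriv g ω k / (k : ℝ) ^ 2) =
      Real.sqrt T ^ 2 / (γ * ω ^ 4) * (PhiDeriv g ω k / (k : ℝ) ^ 2) := by rw [← hsq]
    rw [e5]
    generalize (∫ p, g p.1 * (Φ k |p.1| * (Real.cos (ω * k * p.2) * ψ p)) ∂(stripMeasure T)) = A
      at e ⊢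
    generalize (∫ p, Real.sign p.1 * (Ψ k |p.1| * (Real.cos (ω * k * p.2) * dx ψ p))
      ∂(stripMeasure T)) = B at e ⊢
    generalize (∫ t in Ioc 0 T, Real.cos (ω * k * t) * ψ (0, t)) = D at e ⊢
    -- Inserting the profile identity eliminates `A` as well: its two contributions `∓ ω² k α_k A /
    -- √T` cancel.
    rw [show B = -2 * PhiDeriv g ω k * D + (k : ℝ) ^ 2 * ω ^ 2 * A by linear_combination e]
    field_simp
    ring
  · simp [hαe k (Int.not_odd_iff_even.1 hk)]

/-- If the cube of the sine series `f` of `α` has the coefficients prescribed by the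
Euler-Lagrange equation, then the wave generated by `α` is a weak solution. -/
theorem isWeakSolution_waveFun (h : IsProfileSystem g ω ρ C Φ Ψ V) (h0 : C0 g γ) (hω : 0 < ω)
    (hωT : ω * T = 2 * Real.pi) (hα : Summable fun k => α k ^ 2) (hαe : ∀ k, Even k → α k = 0)
    {f : AddCircle T → ℝ} (hf : IsSineSeries α f)
    (hf3 : IsSineSeries (fun k => -2 * weight g γ ω T k * α k) (fun x => f x ^ 3)) :
    IsWeakSolution g γ T (waveFun Φ ω T α) := by
  obtain ⟨Wx, hxL, hx⟩ := h.exists_space_series hω hT.out hωT hα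
  obtain ⟨Wt, htL, ht⟩ := h.exists_time_series hω hT.out hωT hα
  refine ⟨timePeriodic_waveFun hωT Φ α, h.memLp_waveFun hα, Wx, Wt, hxL, htL,
    h.isWeakDx_waveFun hα hx, h.isWeakDt_waveFun hT.out hωT hα hαe ht, _, _,
    h.isTraceAtZero_waveFun hα hαe hxL hx, ?_, h.isWeakDerivCircle_waveFun hωT hα hαe hf,
    fun ψ hψ => h.weak_equation h0.1 h0.2.1 h0.2.2.2 hω hωT hαe hf3 hxL htL hx ht hψ⟩
  refine MemLp.const_mul ?_ _
  exact memLp_three_of_integrable_abs_pow (memLp_comp_coe hf.memLp).1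
    ((memLp_comp_coe hf3.memLp).integrable (by norm_num))

end IsProfileSystem

/-! ### Translations in time -/

theorem _root_.MeasureTheory.MeasurePreserving.integral_comp_eq {X Y : Type*} [MeasurableSpace X]
    [MeasurableSpace Y] {μ : Measure X} {ν : Measure Y} {θ : X → Y} (h : MeasurePreserving θ μ ν)
    {F : Y → ℝ} (hF : AEStronglyMeasurable F ν) : ∫ x, F (θ x) ∂μ = ∫ y, F y ∂ν := by
  rw [← h.map_eq] at hF ⊢
  exact (integral_map h.aemeasurable hF).symm

theorem IsTest.dt_periodic {T : ℝ} {ψ : ℝ × ℝ → ℝ} (h : IsTest T ψ) (x : ℝ) :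
    Function.Periodic (fun t => dt ψ (x, t)) T := by
  have e : (fun t => dt ψ (x, t)) = deriv fun t => ψ (x, t) := rfl
  rw [e]
  intro t
  rw [← deriv_comp_add_const]
  congr 1
  exact funext fun s => h.2.1 x s

theorem IsTest.shift {T : ℝ} {ψ : ℝ × ℝ → ℝ} (h : IsTest T ψ) (τ : ℝ) :
    IsTest T (fun p => ψ (p.1, p.2 - τ)) := by
  refine ⟨h.1.comp (_root_.contDiff_fst.prodMk (_root_.contDiff_snd.sub contDiff_const)),
    fun x t => ?_, ?_⟩
  · simp only
    rw [show t + T - τ = t - τ + T by ring]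
    exact h.2.1 x _
  · obtain ⟨R, hR⟩ := h.2.2
    exact ⟨R, fun x t hx => hR x _ hx⟩

section Shift

variable {T : ℝ} [hT : Fact (0 < T)]

/-- The translation by `τ` on the circle, in the coordinate `t ∈ (0, T]`. -/
def circleShift (T : ℝ) [hT : Fact (0 < T)] (τ t : ℝ) : ℝ :=
  (AddCircle.equivIoc T 0 ((t : AddCircle T) + (τ : AddCircle T)) : ℝ)

theorem exists_circleShift_eq (τ t : ℝ) : ∃ n : ℤ, circleShift T τ t = t + τ + n * T := by
  have h : ((circleShift T τ t - (t + τ) : ℝ) : AddCircle T) = 0 := by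
    rw [circleShift, AddCircle.coe_sub, AddCircle.coe_equivIoc, AddCircle.coe_add, sub_self]
  obtain ⟨n, hn⟩ := (AddCircle.coe_eq_zero_iff T).1 h
  refine ⟨n, ?_⟩
  rw [zsmul_eq_mul] at hn
  linear_combination -hn

/-- Translation invariance of the measure on the circle, read in the coordinate `t ∈ (0, T]`. -/
theorem measurePreserving_circleShift (τ : ℝ) :
    MeasurePreserving (circleShift T τ) (volume.restrict (Ioc 0 T)) (volume.restrict (Ioc 0 T)) := by
  have h1 := AddCircle.measurePreserving_mk T 0
  have h2 := measurePreserving_add_right (volume : Measure (AddCircle T)) (τ : AddCircle T)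
  have h3 := AddCircle.measurePreserving_equivIoc (T := T) (a := 0)
  have h4 := measurePreserving_subtype_coe (μa := (volume : Measure ℝ))
    (measurableSet_Ioc (a := (0 : ℝ)) (b := 0 + T))
  have h5 : MeasurePreserving (circleShift T τ) (volume.restrict (Ioc 0 (0 + T)))
    (volume.restrict (Ioc 0 (0 + T))) := h4.comp (h3.comp (h2.comp h1))
  rwa [zero_add] at h5

theorem measurePreserving_stripShift (τ : ℝ) :
    MeasurePreserving (Prod.map id (circleShift T τ)) (stripMeasure T) (stripMeasure T) :=
  (MeasurePreserving.id _).prod (measurePreserving_circleShift τ)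

theorem measurePreserving_halfStripShift (τ : ℝ) :
    MeasurePreserving (Prod.map id (circleShift T τ)) (halfStripMeasure T) (halfStripMeasure T) :=
  (MeasurePreserving.id _).prod (measurePreserving_circleShift τ)

theorem periodic_circleShift {φ : ℝ → ℝ} (h : Function.Periodic φ T) (τ t : ℝ) :
    φ (circleShift T τ t) = φ (t + τ) := by
  obtain ⟨n, hn⟩ := exists_circleShift_eq (T := T) τ t
  rw [hn, h.int_mul n]

theorem IsTest.shift_apply {ψ : ℝ × ℝ → ℝ} (h : IsTest T ψ) (τ x t : ℝ) :
    ψ (x, circleShift T τ t - τ) = ψ (x, t) := by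
  obtain ⟨n, hn⟩ := exists_circleShift_eq (T := T) τ t
  rw [hn, show t + τ + n * T - τ = t + n * T by ring]
  exact (h.periodic_snd x).int_mul n t

theorem IsTest.dx_shift {ψ : ℝ × ℝ → ℝ} (h : IsTest T ψ) (τ x t : ℝ) :
    dx (fun p => ψ (p.1, p.2 - τ)) (x, circleShift T τ t) = dx ψ (x, t) := by
  simp only [dx, h.shift_apply]

theorem IsTest.dt_shift {ψ : ℝ × ℝ → ℝ} (h : IsTest T ψ) (τ x t : ℝ) :
    dt (fun p => ψ (p.1, p.2 - τ)) (x, circleShift T τ t) = dt ψ (x, t) := by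
  obtain ⟨n, hn⟩ := exists_circleShift_eq (T := T) τ t
  have e : dt (fun p => ψ (p.1, p.2 - τ)) (x, circleShift T τ t) =
      dt ψ (x, circleShift T τ t - τ) := by
    simp only [dt]
    exact deriv_comp_sub_const (f := fun s => ψ (x, s)) τ _
  rw [e, hn, show t + τ + n * T - τ = t + n * T by ring]
  exact (h.dt_periodic x).int_mul n t

/-- The translates in time of weak solutions are weak solutions. -/
theorem IsWeakSolution.shift {g : ℝ → ℝ} {γ : ℝ} {w : ℝ × ℝ → ℝ} (h : IsWeakSolution g γ T w)
    (hg : AEStronglyMeasurable g volume) (τ : ℝ) :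
    IsWeakSolution g γ T fun p => w (p.1, p.2 + τ) := by
  obtain ⟨hper, hw, wx, wt, hx, ht, hwx, hwt, v, u, ⟨hv, htr⟩, hu, huv, heq⟩ := h
  set Θ := Prod.map (id : ℝ → ℝ) (circleShift T τ)
  have hΘ : MeasurePreserving Θ (stripMeasure T) (stripMeasure T) := measurePreserving_stripShift τ
  have hΘ' : MeasurePreserving Θ (halfStripMeasure T) (halfStripMeasure T) :=
    measurePreserving_halfStripShift τ
  have hθ := measurePreserving_circleShift (T := T) τ
  have hhalf {F : ℝ × ℝ → ℝ} (hF : AEStronglyMeasurable F (stripMeasure T)) :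
      AEStronglyMeasurable F (halfStripMeasure T) := by
    rw [halfStripMeasure_eq_restrict]
    exact hF.restrict
  have hwΘ : (fun p => w (p.1, p.2 + τ)) = w ∘ Θ := funext fun p =>
    (periodic_circleShift (φ := fun t => w (p.1, t)) (fun t => hper p.1 t) τ p.2).symm
  rw [hwΘ]
  refine ⟨fun x t => ?_, hw.comp_measurePreserving hΘ, wx ∘ Θ, wt ∘ Θ,
    hx.comp_measurePreserving hΘ, ht.comp_measurePreserving hΘ, fun ψ hψ => ?_, fun ψ hψ => ?_,
    v ∘ circleShift T τ, u ∘ circleShift T τ, ⟨hv.comp_measurePreserving hθ, fun ψ hψ => ?_⟩,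
    hu.comp_measurePreserving hθ, fun φ hφ hφp => ?_, fun ψ hψ => ?_⟩
  · rw [← hwΘ]
    simp only
    rw [show t + T + τ = t + τ + T by ring]
    exact hper x _
  · have hs := hψ.shift τ
    -- Testing the translate against `ψ` amounts to testing the original against `ψ` translated
    -- back; the change of variables is the measure preserving circle shift. The remaining
    -- conditions follow the same pattern.
    have e := hwx _ hs
    rw [← hΘ.integral_comp_eq (F := fun p => w p * dx (fun p => ψ (p.1, p.2 - τ)) p)
        (hw.1.mul hs.continuous_dx.aestronglyMeasurable),
      ← hΘ.integral_comp_eq (F := fun p => wx p * ψ (p.1, p.2 - τ))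
        (hx.1.mul hs.continuous.aestronglyMeasurable)] at e
    simp only [Θ, Prod.map, id, hψ.dx_shift, hψ.shift_apply] at e
    exact e
  · have hs := hψ.shift τ
    have e := hwt _ hs
    rw [← hΘ.integral_comp_eq (F := fun p => w p * dt (fun p => ψ (p.1, p.2 - τ)) p)
        (hw.1.mul hs.continuous_dt.aestronglyMeasurable),
      ← hΘ.integral_comp_eq (F := fun p => wt p * ψ (p.1, p.2 - τ))
        (ht.1.mul hs.continuous.aestronglyMeasurable)] at e
    simp only [Θ, Prod.map, id, hψ.dt_shift, hψ.shift_apply] at e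
    exact e
  · have hs := hψ.shift τ
    have e := htr _ hs
    have hc : Continuous fun t => ψ (0, t - τ) := by
      have := hψ.continuous
      fun_prop
    rw [← hΘ'.integral_comp_eq
        (F := fun p => wx p * ψ (p.1, p.2 - τ) + w p * dx (fun p => ψ (p.1, p.2 - τ)) p)
        (((hhalf hx.1).mul hs.continuous.aestronglyMeasurable).add
        ((hhalf hw.1).mul hs.continuous_dx.aestronglyMeasurable)),
      ← hθ.integral_comp_eq (F := fun t => v t * ψ (0, t - τ)) (hv.1.mul hc.aestronglyMeasurable)] at e
    simp only [Θ, Prod.map, id, hψ.dx_shift, hψ.shift_apply] at e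
    exact e
  · have e := huv (fun s => φ (s - τ)) (hφ.comp (contDiff_id.sub contDiff_const)) fun t => by
      simp only
      rw [show t + T - τ = t - τ + T by ring]
      exact hφp _
    have hc : Continuous fun t => φ (t - τ) := by
      have := hφ.continuous
      fun_prop
    have hd : deriv (fun s => φ (s - τ)) = fun s => deriv φ (s - τ) :=
      funext fun s => deriv_comp_sub_const φ τ s
    have hdc : Continuous fun t => deriv φ (t - τ) := by
      have := hφ.continuous_deriv (by simp)
      fun_prop
    have hdp : Function.Periodic (deriv φ) T := fun t => by
      rw [← deriv_comp_add_const]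
      exact congrArg (deriv · t) (funext fun s => hφp s)
    have e1 (χ : ℝ → ℝ) (hχ : Function.Periodic χ T) (t : ℝ) : χ (circleShift T τ t - τ) = χ t := by
      obtain ⟨n, hn⟩ := exists_circleShift_eq (T := T) τ t
      rw [hn, show t + τ + n * T - τ = t + n * T by ring]
      exact hχ.int_mul n t
    rw [hd, ← hθ.integral_comp_eq (F := fun t => v t * deriv φ (t - τ)) (hv.1.mul hdc.aestronglyMeasurable),
      ← hθ.integral_comp_eq (F := fun t => u t * φ (t - τ)) (hu.1.mul hc.aestronglyMeasurable)] at e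
    simp only [e1 _ hφp, e1 _ hdp] at e
    exact e
  · have hs := hψ.shift τ
    have e := heq _ hs
    have hc : Continuous fun t => dt (fun p => ψ (p.1, p.2 - τ)) (0, t) := by
      have := hs.continuous_dt
      fun_prop
    have hgm : AEStronglyMeasurable (fun p : ℝ × ℝ => g p.1) (stripMeasure T) :=
      hg.comp_quasiMeasurePreserving Measure.quasiMeasurePreserving_fst
    rw [← hΘ.integral_comp_eq (F := fun p => -g p.1 * wt p * dt (fun p => ψ (p.1, p.2 - τ)) p +
        wx p * dx (fun p => ψ (p.1, p.2 - τ)) p)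
        (((hgm.neg.mul ht.1).mul hs.continuous_dt.aestronglyMeasurable).add
          (hx.1.mul hs.continuous_dx.aestronglyMeasurable)),
      ← hθ.integral_comp_eq (F := fun t => u t ^ 3 * dt (fun p => ψ (p.1, p.2 - τ)) (0, t))
        ((hu.1.pow 3).mul hc.aestronglyMeasurable)] at e
    simp only [Θ, Prod.map, id, hψ.dx_shift, hψ.dt_shift] at e
    exact e

end Shift

/-! ### Distinct waves -/

/-- Continuous functions on `ℝ × 𝕋_T` which agree almost everywhere agree. -/
theorem eq_of_ae_eq_strip {T : ℝ} (hT : 0 < T) {w w' : ℝ × ℝ → ℝ} (hw : Continuous w)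
    (hw' : Continuous w') (hp : TimePeriodic T w) (hp' : TimePeriodic T w')
    (h : w =ᵐ[stripMeasure T] w') : w = w' := by
  have e : stripMeasure T = (volume : Measure (ℝ × ℝ)).restrict (univ ×ˢ Ioc 0 T) := by
    rw [stripMeasure, Measure.volume_eq_prod, ← Measure.prod_restrict, Measure.restrict_univ]
  rw [e] at h
  -- The strip lies in the closure of its interior, so almost everywhere equality of continuous
  -- functions holds everywhere on it; periodicity covers the other times.
  have h1 : EqOn w w' (univ ×ˢ Ioc 0 T) := by
    refine Measure.eqOn_of_ae_eq h hw.continuousOn hw'.continuousOn ?_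
    rw [interior_prod_eq, closure_prod_eq, interior_univ, closure_univ, interior_Ioc,
      closure_Ioo hT.ne]
    exact prod_mono le_rfl Ioc_subset_Icc_self
  have : Fact (0 < T) := ⟨hT⟩
  funext ⟨x, t⟩
  have h2 : circleShift T 0 t ∈ Ioc 0 T := by
    have : circleShift T 0 t ∈ Ioc 0 (0 + T) := (AddCircle.equivIoc T 0 _).2
    rwa [zero_add] at this
  have h3 := h1 (show (x, circleShift T 0 t) ∈ univ ×ˢ Ioc 0 T from ⟨mem_univ _, h2⟩)
  have h4 := periodic_circleShift (T := T) (φ := fun t => w (x, t)) (fun t => hp x t) 0 t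
  have h5 := periodic_circleShift (T := T) (φ := fun t => w' (x, t)) (fun t => hp' x t) 0 t
  simp only [add_zero] at h4 h5
  rw [← h4, ← h5, h3]

theorem isNontrivial_shift {T : ℝ} (hT : 0 < T) {w : ℝ × ℝ → ℝ} (hw : Continuous w)
    (hp : TimePeriodic T w) (h0 : IsNontrivial T w) (τ : ℝ) :
    IsNontrivial T fun p => w (p.1, p.2 + τ) := by
  intro h
  have e := eq_of_ae_eq_strip (w' := 0) hT (by fun_prop) continuous_zero (fun x t => by
    simp only
    rw [show t + T + τ = t + τ + T by ring]
    exact hp x _) (fun _ _ => rfl) h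
  refine h0 (ae_of_all _ fun p => ?_)
  simpa using congrFun e (p.1, p.2 - τ)

/-- The dyadic translates of an antiperiodic wave are pairwise distinct. -/
theorem pairwiseDistinct_shift {T τ : ℝ} (hT : 0 < T) {w : ℝ × ℝ → ℝ} (hw : Continuous w)
    (hp : TimePeriodic T w) (ha : TimeAntiperiodic τ w) (h0 : IsNontrivial T w) :
    PairwiseDistinct T fun n p => w (p.1, p.2 + τ / 2 ^ n) := by
  have key {m n : ℕ} (hmn : m < n) : ¬ (fun p : ℝ × ℝ => w (p.1, p.2 + τ / 2 ^ m))
      =ᵐ[stripMeasure T] fun p => w (p.1, p.2 + τ / 2 ^ n) := by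
    intro h
    have hc (s : ℝ) : Continuous fun p : ℝ × ℝ => w (p.1, p.2 + s) := by fun_prop
    have hpp (s : ℝ) : TimePeriodic T fun p : ℝ × ℝ => w (p.1, p.2 + s) := fun x t => by
      simp only
      rw [show t + T + s = t + s + T by ring]
      exact hp x _
    have e := eq_of_ae_eq_strip hT (hc _) (hc _) (hpp _) (hpp _) h
    refine h0 (ae_of_all _ fun p => ?_)
    obtain ⟨x, t⟩ := p
    have h1 : Function.Periodic (fun t => w (x, t)) (τ / 2 ^ m - τ / 2 ^ n) := fun s => by
      have := congrFun e (x, s - τ / 2 ^ n)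
      simp only at this ⊢
      rw [sub_add_cancel] at this
      rw [← this]
      congr 2
      ring
    have h2 := h1.nat_mul (2 ^ n) t
    have h3 : Function.Antiperiodic (fun t => w (x, t)) τ := fun s => ha x s
    obtain ⟨d, rfl⟩ := Nat.exists_eq_add_of_lt hmn
    -- If two translates agree, `w` has period `τ/2^m - τ/2^n`. Its multiple by `2^n` is `(2^(n-m) -
    -- 1) τ`, an odd multiple of the antiperiod, so `w = -w`.
    have h4 : ((2 ^ (m + d + 1) : ℕ) : ℝ) * (τ / 2 ^ m - τ / 2 ^ (m + d + 1)) =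
        (((2 ^ d - 1 : ℤ)) : ℝ) * (2 * τ) + τ := by
      push_cast
      rw [pow_succ, pow_add]
      field_simp
      ring
    rw [h4, ← add_assoc] at h2
    have h5 := h3 (t + ((2 ^ d - 1 : ℤ) : ℝ) * (2 * τ))
    have h6 := h3.periodic_two_mul.int_mul (2 ^ d - 1) t
    simp only [Pi.zero_apply] at *
    linarith
  intro m n hmn
  rcases lt_or_gt_of_ne hmn with h | h
  · exact key h
  · exact fun he => key h he.symm

/-! ### Symmetry, representation and uniqueness of the coefficients -/

theorem timeAntiperiodic_waveFun {ω T : ℝ} (hωT : ω * T = 2 * Real.pi) (Φ : ℤ → ℝ → ℝ) {r : ℕ}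
    (hr : 0 < r) {α : ℤ → ℝ} (hα : α ∈ symDom r) :
    TimeAntiperiodic (T / (2 * r)) (waveFun Φ ω T α) := by
  intro x t
  simp only [waveFun]
  rw [← tsum_neg]
  refine tsum_congr fun k => ?_
  by_cases hk : k ≡ r [ZMOD (2 * (r : ℤ))]
  · obtain ⟨n, hn⟩ := hk.symm.dvd
    have hr0 : (r : ℝ) ≠ 0 := by positivity
    have hk' : (k : ℝ) = r + 2 * r * n := by
      have : k = r + 2 * r * n := by linarith
      exact_mod_cast this
    -- An admissible `k` is an odd multiple of `r`, so the shift by `T/(2r)` changes the phase by an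
    -- odd multiple of `π`.
    have e : ω * k * (t + T / (2 * r)) = ω * k * t + n * (2 * Real.pi) + Real.pi := by
      have : ω * k * (T / (2 * r)) = (ω * T) * (1 + 2 * n) / 2 := by
        rw [hk']
        field_simp
      rw [mul_add, this, hωT]
      ring
    rw [e, Real.cos_add_pi, Real.cos_add_int_mul_two_pi]
    ring
  · simp [hα.2 k hk]

theorem IsSineSeries.integral_mul_fourier_im {T : ℝ} [hT : Fact (0 < T)] {z : ℤ → ℝ}
    {f : AddCircle T → ℝ} (h : IsSineSeries z f) (k : ℤ) :
    ∫ x, f x * (fourier k x).im ∂AddCircle.haarAddCircle = z k := by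
  have h1 := congrArg Complex.im (h.coeff k)
  have hi : Integrable (fun x => fourier (-k) x • (f x : ℂ)) AddCircle.haarAddCircle := by
    simp only [smul_eq_mul]
    refine Integrable.bdd_mul (c := 1) (h.memLp.integrable (by norm_num)).ofReal
      (fourier (-k)).continuous.aestronglyMeasurable (ae_of_all _ fun x => ?_)
    rw [fourier_apply, Circle.norm_coe]
  rw [fourierCoeff, ← Complex.imCLM_apply, ← Complex.imCLM.integral_comp_comm hi] at h1
  have h2 : (-Complex.I * (z k : ℂ)).im = -z k := by simp
  rw [h2] at h1
  rw [← neg_inj, ← h1, ← integral_neg]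
  refine integral_congr_ae (ae_of_all _ fun x => ?_)
  simp [mul_comm]

namespace IsProfileSystem

variable {g : ℝ → ℝ} {ω ρ C T : ℝ} {Φ Ψ V : ℤ → ℝ → ℝ} {α β : ℤ → ℝ}

theorem neg_apply_abs (h : IsProfileSystem g ω ρ C Φ Ψ V) (k : ℤ) (x : ℝ) :
    Φ (-k) |x| = Φ k |x| := by
  by_cases hk : Odd k
  · rw [← (h.profile k hk).eq_Phi _ (abs_nonneg x),
      ← (h.profile (-k) hk.neg).eq_Phi _ (abs_nonneg x), Phi_neg]
  · rw [(h.even_zero k hk).1, (h.even_zero (-k) (by rwa [odd_neg])).1]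

theorem isGeneratedBy_waveFun (h : IsProfileSystem g ω ρ C Φ Ψ V) (hα : α ∈ DomJ) :
    IsGeneratedBy g ω T α (waveFun Φ ω T α) := by
  intro x t
  have hs := summable_sq_of_mem_DomJ hα
  set c : ℤ → ℝ := fun k => α k / k * Φ k |x| / Real.sqrt T
  have hc (k : ℤ) : c (-k) = c k := by
    simp only [c, h.neg_apply_abs, hα.2.1, Int.cast_neg, neg_div_neg_eq]
  have h1 : HasSum (fun k : ℤ => c k * Real.cos (ω * k * t)) (waveFun Φ ω T α (x, t)) :=
    (h.hasSum_waveFun hs (x, t)).of_forall_eq fun k => by simp only [c]; ring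
  have h2 : Summable fun k : ℤ => c k * Real.sin (ω * k * t) := by
    refine Summable.of_norm_bounded ((summable_abs_div_int hs).mul_right (C / Real.sqrt T))
      fun k => ?_
    have := h.abs_term_le' T α k (x, 0)
    simp only [mul_zero, Real.cos_zero, mul_one] at this
    rw [Real.norm_eq_abs, abs_mul]
    refine (mul_le_of_le_one_right (abs_nonneg _) (Real.abs_sin_le_one _)).trans
      (le_of_eq_of_le ?_ this)
    simp only [c]
    congr 1
    ring
  -- The coefficients `α_k / k` are even in `k`, so the sine parts cancel in pairs and the
  -- exponential series equals the real cosine series.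
  have h3 : ∑' k : ℤ, c k * Real.sin (ω * k * t) = 0 := by
    have e := (Equiv.neg ℤ).tsum_eq fun k : ℤ => c k * Real.sin (ω * k * t)
    have e2 (k : ℤ) : c ((Equiv.neg ℤ) k) * Real.sin (ω * ((Equiv.neg ℤ) k : ℤ) * t) =
        -(c k * Real.sin (ω * k * t)) := by
      rw [Equiv.neg_apply, hc, Int.cast_neg, show ω * -(k : ℝ) * t = -(ω * k * t) by ring,
        Real.sin_neg]
      ring
    simp only [e2, tsum_neg] at e
    linarith
  have h4 : HasSum (fun k : ℤ => (c k : ℂ) * Complex.exp (Complex.I * ω * k * t))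
      (waveFun Φ ω T α (x, t) : ℂ) := by
    have e (k : ℤ) : (c k : ℂ) * Complex.exp (Complex.I * ω * k * t) =
        ((c k * Real.cos (ω * k * t) : ℝ) : ℂ) + ((c k * Real.sin (ω * k * t) : ℝ) : ℂ) * Complex.I
        := by
      rw [show Complex.I * ω * k * t = ((ω * k * t : ℝ) : ℂ) * Complex.I by push_cast; ring,
        Complex.exp_mul_I, ← Complex.ofReal_cos, ← Complex.ofReal_sin]
      push_cast
      ring
    have h5 := h2.hasSum
    rw [h3] at h5
    have := (Complex.hasSum_ofReal.2 h1).add ((Complex.hasSum_ofReal.2 h5).mul_right Complex.I)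
    rw [funext e]
    simpa using this
  have h6 := (hasSum_subtype_iff_of_support_subset (s := {k : ℤ | Odd k}) (by
    intro k hk
    by_contra hko
    refine hk ?_
    simp [c, hα.1 k (Int.not_odd_iff_even.1 hko)])).2 h4
  refine h6.of_forall_eq fun k => ?_
  rw [(h.profile k k.2).eq_Phi _ (abs_nonneg x)]
  rfl

theorem waveFun_sub (h : IsProfileSystem g ω ρ C Φ Ψ V) (hα : Summable fun k => α k ^ 2)
    (hβ : Summable fun k => β k ^ 2) (hs : Summable fun k => (α - β) k ^ 2) (p : ℝ × ℝ) :
    waveFun Φ ω T (α - β) p = waveFun Φ ω T α p - waveFun Φ ω T β p :=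
  (h.hasSum_waveFun hs p).unique (((h.hasSum_waveFun hα p).sub
    (h.hasSum_waveFun hβ p)).of_forall_eq fun k => by rw [Pi.sub_apply]; ring)

variable [hT : Fact (0 < T)]

/-- The trace at `x = 0` determines the coefficients: its weak derivative is `-(ω/√T) f`, and
testing with `sin(ωkt)` recovers `α_k`. -/
theorem eq_zero_of_waveFun_eq_zero (h : IsProfileSystem g ω ρ C Φ Ψ V) (hω : 0 < ω)
    (hωT : ω * T = 2 * Real.pi) (hα : Summable fun k => α k ^ 2) (hαe : ∀ k, Even k → α k = 0)
    (hαn : ∀ k, α (-k) = -α k) (h0 : ∀ t, waveFun Φ ω T α (0, t) = 0) : α = 0 := by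
  obtain ⟨f, hf⟩ := exists_isSineSeries (T := T) hαn hα
  funext k
  have h1 := h.isWeakDerivCircle_waveFun hωT hα hαe hf (fun t => Real.sin (ω * k * t))
    (by fun_prop) (fun t => by
      have : ω * k * (t + T) = ω * k * t + k * (2 * Real.pi) := by
        linear_combination (k : ℝ) * hωT
      simp only [this, Real.sin_add_int_mul_two_pi])
  simp only [h0, zero_mul, integral_zero] at h1
  have h2 := setIntegral_Ioc_coe fun x : AddCircle T => f x * (fourier k x).im
  rw [hf.integral_mul_fourier_im] at h2
  simp only [fourier_coe_im hT.out hωT] at h2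
  simp only [mul_assoc (-(ω / Real.sqrt T)), integral_const_mul, h2] at h1
  have hT0 := hT.out
  have hs := Real.sqrt_pos.2 hT0
  have h3 : ω / Real.sqrt T * (T * α k) = 0 := by linarith
  simpa [hω.ne', hs.ne', hT0.ne'] using h3

theorem eq_of_waveFun_ae_eq (h : IsProfileSystem g ω ρ C Φ Ψ V) (hω : 0 < ω)
    (hωT : ω * T = 2 * Real.pi) (hα : α ∈ DomJ) (hβ : β ∈ DomJ)
    (he : waveFun Φ ω T α =ᵐ[stripMeasure T] waveFun Φ ω T β) : α = β := by
  have sα := summable_sq_of_mem_DomJ hα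
  have sβ := summable_sq_of_mem_DomJ hβ
  have e := eq_of_ae_eq_strip hT.out (h.continuous_waveFun sα) (h.continuous_waveFun sβ)
    (timePeriodic_waveFun hωT Φ α) (timePeriodic_waveFun hωT Φ β) he
  have hs : Summable fun k => (α - β) k ^ 2 := by
    refine Summable.of_nonneg_of_le (fun k => sq_nonneg _) (fun k => ?_)
      ((sα.mul_left 2).add (sβ.mul_left 2))
    rw [Pi.sub_apply]
    nlinarith [sq_nonneg (α k + β k)]
  have := h.eq_zero_of_waveFun_eq_zero (α := α - β) hω hωT hs
    (fun k hk => by rw [Pi.sub_apply, hα.1 k hk, hβ.1 k hk, sub_zero])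
    (fun k => by simp only [Pi.sub_apply, hα.2.1, hβ.2.1]; ring)
    (fun t => by rw [h.waveFun_sub sα sβ hs, e, sub_self])
  exact sub_eq_zero.1 this

theorem isNontrivial_waveFun (h : IsProfileSystem g ω ρ C Φ Ψ V) (hω : 0 < ω)
    (hωT : ω * T = 2 * Real.pi) (hα : α ∈ DomJ) (h0 : α ≠ 0) :
    IsNontrivial T (waveFun Φ ω T α) := by
  intro he
  have sα := summable_sq_of_mem_DomJ hα
  have e := eq_of_ae_eq_strip hT.out (h.continuous_waveFun sα) continuous_zero
    (timePeriodic_waveFun hωT Φ α) (fun _ _ => rfl) he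
  exact h0 (h.eq_zero_of_waveFun_eq_zero hω hωT sα hα.1 hα.2.1 fun t => by rw [e, Pi.zero_apply])

end IsProfileSystem

/-! ### Minimizers -/

theorem J_zero (g : ℝ → ℝ) (γ ω T : ℝ) : J g γ ω T 0 = 0 := by
  simp [J, conv]

theorem exists_isMinimizer {g : ℝ → ℝ} {ω C : ℝ} (h : HasLinearSlopes g ω C) (hC : 0 < C)
    (γ T : ℝ) [Fact (0 < T)] (r : ℕ) : ∃ α, IsMinimizer g γ ω T r α := by
  obtain ⟨α, hα, hmin⟩ := exists_weightedJ_minimizer T (h.abs_weight_le_const hC γ T)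
    (h.tendsto_weight hC γ T) r
  refine ⟨α, hα, fun z hz => ?_⟩
  rw [J_eq_weightedJ g γ ω T hα.1, J_eq_weightedJ g γ ω T hz.1]
  exact hmin z hz

/-- An odd multiple `m l^j` is congruent to `l^j` modulo `2 l^j`, so the mode that makes `j` good is
available in the symmetric class; the sign conditions say that its weight is negative. -/
theorem GoodIndex.exists_weight_neg {g : ℝ → ℝ} {γ ω T : ℝ} (hω : 0 < ω) (hT : 0 < T) {l j : ℕ}
    (hl : Odd l) (h : GoodIndex g γ ω l j) :
    ∃ k : ℤ, k ≡ (l ^ j : ℕ) [ZMOD (2 * ((l ^ j : ℕ) : ℤ))] ∧ k ≠ 0 ∧ weight g γ ω T k < 0 := by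
  obtain ⟨m, hm, hs⟩ := h
  have hr : Odd (m * l ^ j) := hm.mul (hl.pow)
  have hk0 : ((m * l ^ j : ℕ) : ℤ) ≠ 0 := by exact_mod_cast hr.pos.ne'
  refine ⟨(m * l ^ j : ℕ), ?_, hk0, ?_⟩
  · obtain ⟨n, rfl⟩ := hm
    refine (Int.modEq_iff_dvd.2 ⟨-n, ?_⟩)
    push_cast
    ring
  · have hk : (0 : ℝ) < (((m * l ^ j : ℕ) : ℤ) : ℝ) ^ 2 := by
      have : (((m * l ^ j : ℕ) : ℤ) : ℝ) ≠ 0 := by exact_mod_cast hk0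
      positivity
    rw [weight, if_pos (by exact_mod_cast hr)]
    rcases hs with ⟨hγ, hp⟩ | ⟨hγ, hp⟩
    · exact mul_neg_of_neg_of_pos (div_neg_of_pos_of_neg hT
        (mul_neg_of_neg_of_pos hγ (by positivity))) (div_pos hp hk)
    · exact mul_neg_of_pos_of_neg (by positivity) (div_neg_of_neg_of_pos hp hk)

theorem IsMinimizer.J_neg {g : ℝ → ℝ} {γ ω T C : ℝ} (hs : HasLinearSlopes g ω C) (hC : 0 < C)
    (hω : 0 < ω) [hT : Fact (0 < T)] {l j : ℕ} (hl : Odd l) (hj : GoodIndex g γ ω l j) {α : ℤ → ℝ}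
    (h : IsMinimizer g γ ω T (l ^ j) α) : J g γ ω T α < 0 := by
  obtain ⟨k, hk, hk0, hw⟩ := hj.exists_weight_neg hω hT.out hl
  obtain ⟨z, hz, hneg⟩ := exists_weightedJ_neg T (hs.abs_weight_le_const hC γ T)
    (weight_neg g γ ω T) (hl.pow) hk hk0 hw
  refine (h.2 z hz).trans_lt ?_
  rwa [J_eq_weightedJ g γ ω T hz.1]

/-- The waves generated by minimizers are weak solutions. -/
theorem IsMinimizer.isWeakSolution {g : ℝ → ℝ} {γ ω ρ C T : ℝ} {Φ Ψ V : ℤ → ℝ → ℝ}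
    (hs : IsProfileSystem g ω ρ C Φ Ψ V) (h0 : C0 g γ) (hω : 0 < ω) (hωT : ω * T = 2 * Real.pi)
    [Fact (0 < T)] {r : ℕ} (hr : Odd r) {α : ℤ → ℝ} (h : IsMinimizer g γ ω T r α) :
    IsWeakSolution g γ T (waveFun Φ ω T α) := by
  obtain ⟨f, hf, hf4⟩ := exists_isSineSeries_of_mem_DomJ (T := T) h.1.1
  refine hs.isWeakSolution_waveFun h0 hω hωT (summable_sq_of_mem_DomJ h.1.1) h.1.1.1 hf
    (hf.cube_of_minimizer hr h.1 (fun z hz => ?_)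
      (hs.hasLinearSlopes.abs_weight_le_const hs.pos_const γ T) (weight_neg g γ ω T) hf4)
  rw [← J_eq_weightedJ g γ ω T h.1.1, ← J_eq_weightedJ g γ ω T hz.1]
  exact h.2 z hz

theorem modEq_dvd {r : ℕ} {k : ℤ} (h : k ≡ r [ZMOD (2 * (r : ℤ))]) : (r : ℤ) ∣ k := by
  have h1 := (dvd_mul_left (r : ℤ) 2).trans h.dvd
  have h2 := dvd_sub (dvd_refl (r : ℤ)) h1
  rwa [sub_sub_cancel] at h2

/-- Nonzero elements of the spaces `𝒟_{l^j}`, indexed by an infinite set of exponents `j`, are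
pairwise distinct along a suitable sequence of exponents. -/
theorem exists_strictMono_pairwise_ne {l : ℕ} (hl : 1 < l) {S : Set ℕ} (hS : S.Infinite)
    {a : ℕ → ℤ → ℝ} (ha : ∀ j ∈ S, a j ∈ symDom (l ^ j)) (ha0 : ∀ j ∈ S, a j ≠ 0) :
    ∃ j : ℕ → ℕ, StrictMono j ∧ (∀ n, j n ∈ S) ∧ ∀ m n, m ≠ n → a (j m) ≠ a (j n) := by
  have hk (j : ℕ) : ∃ k : ℤ, j ∈ S → a j k ≠ 0 := by
    by_cases hj : j ∈ S
    · obtain ⟨k, hk⟩ := Function.ne_iff.1 (ha0 j hj)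
      exact ⟨k, fun _ => hk⟩
    · exact ⟨0, fun h => absurd h hj⟩
  choose k hk using hk
  have hdvd {i j : ℕ} (hj : j ∈ S) (hij : a j (k i) ≠ 0) : ((l ^ j : ℕ) : ℤ) ∣ k i :=
    modEq_dvd (not_imp_comm.1 ((ha j hj).2 (k i)) hij)
  obtain ⟨j, hjS, hj⟩ := exists_seq_of_forall_finset_exists (fun j => j ∈ S)
    (fun i j => i < j ∧ (k i).natAbs < j) (fun s _ => by
      -- Each new exponent exceeds the chosen nonzero index `k i` of every earlier element. As `l^y
      -- > y`, the number `l^y` cannot divide that index, so the new element vanishes there.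
      obtain ⟨y, hy, hlt⟩ := hS.exists_gt (s.sup fun i => max i (k i).natAbs)
      refine ⟨y, hy, fun x hx => ?_⟩
      have := Finset.le_sup (f := fun i => max i (k i).natAbs) hx
      exact max_lt_iff.1 (this.trans_lt hlt))
  have key {m n : ℕ} (hmn : m < n) : a (j m) ≠ a (j n) := by
    intro he
    have h1 := hk (j m) (hjS m)
    have hk0 : k (j m) ≠ 0 := by
      intro h0
      rw [h0] at h1
      exact h1 ((ha _ (hjS m)).1.1 0 Even.zero)
    have h2 := hdvd (hjS n) (he ▸ h1)
    have h3 := Nat.le_of_dvd (Int.natAbs_pos.2 hk0) (Int.natCast_dvd.1 h2)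
    exact absurd ((Nat.lt_pow_self hl).trans_le h3) (hj m n hmn).2.not_gt
  refine ⟨j, strictMono_nat_of_lt_succ fun n => (hj n (n + 1) (Nat.lt_succ_self n)).1, hjS,
    fun m n hmn => ?_⟩
  rcases lt_or_gt_of_ne hmn with h | h
  · exact key h
  · exact (key h).symm

end Breather

end

/-! ### The main theorem -/

open Breather in
theorem mainTheorem5 (g : ℝ → ℝ) (γ ω T : ℝ) (hω : 0 < ω) (hT : T = 2 * Real.pi / ω)
    (h0 : C0 g γ) (h1 : C1 g ω) (h2 : C2 g ω)
    (l : ℕ) (hl : Odd l) (hinf : {j : ℕ | GoodIndex g γ ω l j}.Infinite) :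
    (∃ w : ℕ → ℝ × ℝ → ℝ, (∀ n, IsWeakSolution g γ T (w n) ∧ IsNontrivial T (w n)) ∧
      PairwiseDistinct T w) ∧
    (∀ j, GoodIndex g γ ω l j →
      (∃ α, IsMinimizer g γ ω T (l ^ j) α) ∧
      ∀ α, IsMinimizer g γ ω T (l ^ j) α →
        J g γ ω T α < 0 ∧
        ∃ w, IsGeneratedBy g ω T α w ∧ IsWeakSolution g γ T w ∧ IsNontrivial T w ∧
          TimeAntiperiodic (T / (2 * (l : ℝ) ^ j)) w) ∧
    (l ≠ 1 → ∃ (j : ℕ → ℕ) (α : ℕ → ℤ → ℝ) (w : ℕ → ℝ × ℝ → ℝ),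
      StrictMono j ∧
      (∀ n, GoodIndex g γ ω l (j n) ∧ IsMinimizer g γ ω T (l ^ j n) (α n) ∧
        IsGeneratedBy g ω T (α n) (w n) ∧ IsWeakSolution g γ T (w n) ∧
        IsNontrivial T (w n)) ∧
      PairwiseDistinct T w) := by
  have hT0 : 0 < T := by
    rw [hT]
    positivity
  have : Fact (0 < T) := ⟨hT0⟩
  have hωT : ω * T = 2 * Real.pi := by
    rw [hT]
    field_simp
  obtain ⟨ρ, hρ, C, hC, Φ, Ψ, V, hprof, hev⟩ := exists_profiles h0 h1 h2
  have hs : IsProfileSystem g ω ρ C Φ Ψ V := ⟨hρ, hC, hprof, hev⟩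
  have hneg {j : ℕ} (hj : GoodIndex g γ ω l j) {α : ℤ → ℝ} (hα : IsMinimizer g γ ω T (l ^ j) α) :
      J g γ ω T α < 0 := hα.J_neg hs.hasLinearSlopes hC hω hl hj
  have hne {j : ℕ} (hj : GoodIndex g γ ω l j) {α : ℤ → ℝ} (hα : IsMinimizer g γ ω T (l ^ j) α) :
      α ≠ 0 := by
    rintro rfl
    exact (hneg hj hα).ne (J_zero g γ ω T)
  have hsol {j : ℕ} {α : ℤ → ℝ} (hα : IsMinimizer g γ ω T (l ^ j) α) :
      IsWeakSolution g γ T (waveFun Φ ω T α) := hα.isWeakSolution hs h0 hω hωT hl.pow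
  have hnon {j : ℕ} (hj : GoodIndex g γ ω l j) {α : ℤ → ℝ} (hα : IsMinimizer g γ ω T (l ^ j) α) :
      IsNontrivial T (waveFun Φ ω T α) := hs.isNontrivial_waveFun hω hωT hα.1.1 (hne hj hα)
  have hanti {j : ℕ} {α : ℤ → ℝ} (hα : IsMinimizer g γ ω T (l ^ j) α) :
      TimeAntiperiodic (T / (2 * (l : ℝ) ^ j)) (waveFun Φ ω T α) := by
    have := timeAntiperiodic_waveFun hωT Φ (pow_pos hl.pos j) hα.1
    rwa [Nat.cast_pow] at this
  choose a ha using fun j => exists_isMinimizer hs.hasLinearSlopes hC γ T (l ^ j)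
  have hseq (hl1 : l ≠ 1) : ∃ (j : ℕ → ℕ) (α : ℕ → ℤ → ℝ) (w : ℕ → ℝ × ℝ → ℝ),
      StrictMono j ∧
      (∀ n, GoodIndex g γ ω l (j n) ∧ IsMinimizer g γ ω T (l ^ j n) (α n) ∧
        IsGeneratedBy g ω T (α n) (w n) ∧ IsWeakSolution g γ T (w n) ∧
        IsNontrivial T (w n)) ∧
      PairwiseDistinct T w := by
    have hl2 : 1 < l := lt_of_le_of_ne hl.pos hl1.symm
    obtain ⟨j, hmono, hgood, hdist⟩ := exists_strictMono_pairwise_ne hl2 hinf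
      (fun j _ => (ha j).1) (fun j hj => hne hj (ha j))
    refine ⟨j, fun n => a (j n), fun n => waveFun Φ ω T (a (j n)), hmono, fun n => ⟨hgood n,
      ha _, hs.isGeneratedBy_waveFun (ha _).1.1, hsol (ha _), hnon (hgood n) (ha _)⟩, ?_⟩
    exact fun m n hmn he => hdist m n hmn
      (hs.eq_of_waveFun_ae_eq hω hωT (ha _).1.1 (ha _).1.1 he)
  refine ⟨?_, fun j hj => ⟨⟨a j, ha j⟩, fun α hα => ⟨hneg hj hα, _,
    hs.isGeneratedBy_waveFun hα.1.1, hsol hα, hnon hj hα, hanti hα⟩⟩, hseq⟩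
  -- For `l = 1` every `l^j` is `1`, and varying `j` yields nothing new. Dyadic time translates of
  -- one antiperiodic solution take the place of distinct minimizers.
  by_cases hl1 : l = 1
  · obtain ⟨j, hj⟩ := hinf.nonempty
    have hc := hs.continuous_waveFun (T := T) (summable_sq_of_mem_DomJ (ha j).1.1)
    have hp := IsProfileSystem.timePeriodic_waveFun hωT Φ (a j)
    exact ⟨_, fun n => ⟨(hsol (ha j)).shift h0.1.1 _,
      isNontrivial_shift hT0 hc hp (hnon hj (ha j)) _⟩,
      pairwiseDistinct_shift hT0 hc hp (hanti (ha j)) (hnon hj (ha j))⟩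
  · obtain ⟨j, α, w, -, h, hd⟩ := hseq hl1
    exact ⟨w, fun n => ⟨(h n).2.2.2.1, (h n).2.2.2.2⟩, hd⟩
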